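/- **Lemma (Robust hierarchical connection).** Let $N\ge 2$ and let $x=(x_1,\dots,x_N)$, $x_i\in\mathbb R^{n_i}$ (Euclidean norms). Let $f(x,t)\in\mathbb R^{n_1}\times\dots\times\mathbb R^{n_N}$ and the square matrices $\Theta_i(x,t)\in\mathbb R^{n_i\times n_i}$ be $C^1$. Put $\delta z_i=\Theta_i\,\delta x_i$ and assume that each $\Theta_i^T\Theta_i$ is uniformly positive definite for $t\ge0$. With $\Theta=\mathrm{diag}(\Theta_1,\dots,\Theta_N)$ and $\dot\Theta$ the total time derivative along $\dot x=f(x,t)$, let $F=(\dot\Theta+\Theta\,\partial f/\partial x)\Theta^{-1}$ be the generalized Jacobian, with blocks $F_{ij}$. Assume that, for all $x$ and all $t\ge0$, $F$ is block lower triangular ($F_{ij}=0$ for $i<j$) and each group is contracting with rate $\lambda_i>0$: the symmetric part of $F_{ii}$ is $\le-\lambda_iI$. (The case $N=2$ is the combination of two contracting systems with Jacobian $\begin{bmatrix}F_{11}&0\\F_{21}&F_{22}\end{bmatrix}$; the best rate is $\lambda_i=|\sup_{x,\,t\ge0}\lambda_{\max}(F_{ii})|$, where $\lambda_{\max}$ is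 the largest eigenvalue of the symmetric part.) Let $P_1$ be a solution of $\dot x=f(x,t)$ and $P_2$ a solution of $\dot x=f(x,t)+d(x,t)$ on $[0,\infty)$, $d=(d_1,\dots,d_N)$, with $t\mapsto d(P_2(t),t)$ continuous. Write $\Delta_i(t)=\|\Theta_id_i\|$ evaluated at $(P_2(t),t)$, $D^+$ for the upper right Dini derivative (the derivative where it exists), and $\|(u)_\tau\|_{\mathcal L_p}$ for the $\mathcal L_p$ norm of $u$ on $[0,\tau]$. Let $R_i(t)=\int_{P_1(t)}^{P_2(t)}\|\delta z_i\|$, in either of the following two senses. * (A) The integral at time $t$ is taken along a path from $P_1(t)$ to $P_2(t)$ that is transported by the unperturbed dynamics: a family $x(s,t)$, $-1\le s\le t$, that is $C^2$ on $\{-1\le s\le0\le t\}$ and on $\{0\le s\le t\}$, with $x(-1,t)=P_1(t)$, $x(t,t)=P_2(t)$, and $\partial_tx(s,t)=f(x(s,t),t)$ for $t\ge\max(s,0)$. Here $\Theta_i$ may depend on the whole state $x$. * (B) $R_i(t)$ is the smallest path integral, i.e. the infimum of $\int\|\delta z_i\|$ over all $C^1$ paths from $P_1(t)$ to $P_2(t)$,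 where each group has its own metric, $\Theta_i=\Theta_i(x_i,t)$ for $t\ge0$. Then each $R_i$ is continuous on $[0,\infty)$ and, for all $t\ge0$, $$D^+R_i+\lambda_iR_i\le\|\Theta_id_i\|+\sum_{j<i}\int_{P_1}^{P_2}\|F_{ij}\|\,\|\delta z_j\|,$$ where the integrals are taken along the transported path in (A), and along any $C^1$ path $\gamma$ from $P_1(t)$ to $P_2(t)$ with $\int_\gamma\|\delta z_i\|=R_i(t)$ in (B). In (B), if moreover $\|F_{ij}\|\le\sigma_{ij}$ for all $j<i$, $x$, $t\ge0$, then also $D^+R_i+\lambda_iR_i\le\|\Theta_id_i\|+\sum_{j<i}\sigma_{ij}R_j$. For $N=2$ these read $$D^+R_1+\lambda_1R_1\le\|\Theta_1d_1\|,\qquad D^+R_2+\lambda_2R_2\le\|\Theta_2d_2\|+\int_{P_1}^{P_2}\|F_{21}\|\,\|\delta z_1\|.$$ Consequently, in both senses, with $\zeta_i=1$ if $p=\infty$ and $\zeta_i=1/(\lambda_ip)^{1/p}$ if $p\in[1,\infty)$: 1. (First two groups.) Suppose $\|F_{21}(x,t)\|\le\bar\sigma$ for all $x$, $t\ge0$.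 Then for $t\ge0$ $$R_1(t)\le e^{-\lambda_1t}R_1(0)+\int_0^te^{-\lambda_1(t-r)}\Delta_1(r)\,dr,$$ $$R_2(t)\le e^{-\lambda_2t}R_2(0)+\int_0^te^{-\lambda_2(t-r)}\big(\Delta_2(r)+\bar\sigma R_1(r)\big)\,dr.$$ If $\Delta_1\le D_1$ on $[0,\infty)$, then $\limsup_{t\to\infty}R_1\le D_1/\lambda_1$; if also $\Delta_2\le D_2$ on $[0,\infty)$, then $\limsup_{t\to\infty}R_2\le\frac{D_2}{\lambda_2}+\frac{\bar\sigma}{\lambda_1\lambda_2}D_1$. For all $p\in[1,\infty]$ and $\tau\ge0$, $$\|(R_1)_\tau\|_{\mathcal L_p}\le R_1(0)\zeta_1+\frac{\|(\Delta_1)_\tau\|_{\mathcal L_p}}{\lambda_1},$$ $$\|(R_2)_\tau\|_{\mathcal L_p}\le R_2(0)\zeta_2+\frac{\bar\sigma}{\lambda_2}R_1(0)\zeta_1+\frac{\|(\Delta_2)_\tau\|_{\mathcal L_p}}{\lambda_2}+\frac{\bar\sigma}{\lambda_1\lambda_2}\|(\Delta_1)_\tau\|_{\mathcal L_p}.$$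 2. (Any number of groups.) Fix $i$ and suppose $\|F_{kj}(x,t)\|\le\sigma_{kj}$ for all $j<k\le i$, $x$, $t\ge0$. Then $R_i(t)\le e^{-\lambda_it}R_i(0)+\int_0^te^{-\lambda_i(t-r)}\big(\Delta_i(r)+\sum_{j<i}\sigma_{ij}R_j(r)\big)dr$ for $t\ge0$. If $\Delta_j\le D_j$ on $[0,\infty)$ for $j\le i$ and $U_k=\frac{D_k}{\lambda_k}+\sum_{j<k}\frac{\sigma_{kj}}{\lambda_k}U_j$, then $R_i$ converges exponentially to the error ball of radius $U_i$: $R_i(t)\le U_i+Ke^{-\mu t}$ for all $t\ge0$, for some $K$ and some $\mu>0$; so $\limsup_{t\to\infty}R_i\le U_i$. For all $p\in[1,\infty]$ and $\tau\ge0$, $\|(R_i)_\tau\|_{\mathcal L_p}\le B_i$, where $B_k=R_k(0)\zeta_k+\frac{\|(\Delta_k)_\tau\|_{\mathcal L_p}}{\lambda_k}+\sum_{j<k}\frac{\sigma_{kj}}{\lambda_k}B_j$. 3. ($\mathcal L_p$ stability.) Suppose the bounds $\|F_{kj}\|\le\sigma_{kj}$ hold for all $j<k\le N$, and $\Theta_i^T\Theta_i\ge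 c_i^2I$ with $c_i>0$ for all $x$, $t\ge0$. Let $\xi_i=\int_{P_1}^{P_2}\|\delta x_i\|$ along the transported path in (A), and $\xi_i=\|P_{2,i}-P_{1,i}\|$ in (B). If an output path length $Y$ satisfies $|Y(t)|\le\sum_i\big(\eta_i\xi_i(t)+\kappa_i\|d_i(P_2(t),t)\|\big)$ for $t\ge0$, with $\eta_i,\kappa_i\ge0$, then $\|(Y)_\tau\|_{\mathcal L_p}\le\sum_i\big(\frac{\eta_i}{c_i}B_i+\frac{\kappa_i}{c_i}\|(\Delta_i)_\tau\|_{\mathcal L_p}\big)$ for all $p\in[1,\infty]$, $\tau\ge0$. -/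

import Mathlib

open Set Filter Topology MeasureTheory
open scoped ENNReal

noncomputable section

namespace Hierarchy

/-- State space of `N` groups: the `i`-th group has state `x i ∈ ℝ^(n i)` with the Euclidean norm. -/
abbrev State {N : ℕ} (n : Fin N → ℕ) : Type :=
  (i : Fin N) → EuclideanSpace ℝ (Fin (n i))

/-- A family of coordinate transformations `Θ i (x, t)` of the virtual displacements,
`δz i = Θ i (x, t) (δx i)`; each may depend on the whole state. -/
abbrev Transformation {N : ℕ} (n : Fin N → ℕ) : Type :=
  (i : Fin N) → State n → ℝ → (EuclideanSpace ℝ (Fin (n i)) →L[ℝ] EuclideanSpace ℝ (Fin (n i)))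

section Jacobian

variable {N : ℕ} {n : Fin N → ℕ}

/-- The block diagonal transformation `Θ = diag (Θ 1, …, Θ N)` of the whole displacement. -/
def blockTheta (Θ : Transformation n) (x : State n) (t : ℝ) : State n →L[ℝ] State n :=
  ContinuousLinearMap.pi fun i => (Θ i x t).comp (ContinuousLinearMap.proj i)

/-- The total time derivative of `Θ (x, t)` along the unperturbed dynamics `x' = f (x, t)`. -/
def thetaDot (f : State n → ℝ → State n) (Θ : Transformation n) (x : State n) (t : ℝ) :
    State n →L[ℝ] State n :=
  fderiv ℝ (fun p : State n × ℝ => blockTheta Θ p.1 p.2) (x, t) (f x t, 1)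

/-- The generalized Jacobian `F = (Θ' + Θ ∂f/∂x) Θ⁻¹`. -/
def genJacobian (f : State n → ℝ → State n) (Θ : Transformation n) (x : State n) (t : ℝ) :
    State n →L[ℝ] State n :=
  (thetaDot f Θ x t + (blockTheta Θ x t).comp (fderiv ℝ (fun y => f y t) x)).comp
    (blockTheta Θ x t).inverse

/-- The block `F i j` of the generalized Jacobian. Its operator norm is its largest singular
value. -/
def jacBlock (f : State n → ℝ → State n) (Θ : Transformation n) (i j : Fin N)
    (x : State n) (t : ℝ) : EuclideanSpace ℝ (Fin (n j)) →L[ℝ] EuclideanSpace ℝ (Fin (n i)) :=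
  ((ContinuousLinearMap.proj i : State n →L[ℝ] EuclideanSpace ℝ (Fin (n i))).comp
    (genJacobian f Θ x t)).comp
      (ContinuousLinearMap.single ℝ (fun k => EuclideanSpace ℝ (Fin (n k))) j)

/-- A hierarchical combination of contracting systems: the metrics `Θᵀ Θ` are uniformly positive
definite, the generalized Jacobian is block lower triangular, and the symmetric part of each
diagonal block `F i i` is at most `-lam i`, uniformly in the state and in `t ≥ 0`. -/
structure IsContractingHierarchy (f : State n → ℝ → State n) (Θ : Transformation n)
    (lam : Fin N → ℝ) : Prop where
  smooth_field : ContDiff ℝ 1 (fun p : State n × ℝ => f p.1 p.2)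
  smooth_theta : ∀ i, ContDiff ℝ 1 (fun p : State n × ℝ => Θ i p.1 p.2)
  uniformly_pos : ∀ i, ∃ c : ℝ, 0 < c ∧ ∀ x t, 0 ≤ t → ∀ v, c * ‖v‖ ≤ ‖Θ i x t v‖
  lower_triangular : ∀ i j, i < j → ∀ x t, 0 ≤ t → jacBlock f Θ i j x t = 0
  rate_pos : ∀ i, 0 < lam i
  contracting : ∀ i x t, 0 ≤ t → ∀ v, inner ℝ v (jacBlock f Θ i i x t v) ≤ -(lam i) * ‖v‖ ^ 2

end Jacobian

section Paths

variable {N : ℕ} {n : Fin N → ℕ}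

/-- `∫ ‖δz i‖` at time `t` along the path `γ s`, `a ≤ s ≤ b`. -/
def zLength (Θ : Transformation n) (i : Fin N) (t : ℝ) (γ : ℝ → State n) (a b : ℝ) : ℝ :=
  ∫ s in a..b, ‖Θ i (γ s) t (deriv γ s i)‖

/-- `∫ ‖δx i‖` along the path `γ s`, `a ≤ s ≤ b`. -/
def xLength (i : Fin N) (γ : ℝ → State n) (a b : ℝ) : ℝ :=
  ∫ s in a..b, ‖deriv γ s i‖

/-- `∫ ‖F i j‖ ‖δz j‖` at time `t` along the path `γ s`, `a ≤ s ≤ b`. -/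
def coupling (f : State n → ℝ → State n) (Θ : Transformation n) (i j : Fin N) (t : ℝ)
    (γ : ℝ → State n) (a b : ℝ) : ℝ :=
  ∫ s in a..b, ‖jacBlock f Θ i j (γ s) t‖ * ‖Θ j (γ s) t (deriv γ s j)‖

/-- Continuously differentiable paths from `p` to `q`, parametrized by `[0, 1]`. -/
structure IsPath (γ : ℝ → State n) (p q : State n) : Prop where
  smooth : ContDiff ℝ 1 γ
  source : γ 0 = p
  target : γ 1 = q

/-- The smallest path integral `∫ ‖δz i‖` from `p` to `q` at time `t`. -/
def zDist (Θ : Transformation n) (i : Fin N) (t : ℝ) (p q : State n) : ℝ :=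
  sInf {L : ℝ | ∃ γ : ℝ → State n, IsPath γ p q ∧ L = zLength Θ i t γ 0 1}

/-- A path from `P₁ t` to `P₂ t` that is carried along by the unperturbed flow: at time `t` it is
`s ↦ x s t`, `-1 ≤ s ≤ t`. The part `-1 ≤ s ≤ 0` is a path from `P₁` to `P₂` chosen at time `0`;
the point with label `s ≥ 0` is released by the perturbed trajectory `P₂` at time `s`. After its
release every point follows the unperturbed dynamics. -/
structure IsTransportedPath (f : State n → ℝ → State n) (P₁ P₂ : ℝ → State n)
    (x : ℝ → ℝ → State n) : Prop where
  smooth_initial : ContDiffOn ℝ 2 (fun p : ℝ × ℝ => x p.1 p.2) {p | -1 ≤ p.1 ∧ p.1 ≤ 0 ∧ 0 ≤ p.2}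
  smooth_released : ContDiffOn ℝ 2 (fun p : ℝ × ℝ => x p.1 p.2) {p | 0 ≤ p.1 ∧ p.1 ≤ p.2}
  flow : ∀ s, -1 ≤ s → IsIntegralCurveOn (x s) (fun t y => f y t) (Ici (max s 0))
  source : ∀ t, 0 ≤ t → x (-1) t = P₁ t
  target : ∀ t, 0 ≤ t → x t t = P₂ t

end Paths

/-- The upper right Dini derivative. -/
def upperDini (R : ℝ → ℝ) (t : ℝ) : EReal :=
  limsup (fun h : ℝ => (((R (t + h) - R t) / h : ℝ) : EReal)) (𝓝[>] 0)

/-- The norm `‖(u)_τ‖` in `L_p` of the truncation of `u` to `[0, τ]`. -/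
def truncNorm {G : Type*} [NormedAddCommGroup G] (p : ℝ≥0∞) (τ : ℝ) (u : ℝ → G) : ℝ≥0∞ :=
  eLpNorm u p (volume.restrict (Icc 0 τ))

/-- `ζ = 1` for `p = ∞` and `ζ = 1 / (lam p)^(1/p)` for finite `p`. -/
def zeta (lam : ℝ) (p : ℝ≥0∞) : ℝ :=
  if p = ⊤ then 1 else 1 / (lam * p.toReal) ^ (1 / p.toReal)

/-- The solution `B` of the recursion `B i = a i + ∑_{j < i} g i j * B j`. -/
def recBound {α : Type*} [Semiring α] {N : ℕ} (a : Fin N → α) (g : Fin N → Fin N → α)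
    (i : Fin N) : α :=
  a i + ∑ j : Fin i.val, g i ⟨j.val, j.isLt.trans i.isLt⟩ *
    recBound a g ⟨j.val, j.isLt.trans i.isLt⟩
termination_by i.val
decreasing_by exact j.isLt

/-- The recursive `L_p` bounds for the path lengths `R i`, with `δ i = ‖Θ i d i‖`. -/
def lpBound {N : ℕ} (lam : Fin N → ℝ) (σ : Fin N → Fin N → ℝ) (δ R : Fin N → ℝ → ℝ)
    (p : ℝ≥0∞) (τ : ℝ) (i : Fin N) : ℝ≥0∞ :=
  recBound
    (fun k => ENNReal.ofReal (R k 0 * zeta (lam k) p)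
      + ENNReal.ofReal (1 / lam k) * truncNorm p τ (δ k))
    (fun k j => ENNReal.ofReal (σ k j / lam k)) i

/-- Error bounds for two groups with rates `l₁, l₂`, coupling bound `s`, disturbances
`δ₁ = ‖Θ₁ d₁‖`, `δ₂ = ‖Θ₂ d₂‖` and path lengths `R₁, R₂`. -/
structure TwoGroupBounds (l₁ l₂ s : ℝ) (δ₁ δ₂ R₁ R₂ : ℝ → ℝ) : Prop where
  transient₁ : ∀ t, 0 ≤ t →
    R₁ t ≤ Real.exp (-l₁ * t) * R₁ 0 + ∫ τ in (0 : ℝ)..t, Real.exp (-l₁ * (t - τ)) * δ₁ τ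
  transient₂ : ∀ t, 0 ≤ t →
    R₂ t ≤ Real.exp (-l₂ * t) * R₂ 0
      + ∫ τ in (0 : ℝ)..t, Real.exp (-l₂ * (t - τ)) * (δ₂ τ + s * R₁ τ)
  ultimate₁ : ∀ D₁, (∀ t, 0 ≤ t → δ₁ t ≤ D₁) →
    limsup (fun t => (R₁ t : EReal)) atTop ≤ ((D₁ / l₁ : ℝ) : EReal)
  ultimate₂ : ∀ D₁ D₂, (∀ t, 0 ≤ t → δ₁ t ≤ D₁) → (∀ t, 0 ≤ t → δ₂ t ≤ D₂) →
    limsup (fun t => (R₂ t : EReal)) atTop ≤ ((D₂ / l₂ + s / (l₁ * l₂) * D₁ : ℝ) : EReal)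
  lp₁ : ∀ (p : ℝ≥0∞) (τ : ℝ), 1 ≤ p → 0 ≤ τ →
    truncNorm p τ R₁ ≤ ENNReal.ofReal (R₁ 0 * zeta l₁ p)
      + ENNReal.ofReal (1 / l₁) * truncNorm p τ δ₁
  lp₂ : ∀ (p : ℝ≥0∞) (τ : ℝ), 1 ≤ p → 0 ≤ τ →
    truncNorm p τ R₂ ≤
      ENNReal.ofReal (R₂ 0 * zeta l₂ p) + ENNReal.ofReal (s / l₂ * R₁ 0 * zeta l₁ p)
      + ENNReal.ofReal (1 / l₂) * truncNorm p τ δ₂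
      + ENNReal.ofReal (s / (l₁ * l₂)) * truncNorm p τ δ₁

/-- Error bounds for the `i`-th of `N` groups, obtained by recursion over the groups before it. -/
structure GroupBounds {N : ℕ} (lam : Fin N → ℝ) (σ : Fin N → Fin N → ℝ)
    (δ R : Fin N → ℝ → ℝ) (i : Fin N) : Prop where
  transient : ∀ t, 0 ≤ t →
    R i t ≤ Real.exp (-(lam i) * t) * R i 0
      + ∫ τ in (0 : ℝ)..t,
          Real.exp (-(lam i) * (t - τ)) * (δ i τ + ∑ j ∈ Finset.Iio i, σ i j * R j τ)
  ultimate : ∀ D : Fin N → ℝ, (∀ j ≤ i, ∀ t, 0 ≤ t → δ j t ≤ D j) →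
    (∃ K μ : ℝ, 0 < μ ∧ ∀ t, 0 ≤ t →
      R i t ≤ recBound (fun k => D k / lam k) (fun k j => σ k j / lam k) i
        + K * Real.exp (-μ * t)) ∧
    limsup (fun t => (R i t : EReal)) atTop ≤
      ((recBound (fun k => D k / lam k) (fun k j => σ k j / lam k) i : ℝ) : EReal)
  lp : ∀ (p : ℝ≥0∞) (τ : ℝ), 1 ≤ p → 0 ≤ τ →
    truncNorm p τ (R i) ≤ lpBound lam σ δ R p τ i

section Bounds

variable {m : ℕ} {n : Fin (m + 2) → ℕ}

/-- The size `‖Θ i d i‖` of the transformed disturbance of group `i` along the trajectory `P₂`. -/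
def disturbance (Θ : Transformation n) (d : State n → ℝ → State n) (P₂ : ℝ → State n)
    (i : Fin (m + 2)) (t : ℝ) : ℝ :=
  ‖Θ i (P₂ t) t (d (P₂ t) t i)‖

/-- All error bounds for path lengths `R i`, each under the boundedness of the coupling blocks
that it involves; `ξ i` is the length `∫ ‖δx i‖` entering the output. -/
structure ErrorBounds (f : State n → ℝ → State n) (Θ : Transformation n)
    (lam : Fin (m + 2) → ℝ) (d : State n → ℝ → State n) (P₂ : ℝ → State n)
    (R ξ : Fin (m + 2) → ℝ → ℝ) : Prop where
  two_groups : ∀ s : ℝ, (∀ x t, 0 ≤ t → ‖jacBlock f Θ 1 0 x t‖ ≤ s) →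
    TwoGroupBounds (lam 0) (lam 1) s (disturbance Θ d P₂ 0) (disturbance Θ d P₂ 1) (R 0) (R 1)
  all_groups : ∀ (σ : Fin (m + 2) → Fin (m + 2) → ℝ) (i : Fin (m + 2)),
    (∀ k ≤ i, ∀ j < k, ∀ x t, 0 ≤ t → ‖jacBlock f Θ k j x t‖ ≤ σ k j) →
    GroupBounds lam σ (disturbance Θ d P₂) R i
  /-- Finite-gain `L_p` stability; `c i` is the square root of a lower bound of `(Θ i)ᵀ (Θ i)`, and
  `y` is the length of the output path. -/
  output : ∀ σ : Fin (m + 2) → Fin (m + 2) → ℝ,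
    (∀ k, ∀ j < k, ∀ x t, 0 ≤ t → ‖jacBlock f Θ k j x t‖ ≤ σ k j) →
    ∀ c : Fin (m + 2) → ℝ, (∀ i, 0 < c i) →
    (∀ i x t, 0 ≤ t → ∀ v, c i * ‖v‖ ≤ ‖Θ i x t v‖) →
    ∀ η κ : Fin (m + 2) → ℝ, (∀ i, 0 ≤ η i) → (∀ i, 0 ≤ κ i) → ∀ y : ℝ → ℝ,
    (∀ t, 0 ≤ t → |y t| ≤ ∑ i, (η i * ξ i t + κ i * ‖d (P₂ t) t i‖)) →
    ∀ (p : ℝ≥0∞) (τ : ℝ), 1 ≤ p → 0 ≤ τ →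
    truncNorm p τ y ≤ ∑ i, (ENNReal.ofReal (η i / c i) *
        lpBound lam σ (disturbance Θ d P₂) R p τ i
      + ENNReal.ofReal (κ i / c i) * truncNorm p τ (disturbance Θ d P₂ i))

end Bounds

end Hierarchy

end

/-! In the coordinates `δz = Θ δx` the variational equation is `(δz)' = F δz`. Since `F` is block
lower triangular and the symmetric part of `F i i` is at most `-lam i`, the norm `‖δz i‖` decays at
rate `lam i` up to the inputs `‖F i j‖ ‖δz j‖` with `j < i`. Integrating along a path joining `P₁`
to `P₂` gives the differential inequality for `R i`. The disturbance acts only at the end point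
`P₂`, where it lengthens the path at speed `‖Θ i d i‖`. The decay is used as a one-step estimate `‖z
+ h A z‖ ≤ (1 - h lam)‖z‖ + O(h²)` (`norm_add_smul_jacBlock_le`), so the norm is never
differentiated at zero.

For a transported path, `exists_length_step` treats the labels already released, and the labels
released during a time step `k` contribute `k ‖Θ i d i‖ + o(k)`, because the displacement at the
moving end is exactly `d` (`labelDeriv_diagonal`).

For smallest path integrals a nearly shortest path is pushed forward by one explicit Euler step, so
no flow map is needed (`exists_zLength_step`). The triangle inequality then reaches the true end
points: `P₁` is missed by `o(k)`, and `P₂` by `k ‖Θ i d i‖ + o(k)` (`eventually_zDist_step`).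
Minimisers need not exist, and those of different groups differ; but when each `Θ i` sees only its
own group, nearly shortest paths can be assembled component by component into one that serves all
groups (`exists_path_forall_le`).

The rest is scalar. Comparison bounds `R i` by its initial decay plus the exponential filter of its
input; this filter has `L_p` gain at most `1 / lam i` for every `p` (`truncNorm_expConv_le`), and
the hierarchy is resolved by induction on the group index. `errorBounds_of_upperDini` does this once
for both notions of length. -/

namespace Hierarchy

/-! ### Upper Dini derivatives -/

section Dini

/-- Converts one-step estimates with an arbitrarily small slack per unit time into the Dini
inequalities of the theorem. -/
theorem upperDini_add_le {R : ℝ → ℝ} {t a b : ℝ}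
    (h : ∀ ε > 0, ∀ᶠ s in 𝓝[>] (0 : ℝ), R (t + s) - R t ≤ s * (b - a + ε)) :
    upperDini R t + (a : EReal) ≤ (b : EReal) := by
  have key : upperDini R t ≤ ((b - a : ℝ) : EReal) := by
    refine EReal.le_of_forall_lt_iff_le.1 fun z hz => ?_
    have hz' : b - a < z := EReal.coe_lt_coe_iff.1 hz
    refine limsup_le_of_le (by isBoundedDefault) ?_
    filter_upwards [h (z - (b - a)) (sub_pos.2 hz'), self_mem_nhdsWithin] with s hs hs0
    have hs0' : (0 : ℝ) < s := hs0
    rw [EReal.coe_le_coe_iff, div_le_iff₀ hs0']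
    linarith
  calc upperDini R t + (a : EReal) ≤ ((b - a : ℝ) : EReal) + (a : EReal) := add_le_add_left key _
    _ = (b : EReal) := by rw [← EReal.coe_add, sub_add_cancel]

/-- The converse passage, in the form asked for by
`image_le_of_liminf_slope_right_lt_deriv_boundary`. -/
theorem eventually_slope_lt_of_upperDini {R : ℝ → ℝ} {t a b r : ℝ}
    (h : upperDini R t + (a : EReal) ≤ (b : EReal)) (hr : b - a < r) :
    ∀ᶠ z in 𝓝[>] t, slope R t z < r := by
  have h1 : upperDini R t ≤ ((b - a : ℝ) : EReal) := by
    rw [EReal.coe_sub]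
    exact EReal.le_sub_iff_add_le (Or.inl (EReal.coe_ne_bot a)) (Or.inl (EReal.coe_ne_top a)) |>.2 h
  have h2 : upperDini R t < (r : EReal) := h1.trans_lt (EReal.coe_lt_coe_iff.2 hr)
  have h3 := eventually_lt_of_limsup_lt h2
  have h4 : Tendsto (fun z : ℝ => z - t) (𝓝[>] t) (𝓝[>] 0) := by
    refine tendsto_nhdsWithin_iff.2 ⟨?_, ?_⟩
    · have : Tendsto (fun z : ℝ => z - t) (𝓝 t) (𝓝 (t - t)) :=
        (continuous_id.sub continuous_const).tendsto t
      rw [sub_self] at this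
      exact this.mono_left nhdsWithin_le_nhds
    · filter_upwards [self_mem_nhdsWithin] with z hz
      exact sub_pos.2 (mem_Ioi.1 hz)
  filter_upwards [h4.eventually h3] with z hz
  rw [EReal.coe_lt_coe_iff, add_sub_cancel] at hz
  rwa [slope_def_field]

end Dini

/-! ### The first-order filter and scalar comparison -/

section ExponentialConvolution

/-- The response at time `t` of the filter `w' = -l w + u`, `w 0 = 0`. -/
noncomputable def expConv (l : ℝ) (u : ℝ → ℝ) (t : ℝ) : ℝ :=
  ∫ τ in (0 : ℝ)..t, Real.exp (-l * (t - τ)) * u τ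

/-- With `t` moved out of the integrand, the fundamental theorem of calculus applies directly. -/
theorem expConv_eq (l : ℝ) (u : ℝ → ℝ) (t : ℝ) :
    expConv l u t = Real.exp (-l * t) * ∫ τ in (0 : ℝ)..t, Real.exp (l * τ) * u τ := by
  rw [expConv, ← intervalIntegral.integral_const_mul]
  congr 1
  ext τ
  rw [← mul_assoc, ← Real.exp_add]
  congr 3
  ring

theorem expConv_congr {l : ℝ} {u v : ℝ → ℝ} {t : ℝ} (ht : 0 ≤ t) (h : ∀ s, 0 ≤ s → u s = v s) :
    expConv l u t = expConv l v t := by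
  refine intervalIntegral.integral_congr fun s hs => ?_
  rw [uIcc_of_le ht] at hs
  simp only [h s hs.1]

theorem hasDerivAt_expConv {l : ℝ} {u : ℝ → ℝ} (hu : Continuous u) (t : ℝ) :
    HasDerivAt (expConv l u) (u t - l * expConv l u t) t := by
  have hc : Continuous fun τ => Real.exp (l * τ) * u τ := by fun_prop
  have h1 : HasDerivAt (fun t => ∫ τ in (0 : ℝ)..t, Real.exp (l * τ) * u τ)
      (Real.exp (l * t) * u t) t :=
    intervalIntegral.integral_hasDerivAt_right (hc.intervalIntegrable _ _)
      (hc.stronglyMeasurableAtFilter _ _) hc.continuousAt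
  have h2 : HasDerivAt (fun t : ℝ => Real.exp (-l * t)) (Real.exp (-l * t) * -l) t := by
    simpa using ((hasDerivAt_id t).const_mul (-l)).exp
  have h3 := h2.mul h1
  have h4 : expConv l u = fun t => Real.exp (-l * t) * ∫ τ in (0 : ℝ)..t, Real.exp (l * τ) * u τ :=
    funext (expConv_eq l u)
  have h5 : Real.exp (-l * t) * (Real.exp (l * t) * u t) = u t := by
    rw [← mul_assoc, ← Real.exp_add]
    simp
  rw [h5, mul_right_comm] at h3
  rw [h4]
  exact h3.congr_deriv (by ring)

theorem continuous_expConv {l : ℝ} {u : ℝ → ℝ} (hu : Continuous u) : Continuous (expConv l u) :=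
  continuous_iff_continuousAt.2 fun t => (hasDerivAt_expConv hu t).continuousAt

theorem expConv_nonneg {l : ℝ} {u : ℝ → ℝ} {t : ℝ} (ht : 0 ≤ t) (hu : ∀ s, 0 ≤ s → 0 ≤ u s) :
    0 ≤ expConv l u t :=
  intervalIntegral.integral_nonneg ht fun s hs => mul_nonneg (Real.exp_pos _).le (hu s hs.1)

theorem expConv_const {l : ℝ} (hl : 0 < l) (c t : ℝ) :
    expConv l (fun _ => c) t = c / l * (1 - Real.exp (-l * t)) := by
  have : ∫ τ in (0 : ℝ)..t, Real.exp (l * τ) * c = (Real.exp (l * t) - 1) / l * c := by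
    rw [intervalIntegral.integral_mul_const]
    simp [intervalIntegral.integral_comp_mul_left (fun x => Real.exp x) hl.ne']
    left
    field_simp
  rw [expConv_eq, this]
  have h : Real.exp (-l * t) * Real.exp (l * t) = 1 := by rw [← Real.exp_add]; simp
  have h' : Real.exp (-l * t) * ((Real.exp (l * t) - 1) / l * c)
      = c / l * (Real.exp (-l * t) * Real.exp (l * t) - Real.exp (-l * t)) := by ring
  rw [h', h]

/-- The strict inequality `μ < l` excludes resonance, where a term `t e^{-lt}` would appear. -/
theorem expConv_exp {l μ : ℝ} (h : μ < l) (K t : ℝ) :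
    expConv l (fun s => K * Real.exp (-μ * s)) t
      = K / (l - μ) * (Real.exp (-μ * t) - Real.exp (-l * t)) := by
  have h0 : l - μ ≠ 0 := (sub_pos.2 h).ne'
  have h1 : ∫ τ in (0 : ℝ)..t, Real.exp (l * τ) * (K * Real.exp (-μ * τ))
      = (Real.exp ((l - μ) * t) - 1) / (l - μ) * K := by
    have : ∀ τ : ℝ, Real.exp (l * τ) * (K * Real.exp (-μ * τ)) = Real.exp ((l - μ) * τ) * K := by
      intro τ
      rw [mul_left_comm, ← Real.exp_add, mul_comm]
      congr 2
      ring
    simp_rw [this]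
    rw [intervalIntegral.integral_mul_const]
    simp [intervalIntegral.integral_comp_mul_left (fun x => Real.exp x) h0]
    left
    field_simp
  rw [expConv_eq, h1]
  have h2 : Real.exp (-l * t) * Real.exp ((l - μ) * t) = Real.exp (-μ * t) := by
    rw [← Real.exp_add]
    congr 1
    ring
  rw [← h2]
  have h3 : Real.exp (-l * t) * Real.exp ((l - μ) * t) - Real.exp (-l * t)
      = Real.exp (-l * t) * (Real.exp ((l - μ) * t) - 1) := by ring
  rw [h3]
  ring

theorem intervalIntegrable_exp_mul {l t : ℝ} {u : ℝ → ℝ} (ht : 0 ≤ t)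
    (hu : ContinuousOn u (Ici 0)) :
    IntervalIntegrable (fun τ => Real.exp (-l * (t - τ)) * u τ) volume 0 t := by
  refine ContinuousOn.intervalIntegrable ?_
  rw [uIcc_of_le ht]
  exact (by fun_prop : Continuous fun τ => Real.exp (-l * (t - τ))).continuousOn.mul
    (hu.mono Icc_subset_Ici_self)

theorem expConv_mono {l t : ℝ} {u v : ℝ → ℝ} (ht : 0 ≤ t) (hu : ContinuousOn u (Ici 0))
    (hv : ContinuousOn v (Ici 0)) (h : ∀ s, 0 ≤ s → u s ≤ v s) :
    expConv l u t ≤ expConv l v t :=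
  intervalIntegral.integral_mono_on ht (intervalIntegrable_exp_mul ht hu)
    (intervalIntegrable_exp_mul ht hv) fun s hs =>
      mul_le_mul_of_nonneg_left (h s hs.1) (Real.exp_pos _).le

theorem expConv_add {l t : ℝ} {u v : ℝ → ℝ} (ht : 0 ≤ t) (hu : ContinuousOn u (Ici 0))
    (hv : ContinuousOn v (Ici 0)) :
    expConv l (fun s => u s + v s) t = expConv l u t + expConv l v t := by
  simp only [expConv, mul_add]
  exact intervalIntegral.integral_add (intervalIntegrable_exp_mul ht hu)
    (intervalIntegrable_exp_mul ht hv)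

/-- Inputs are controlled only for `t ≥ 0`. Freezing them at their initial value for negative times
gives a globally continuous input with the same response on `[0, ∞)`. -/
theorem continuous_comp_max_zero {u : ℝ → ℝ} (hu : ContinuousOn u (Ici 0)) :
    Continuous fun s => u (max s 0) :=
  hu.comp_continuous (by fun_prop) fun _ => mem_Ici.2 (le_max_right _ _)

/-- A scalar comparison principle: a Dini differential inequality `D⁺R + l R ≤ b` bounds `R` by the
solution of the corresponding equation. -/
theorem le_exp_add_expConv_of_upperDini {R b : ℝ → ℝ} {l : ℝ} (hl : 0 < l)
    (hR : ContinuousOn R (Ici 0)) (hb : ContinuousOn b (Ici 0))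
    (h : ∀ t, 0 ≤ t → upperDini R t + ((l * R t : ℝ) : EReal) ≤ (b t : EReal)) {t : ℝ}
    (ht : 0 ≤ t) : R t ≤ Real.exp (-l * t) * R 0 + expConv l b t := by
  have hb' := continuous_comp_max_zero hb
  -- The comparison theorem needs a strict inequality of slopes wherever the two functions meet;
  -- raising the input by `ε` provides it.
  have key : ∀ ε > 0, R t ≤ Real.exp (-l * t) * R 0 + expConv l (fun s => b (max s 0) + ε) t := by
    intro ε hε
    have hcu : Continuous fun s => b (max s 0) + ε := hb'.add continuous_const
    have hd : ∀ s, HasDerivAt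
        (fun s => Real.exp (-l * s) * R 0 + expConv l (fun s => b (max s 0) + ε) s)
        (Real.exp (-l * s) * -l * R 0
          + (b (max s 0) + ε - l * expConv l (fun s => b (max s 0) + ε) s)) s := by
      intro s
      have h2 : HasDerivAt (fun t : ℝ => Real.exp (-l * t)) (Real.exp (-l * s) * -l) s := by
        simpa using ((hasDerivAt_id s).const_mul (-l)).exp
      exact (h2.mul_const _).add (hasDerivAt_expConv hcu s)
    refine image_le_of_liminf_slope_right_lt_deriv_boundary (f' := fun s => b s - l * R s)
      (hR.mono Icc_subset_Ici_self)
      (fun x hx r hr => (eventually_slope_lt_of_upperDini (h x hx.1) hr).frequently)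
      ?_ hd ?_ (right_mem_Icc.2 ht)
    · simp [expConv]
    · intro x hx hxx
      rw [hxx, max_eq_left hx.1]
      linarith
  refine le_of_forall_pos_le_add fun ε hε => ?_
  -- An extra input `ε l` raises the response by `ε (1 - e^{-lt}) ≤ ε`.
  have h1 := key (ε * l) (mul_pos hε hl)
  rw [expConv_add ht hb'.continuousOn continuousOn_const, expConv_const hl,
    mul_div_cancel_right₀ _ hl.ne'] at h1
  have h2 : expConv l (fun s => b (max s 0)) t = expConv l b t :=
    expConv_congr ht fun s hs => by rw [max_eq_left hs]
  have h3 : 0 ≤ ε * Real.exp (-l * t) := mul_nonneg hε.le (Real.exp_pos _).le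
  rw [h2] at h1
  linarith

end ExponentialConvolution

/-! ### `L_p` estimates for the filter -/

section Norms

theorem memLp_restrict_Icc {T : ℝ} {u : ℝ → ℝ} (hu : ContinuousOn u (Ici 0)) (p : ℝ≥0∞) :
    MemLp u p (volume.restrict (Icc 0 T)) := by
  have hc : ContinuousOn u (Icc 0 T) := hu.mono Icc_subset_Ici_self
  obtain ⟨C, hC⟩ := isCompact_Icc.exists_bound_of_continuousOn hc
  exact MemLp.of_bound (hc.aestronglyMeasurable measurableSet_Icc) C
    ((ae_restrict_iff' measurableSet_Icc).2 (Eventually.of_forall hC))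

theorem truncNorm_mono {G : Type*} [NormedAddCommGroup G] {p : ℝ≥0∞} {T : ℝ} {u : ℝ → G}
    {v : ℝ → ℝ} (h : ∀ s, 0 ≤ s → ‖u s‖ ≤ v s) : truncNorm p T u ≤ truncNorm p T v :=
  eLpNorm_mono_ae_real
    ((ae_restrict_iff' measurableSet_Icc).2 (Eventually.of_forall fun s hs => h s hs.1))

theorem truncNorm_add_le {p : ℝ≥0∞} (hp : 1 ≤ p) {T : ℝ} {u v : ℝ → ℝ}
    (hu : ContinuousOn u (Ici 0)) (hv : ContinuousOn v (Ici 0)) :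
    truncNorm p T (fun s => u s + v s) ≤ truncNorm p T u + truncNorm p T v :=
  eLpNorm_add_le (memLp_restrict_Icc hu p).1 (memLp_restrict_Icc hv p).1 hp

theorem truncNorm_sum_le {ι : Type*} (S : Finset ι) {p : ℝ≥0∞} (hp : 1 ≤ p) {T : ℝ}
    {u : ι → ℝ → ℝ} (hu : ∀ i ∈ S, ContinuousOn (u i) (Ici 0)) :
    truncNorm p T (fun s => ∑ i ∈ S, u i s) ≤ ∑ i ∈ S, truncNorm p T (u i) := by
  have h := eLpNorm_sum_le (μ := volume.restrict (Icc 0 T)) (f := u) (s := S)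
    (fun i hi => (memLp_restrict_Icc (hu i hi) p).1) hp
  have h2 : (∑ i ∈ S, u i) = fun s => ∑ i ∈ S, u i s := by
    ext s
    simp
  rwa [h2] at h

theorem truncNorm_const_mul {p : ℝ≥0∞} {T c : ℝ} (hc : 0 ≤ c) (u : ℝ → ℝ) :
    truncNorm p T (fun s => c * u s) = ENNReal.ofReal c * truncNorm p T u := by
  have h := eLpNorm_const_smul c u p (volume.restrict (Icc 0 T))
  rw [← ofReal_norm, Real.norm_of_nonneg hc] at h
  exact h

theorem truncNorm_eq_integral {p : ℝ≥0∞} (hp : 1 ≤ p) (hp' : p ≠ ⊤) {T : ℝ} (hT : 0 ≤ T)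
    {u : ℝ → ℝ} (hu : ContinuousOn u (Ici 0)) (h0 : ∀ s, 0 ≤ s → 0 ≤ u s) :
    truncNorm p T u = ENNReal.ofReal ((∫ s in (0 : ℝ)..T, u s ^ p.toReal) ^ p.toReal⁻¹) := by
  rw [truncNorm, MemLp.eLpNorm_eq_integral_rpow_norm (zero_lt_one.trans_le hp).ne' hp'
    (memLp_restrict_Icc hu p), intervalIntegral.integral_of_le hT, ← integral_Icc_eq_integral_Ioc]
  congr 2
  refine setIntegral_congr_fun measurableSet_Icc fun s hs => ?_
  simp only [Real.norm_of_nonneg (h0 s hs.1)]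

/-- An energy argument: `W = l * expConv l u` solves `W' = l (u - W)` with `W 0 = 0`, so the
integral of `(W^q)'` is `W(T)^q ≥ 0`. By Young's inequality that integrand is at most `l (u^q -
W^q)`. -/
theorem integral_expConv_rpow_le {l q T : ℝ} {u : ℝ → ℝ} (hl : 0 < l) (hq : 1 ≤ q) (hT : 0 ≤ T)
    (hu : Continuous u) (h0 : ∀ s, 0 ≤ s → 0 ≤ u s) :
    ∫ s in (0 : ℝ)..T, (l * expConv l u s) ^ q ≤ ∫ s in (0 : ℝ)..T, u s ^ q := by
  set W := fun s => l * expConv l u s with hW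
  have hq0 : 0 < q := zero_lt_one.trans_le hq
  have hWc : Continuous W := continuous_const.mul (continuous_expConv hu)
  have hW0 : ∀ s, 0 ≤ s → 0 ≤ W s := fun s hs => mul_nonneg hl.le (expConv_nonneg hs h0)
  have hWd : ∀ s, HasDerivAt W (l * (u s - W s)) s := fun s => (hasDerivAt_expConv hu s).const_mul l
  have hWp : ∀ s, HasDerivAt (fun s => W s ^ q) (l * (u s - W s) * q * W s ^ (q - 1)) s :=
    fun s => (hWd s).rpow_const (Or.inr hq)
  have hc1 : Continuous fun s => W s ^ (q - 1) :=
    hWc.rpow_const fun _ => Or.inr (sub_nonneg.2 hq)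
  have hcq : Continuous fun s => W s ^ q := hWc.rpow_const fun _ => Or.inr hq0.le
  have huq : Continuous fun s => u s ^ q := hu.rpow_const fun _ => Or.inr hq0.le
  have hint := intervalIntegral.integral_eq_sub_of_hasDerivAt (a := 0) (b := T) (fun s _ => hWp s)
    ((by fun_prop : Continuous fun s => l * (u s - W s) * q * W s ^ (q - 1)).intervalIntegrable _ _)
  have hW00 : W 0 = 0 := by simp [hW, expConv]
  rw [hW00, Real.zero_rpow hq0.ne', sub_zero] at hint
  have hpos : 0 ≤ ∫ s in (0 : ℝ)..T, l * (u s - W s) * q * W s ^ (q - 1) := by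
    rw [hint]
    exact Real.rpow_nonneg (hW0 T hT) _
  have hpt : ∀ s ∈ Icc 0 T, l * (u s - W s) * q * W s ^ (q - 1) ≤ l * (u s ^ q - W s ^ q) := by
    intro s hs
    have hu0 := h0 s hs.1
    have hw0 := hW0 s hs.1
    have hqi : 1 / q ≤ 1 := by rw [div_le_one hq0]; exact hq
    -- Young's inequality `q u W^(q-1) ≤ (q-1) W^q + u^q`, as weighted AM-GM for `W^q` and `u^q`.
    -- The weight `1 - 1/q` may vanish, so `q = 1` is included.
    have h1 := Real.geom_mean_le_arith_mean2_weighted (w₁ := 1 - 1 / q) (w₂ := 1 / q)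
      (p₁ := W s ^ q) (p₂ := u s ^ q) (by linarith) (by positivity) (by positivity) (by positivity)
      (by ring)
    rw [← Real.rpow_mul hw0, ← Real.rpow_mul hu0] at h1
    have e1 : q * (1 - 1 / q) = q - 1 := by field_simp
    have e2 : q * (1 / q) = 1 := by field_simp
    rw [e1, e2, Real.rpow_one] at h1
    have h2 : W s * W s ^ (q - 1) = W s ^ q := by
      rcases hw0.eq_or_lt with hw | hw
      · rw [← hw, zero_mul, Real.zero_rpow hq0.ne']
      · rw [mul_comm, ← Real.rpow_add_one hw.ne', sub_add_cancel]
    have h3 : q * (W s ^ (q - 1) * u s) ≤ (q - 1) * W s ^ q + u s ^ q := by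
      calc q * (W s ^ (q - 1) * u s) ≤ q * ((1 - 1 / q) * W s ^ q + 1 / q * u s ^ q) :=
            mul_le_mul_of_nonneg_left h1 hq0.le
        _ = _ := by field_simp
    have h4 : l * (u s - W s) * q * W s ^ (q - 1)
        = l * (q * (W s ^ (q - 1) * u s) - q * W s ^ q) := by
      rw [← h2]; ring
    rw [h4]
    exact mul_le_mul_of_nonneg_left (by linarith) hl.le
  have hmono := intervalIntegral.integral_mono_on (μ := volume) hT
    ((by fun_prop : Continuous fun s => l * (u s - W s) * q * W s ^ (q - 1)).intervalIntegrable _ _)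
    ((by fun_prop : Continuous fun s => l * (u s ^ q - W s ^ q)).intervalIntegrable _ _) hpt
  rw [intervalIntegral.integral_const_mul, intervalIntegral.integral_sub
    (huq.intervalIntegrable _ _) (hcq.intervalIntegrable _ _)] at hmono
  have := nonneg_of_mul_nonneg_right (hpos.trans hmono) hl
  linarith

theorem truncNorm_expConv_le_of_continuous {l T : ℝ} {u : ℝ → ℝ} {p : ℝ≥0∞} (hl : 0 < l)
    (hp : 1 ≤ p) (hT : 0 ≤ T) (hu : Continuous u) (h0 : ∀ s, 0 ≤ s → 0 ≤ u s) :
    truncNorm p T (fun s => l * expConv l u s) ≤ truncNorm p T u := by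
  have hW0 : ∀ s, 0 ≤ s → 0 ≤ l * expConv l u s := fun s hs =>
    mul_nonneg hl.le (expConv_nonneg hs h0)
  have hWc : Continuous fun s => l * expConv l u s := continuous_const.mul (continuous_expConv hu)
  by_cases hp' : p = ⊤
  · subst hp'
    have hfin : eLpNorm u ⊤ (volume.restrict (Icc 0 T)) ≠ ⊤ :=
      (memLp_restrict_Icc hu.continuousOn ⊤).2.ne
    set M := (eLpNorm u ⊤ (volume.restrict (Icc 0 T))).toReal with hM
    have hM0 : 0 ≤ M := ENNReal.toReal_nonneg
    -- For `p = ∞` the kernel `l e^{-l(t-τ)}` has mass `1 - e^{-lt} ≤ 1`, so an essential bound on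
    -- the input passes to the response.
    have hae : ∀ᵐ s ∂(volume.restrict (Icc 0 T)), u s ≤ M := by
      have h1 := ae_le_eLpNormEssSup (f := u) (μ := volume.restrict (Icc 0 T))
      filter_upwards [h1, ae_restrict_mem measurableSet_Icc] with s hs hs2
      rw [← eLpNorm_exponent_top, ← ENNReal.ofReal_toReal hfin, ← ofReal_norm,
        ENNReal.ofReal_le_ofReal_iff hM0] at hs
      exact (le_abs_self _).trans hs
    have hpt : ∀ t ∈ Icc 0 T, ‖l * expConv l u t‖ ≤ M := by
      intro t ht
      rw [Real.norm_of_nonneg (hW0 t ht.1)]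
      have h2 : expConv l u t ≤ expConv l (fun _ => M) t := by
        refine intervalIntegral.integral_mono_ae_restrict (μ := volume) ht.1
          (intervalIntegrable_exp_mul ht.1 hu.continuousOn)
          (intervalIntegrable_exp_mul ht.1 continuousOn_const) ?_
        filter_upwards [ae_restrict_of_ae_restrict_of_subset (Icc_subset_Icc_right ht.2) hae]
          with s hs
        exact mul_le_mul_of_nonneg_left hs (Real.exp_pos _).le
      rw [expConv_const hl] at h2
      have h3 : l * (M / l * (1 - Real.exp (-l * t))) = M * (1 - Real.exp (-l * t)) := by
        field_simp
      have h4 := mul_le_mul_of_nonneg_left h2 hl.le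
      have h5 : 0 ≤ M * Real.exp (-l * t) := mul_nonneg hM0 (Real.exp_pos _).le
      rw [h3] at h4
      linarith
    rw [truncNorm, truncNorm, ← ENNReal.ofReal_toReal hfin, eLpNorm_exponent_top]
    exact eLpNormEssSup_le_of_ae_bound
      ((ae_restrict_iff' measurableSet_Icc).2 (Eventually.of_forall hpt))
  · have hq : 1 ≤ p.toReal := by
      have := ENNReal.toReal_mono hp' hp
      simpa using this
    rw [truncNorm_eq_integral hp hp' hT hWc.continuousOn hW0,
      truncNorm_eq_integral hp hp' hT hu.continuousOn h0]
    refine ENNReal.ofReal_le_ofReal (Real.rpow_le_rpow ?_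
      (integral_expConv_rpow_le hl hq hT hu h0) (by positivity))
    exact intervalIntegral.integral_nonneg hT fun s hs => Real.rpow_nonneg (hW0 s hs.1) _

theorem truncNorm_congr {p : ℝ≥0∞} {T : ℝ} {u v : ℝ → ℝ} (h : ∀ s, 0 ≤ s → u s = v s) :
    truncNorm p T u = truncNorm p T v :=
  eLpNorm_congr_ae ((ae_restrict_iff' measurableSet_Icc).2 (Eventually.of_forall fun s hs => h s hs.1))

theorem truncNorm_expConv_le {l T : ℝ} {u : ℝ → ℝ} {p : ℝ≥0∞} (hl : 0 < l)
    (hp : 1 ≤ p) (hT : 0 ≤ T) (hu : ContinuousOn u (Ici 0)) (h0 : ∀ s, 0 ≤ s → 0 ≤ u s) :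
    truncNorm p T (expConv l u) ≤ ENNReal.ofReal (1 / l) * truncNorm p T u := by
  have h1 := truncNorm_expConv_le_of_continuous (p := p) hl hp hT (continuous_comp_max_zero hu)
    fun s hs => h0 _ (le_max_right _ _)
  have h2 : truncNorm p T (fun s => u (max s 0)) = truncNorm p T u :=
    truncNorm_congr fun s hs => by rw [max_eq_left hs]
  rw [h2] at h1
  have h3 : truncNorm p T (expConv l u)
      = truncNorm p T (fun s => 1 / l * (l * expConv l (fun s => u (max s 0)) s)) := by
    refine truncNorm_congr fun s hs => ?_
    rw [← mul_assoc, one_div_mul_cancel hl.ne', one_mul]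
    exact expConv_congr hs fun r hr => by rw [max_eq_left hr]
  rw [h3, truncNorm_const_mul (by positivity)]
  gcongr

/-- `zeta l p` is the `L_p` norm of `e^{-ls}` over the whole half-line; truncation can only decrease
it. -/
theorem truncNorm_exp_le {l T c : ℝ} {p : ℝ≥0∞} (hl : 0 < l) (hp : 1 ≤ p) (hT : 0 ≤ T)
    (hc : 0 ≤ c) :
    truncNorm p T (fun s => Real.exp (-l * s) * c) ≤ ENNReal.ofReal (c * zeta l p) := by
  have hpos : ∀ s : ℝ, 0 ≤ s → 0 ≤ Real.exp (-l * s) * c := fun s _ =>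
    mul_nonneg (Real.exp_pos _).le hc
  by_cases hp' : p = ⊤
  · subst hp'
    rw [truncNorm, eLpNorm_exponent_top, zeta, if_pos rfl, mul_one]
    refine eLpNormEssSup_le_of_ae_bound ((ae_restrict_iff' measurableSet_Icc).2
      (Eventually.of_forall fun s hs => ?_))
    rw [Real.norm_of_nonneg (hpos s hs.1)]
    have : Real.exp (-l * s) ≤ 1 := Real.exp_le_one_iff.2 (by nlinarith [hs.1])
    nlinarith
  · have hq : 1 ≤ p.toReal := by
      have := ENNReal.toReal_mono hp' hp
      simpa using this
    set q := p.toReal with hqd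
    have hq0 : 0 < q := zero_lt_one.trans_le hq
    have hlq : 0 < l * q := mul_pos hl hq0
    rw [truncNorm_eq_integral hp hp' hT
      (by fun_prop : Continuous fun s => Real.exp (-l * s) * c).continuousOn hpos, zeta, if_neg hp',
      ← hqd]
    refine ENNReal.ofReal_le_ofReal ?_
    have h1 : ∫ s in (0 : ℝ)..T, (Real.exp (-l * s) * c) ^ q ≤ c ^ q * (1 / (l * q)) := by
      have e : ∀ s : ℝ, (Real.exp (-l * s) * c) ^ q = Real.exp (-(l * q) * s) * c ^ q := by
        intro s
        rw [Real.mul_rpow (Real.exp_pos _).le hc, ← Real.exp_mul]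
        congr 2
        ring
      simp_rw [e]
      have h2 := expConv_const hlq 1 T
      have h3 : ∫ s in (0 : ℝ)..T, Real.exp (-(l * q) * s)
          = 1 / (l * q) * (1 - Real.exp (-(l * q) * T)) := by
        rw [intervalIntegral.integral_comp_mul_left (fun x => Real.exp x) (neg_ne_zero.2 hlq.ne')]
        simp
        field_simp
        ring
      rw [intervalIntegral.integral_mul_const, h3, mul_comm]
      refine mul_le_mul_of_nonneg_left ?_ (Real.rpow_nonneg hc _)
      have := Real.exp_pos (-(l * q) * T)
      exact mul_le_of_le_one_right (by positivity) (by linarith)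
    calc (∫ s in (0 : ℝ)..T, (Real.exp (-l * s) * c) ^ q) ^ q⁻¹ ≤ (c ^ q * (1 / (l * q))) ^ q⁻¹ :=
          Real.rpow_le_rpow (intervalIntegral.integral_nonneg hT fun s hs =>
            Real.rpow_nonneg (hpos s hs.1) _) h1 (by positivity)
      _ = c * (1 / (l * q) ^ (1 / q)) := by
          rw [Real.mul_rpow (by positivity) (by positivity), ← Real.rpow_mul hc,
            mul_inv_cancel₀ hq0.ne', Real.rpow_one, Real.div_rpow zero_le_one hlq.le,
            Real.one_rpow, one_div q]

theorem truncNorm_le_of_transient {l T : ℝ} {R u : ℝ → ℝ} {p : ℝ≥0∞} (hl : 0 < l)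
    (hp : 1 ≤ p) (hT : 0 ≤ T) (hu : ContinuousOn u (Ici 0)) (h0 : ∀ s, 0 ≤ s → 0 ≤ u s)
    (hR : ∀ s, 0 ≤ s → 0 ≤ R s)
    (h : ∀ t, 0 ≤ t → R t ≤ Real.exp (-l * t) * R 0 + expConv l u t) :
    truncNorm p T R ≤ ENNReal.ofReal (R 0 * zeta l p)
      + ENNReal.ofReal (1 / l) * truncNorm p T u := by
  have h1 : truncNorm p T R ≤ truncNorm p T (fun s => Real.exp (-l * s) * R 0 + expConv l u s) :=
    truncNorm_mono fun s hs => by rw [Real.norm_of_nonneg (hR s hs)]; exact h s hs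
  refine h1.trans ((truncNorm_add_le hp
    (by fun_prop : Continuous fun s => Real.exp (-l * s) * R 0).continuousOn ?_).trans
    (add_le_add (truncNorm_exp_le hl hp hT (hR 0 le_rfl)) (truncNorm_expConv_le hl hp hT hu h0)))
  exact (continuous_expConv (continuous_comp_max_zero hu)).continuousOn.congr fun s hs =>
    expConv_congr hs fun r hr => by rw [max_eq_left hr]

end Norms

/-! ### Induction over the groups -/

section Recursion

/-- The sum over `Fin i.val` in the definition serves its termination proof; the estimates use sums
over `Finset.Iio i`. -/
theorem recBound_eq {α : Type*} [Semiring α] {N : ℕ} (a : Fin N → α) (g : Fin N → Fin N → α)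
    (i : Fin N) :
    recBound a g i = a i + ∑ j ∈ Finset.Iio i, g i j * recBound a g j := by
  rw [recBound]
  congr 1
  refine Finset.sum_bij (fun j _ => (⟨j.val, j.isLt.trans i.isLt⟩ : Fin N)) ?_ ?_ ?_ ?_
  · intro j _
    exact Finset.mem_Iio.2 (Fin.lt_def.2 j.isLt)
  · intro j _ k _ h
    exact Fin.ext (Fin.mk.inj_iff.1 h)
  · intro j hj
    exact ⟨⟨j.val, Fin.lt_def.1 (Finset.mem_Iio.1 hj)⟩, Finset.mem_univ _, rfl⟩
  · intro j _
    rfl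

theorem limsup_le_of_exponential {R : ℝ → ℝ} {U K μ : ℝ} (hμ : 0 < μ)
    (h : ∀ t, 0 ≤ t → R t ≤ U + K * Real.exp (-μ * t)) :
    limsup (fun t => (R t : EReal)) atTop ≤ (U : EReal) := by
  have h1 : Tendsto (fun t => U + K * Real.exp (-μ * t)) atTop (𝓝 (U + K * 0)) := by
    refine tendsto_const_nhds.add (tendsto_const_nhds.mul ?_)
    refine Real.tendsto_exp_atBot.comp ?_
    exact tendsto_id.const_mul_atTop_of_neg (neg_lt_zero.2 hμ)
  rw [mul_zero, add_zero] at h1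
  have h2 : Tendsto (fun t => ((U + K * Real.exp (-μ * t) : ℝ) : EReal)) atTop (𝓝 (U : EReal)) :=
    (continuous_coe_real_ereal.tendsto U).comp h1
  rw [← h2.limsup_eq]
  refine limsup_le_limsup ?_
  filter_upwards [eventually_ge_atTop 0] with t ht
  exact EReal.coe_le_coe_iff.2 (h t ht)

/-- The constant part of the input contributes `U (1 - e^{-lt})`, and every other term is dominated
by `e^{-μt}` because `μ < l`. No sign of `U` is assumed, hence `|U|`. -/
theorem exponential_bound_of_transient {R u : ℝ → ℝ} {l μ U K : ℝ} (hl : 0 < l) (hμl : μ < l)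
    (hu : ContinuousOn u (Ici 0)) (hK : 0 ≤ K) (hR0 : 0 ≤ R 0)
    (h : ∀ t, 0 ≤ t → R t ≤ Real.exp (-l * t) * R 0 + expConv l u t)
    (hb : ∀ t, 0 ≤ t → u t ≤ l * U + K * Real.exp (-μ * t)) {t : ℝ} (ht : 0 ≤ t) :
    R t ≤ U + (R 0 + |U| + K / (l - μ)) * Real.exp (-μ * t) := by
  have h1 : expConv l u t ≤ U * (1 - Real.exp (-l * t))
      + K / (l - μ) * (Real.exp (-μ * t) - Real.exp (-l * t)) := by
    have := expConv_mono (l := l) ht hu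
      (by fun_prop : Continuous fun t => l * U + K * Real.exp (-μ * t)).continuousOn hb
    rw [expConv_add ht continuousOn_const
      (by fun_prop : Continuous fun t => K * Real.exp (-μ * t)).continuousOn, expConv_const hl,
      expConv_exp hμl, mul_div_cancel_left₀ _ hl.ne'] at this
    exact this
  have h2 : Real.exp (-l * t) ≤ Real.exp (-μ * t) := Real.exp_le_exp.2 (by nlinarith)
  have h3 := Real.exp_pos (-l * t)
  have h4 : 0 ≤ K / (l - μ) := div_nonneg hK (sub_pos.2 hμl).le
  have h5 := h t ht
  have h6 : -U * Real.exp (-l * t) ≤ |U| * Real.exp (-μ * t) :=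
    mul_le_mul (neg_le_abs U) h2 h3.le (abs_nonneg U)
  nlinarith [mul_le_mul_of_nonneg_left h2 hR0, mul_nonneg h4 h3.le]

variable {N : ℕ} {lam : Fin N → ℝ} {σ : Fin N → Fin N → ℝ} {δ R : Fin N → ℝ → ℝ} {i : Fin N}

theorem continuousOn_forcing (hδc : ∀ k, ContinuousOn (δ k) (Ici 0))
    (hRc : ∀ k, ContinuousOn (R k) (Ici 0)) (k : Fin N) :
    ContinuousOn (fun t => δ k t + ∑ j ∈ Finset.Iio k, σ k j * R j t) (Ici 0) :=
  (hδc k).add (continuousOn_finsetSum _ fun j _ => continuousOn_const.mul (hRc j))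

/-- The induction runs over the number `M` of groups treated, so that a single pair `K, μ` serves
all of them at once. -/
theorem exists_exponential_bound (hlam : ∀ k, 0 < lam k) (hσ : ∀ k ≤ i, ∀ j < k, 0 ≤ σ k j)
    (hδc : ∀ k, ContinuousOn (δ k) (Ici 0)) (hRc : ∀ k, ContinuousOn (R k) (Ici 0))
    (hR0 : ∀ k t, 0 ≤ t → 0 ≤ R k t)
    (htrans : ∀ k ≤ i, ∀ t, 0 ≤ t → R k t ≤ Real.exp (-(lam k) * t) * R k 0
      + expConv (lam k) (fun t => δ k t + ∑ j ∈ Finset.Iio k, σ k j * R j t) t)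
    {D : Fin N → ℝ} (hD : ∀ j ≤ i, ∀ t, 0 ≤ t → δ j t ≤ D j) (M : ℕ) :
    ∃ K μ : ℝ, 0 ≤ K ∧ 0 < μ ∧ ∀ k ≤ i, k.val < M → ∀ t, 0 ≤ t →
      R k t ≤ recBound (fun k => D k / lam k) (fun k j => σ k j / lam k) k
        + K * Real.exp (-μ * t) := by
  set U := recBound (fun k => D k / lam k) (fun k j => σ k j / lam k) with hU
  induction M with
  | zero => exact ⟨0, 1, le_rfl, one_pos, fun k _ hk => absurd hk (Nat.not_lt_zero _)⟩
  | succ M ih =>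
    obtain ⟨K, μ, hK, hμ, hb⟩ := ih
    by_cases hM : ∃ k ≤ i, k.val = M
    · obtain ⟨k, hki, rfl⟩ := hM
      have hl := hlam k
      -- At most `μ`, to keep the earlier bounds, and strictly below `lam k`, to avoid resonance in
      -- the new group.
      set μ' := min μ (lam k / 2) with hμ'
      have hμ'0 : 0 < μ' := lt_min hμ (half_pos hl)
      have hμ'l : μ' < lam k := (min_le_right _ _).trans_lt (half_lt_self hl)
      set K' := ∑ j ∈ Finset.Iio k, σ k j * K with hK'
      have hK'0 : 0 ≤ K' := Finset.sum_nonneg fun j hj =>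
        mul_nonneg (hσ k hki j (Finset.mem_Iio.1 hj)) hK
      have hexp : ∀ t, 0 ≤ t → Real.exp (-μ * t) ≤ Real.exp (-μ' * t) := fun t ht =>
        Real.exp_le_exp.2 (by nlinarith [min_le_left μ (lam k / 2)])
      have hbk : ∀ t, 0 ≤ t → δ k t + ∑ j ∈ Finset.Iio k, σ k j * R j t
          ≤ lam k * U k + K' * Real.exp (-μ' * t) := by
        intro t ht
        have h1 : ∑ j ∈ Finset.Iio k, σ k j * R j t
            ≤ ∑ j ∈ Finset.Iio k, (σ k j * U j + σ k j * K * Real.exp (-μ' * t)) := by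
          refine Finset.sum_le_sum fun j hj => ?_
          have hjk := Finset.mem_Iio.1 hj
          have h2 := hb j (hjk.le.trans hki) hjk t ht
          have h3 := mul_le_mul_of_nonneg_left (hexp t ht) hK
          nlinarith [mul_le_mul_of_nonneg_left (h2.trans (by linarith :
            U j + K * Real.exp (-μ * t) ≤ U j + K * Real.exp (-μ' * t))) (hσ k hki j hjk)]
        rw [Finset.sum_add_distrib, ← Finset.sum_mul] at h1
        have h4 : lam k * U k = D k + ∑ j ∈ Finset.Iio k, σ k j * U j := by
          rw [hU, recBound_eq, mul_add, Finset.mul_sum, mul_div_cancel₀ _ hl.ne']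
          congr 1
          refine Finset.sum_congr rfl fun j _ => ?_
          field_simp
        have h5 := hD k hki t ht
        linarith
      set K2 := R k 0 + |U k| + K' / (lam k - μ') with hK2
      refine ⟨max K K2, μ', hK.trans (le_max_left _ _), hμ'0, fun j hji hjM t ht => ?_⟩
      have he := Real.exp_pos (-μ' * t)
      rcases (Nat.lt_succ_iff.1 hjM).lt_or_eq with hlt | heq
      · have h1 := hb j hji hlt t ht
        have h2 := mul_le_mul_of_nonneg_left (hexp t ht) hK
        have h3 := mul_le_mul_of_nonneg_right (le_max_left K K2) he.le
        linarith
      · obtain rfl := Fin.ext heq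
        have h1 := exponential_bound_of_transient hl hμ'l (continuousOn_forcing hδc hRc j) hK'0
          (hR0 j 0 le_rfl) (htrans j hki) hbk ht
        have h3 := mul_le_mul_of_nonneg_right (le_max_right K K2) he.le
        linarith
    -- No group `k ≤ i` has index `M`, so the induction step adds nothing.
    · refine ⟨K, μ, hK, hμ, fun k hki hkM => hb k hki ?_⟩
      exact lt_of_le_of_ne (Nat.lt_succ_iff.1 hkM) fun h => hM ⟨k, hki, h⟩

/-- Minkowski's inequality on the input, followed by the gain `1 / lam k`, reproduces the recursion
that defines `lpBound`. -/
theorem truncNorm_le_lpBound (hlam : ∀ k, 0 < lam k) (hσ : ∀ k ≤ i, ∀ j < k, 0 ≤ σ k j)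
    (hδc : ∀ k, ContinuousOn (δ k) (Ici 0)) (hδ0 : ∀ k t, 0 ≤ δ k t)
    (hRc : ∀ k, ContinuousOn (R k) (Ici 0))
    (hR0 : ∀ k t, 0 ≤ t → 0 ≤ R k t)
    (htrans : ∀ k ≤ i, ∀ t, 0 ≤ t → R k t ≤ Real.exp (-(lam k) * t) * R k 0
      + expConv (lam k) (fun t => δ k t + ∑ j ∈ Finset.Iio k, σ k j * R j t) t)
    {p : ℝ≥0∞} {T : ℝ} (hp : 1 ≤ p) (hT : 0 ≤ T) (k : Fin N) (hk : k ≤ i) :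
    truncNorm p T (R k) ≤ lpBound lam σ δ R p T k := by
  induction k using WellFoundedLT.induction with
  | ind k ih =>
    have hl := hlam k
    have hnn : ∀ j ∈ Finset.Iio k, 0 ≤ σ k j := fun j hj => hσ k hk j (Finset.mem_Iio.1 hj)
    have h1 := truncNorm_le_of_transient hl hp hT (continuousOn_forcing hδc hRc k)
      (fun s hs => add_nonneg (hδ0 k s) (Finset.sum_nonneg fun j hj =>
        mul_nonneg (hnn j hj) (hR0 j s hs))) (hR0 k) (htrans k hk)
    have h2 : truncNorm p T (fun t => δ k t + ∑ j ∈ Finset.Iio k, σ k j * R j t)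
        ≤ truncNorm p T (δ k) + ∑ j ∈ Finset.Iio k, ENNReal.ofReal (σ k j) * truncNorm p T (R j) := by
      refine (truncNorm_add_le hp (hδc k) (continuousOn_finsetSum _ fun j _ =>
        continuousOn_const.mul (hRc j))).trans (add_le_add le_rfl ?_)
      refine (truncNorm_sum_le _ hp fun j _ => continuousOn_const.mul (hRc j)).trans
        (le_of_eq (Finset.sum_congr rfl fun j hj => truncNorm_const_mul (hnn j hj) _))
    refine h1.trans ?_
    rw [lpBound, recBound_eq, add_assoc]
    refine add_le_add le_rfl ((mul_le_mul_right h2 _).trans ?_)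
    rw [mul_add, Finset.mul_sum]
    refine add_le_add le_rfl (Finset.sum_le_sum fun j hj => ?_)
    have hjk := Finset.mem_Iio.1 hj
    rw [← mul_assoc, ← ENNReal.ofReal_mul (by positivity), one_div_mul_eq_div]
    exact mul_le_mul_right (ih j hjk (hjk.le.trans hk)) _

theorem groupBounds_of_upperDini (hlam : ∀ k, 0 < lam k) (hσ : ∀ k ≤ i, ∀ j < k, 0 ≤ σ k j)
    (hδc : ∀ k, ContinuousOn (δ k) (Ici 0)) (hδ0 : ∀ k t, 0 ≤ δ k t)
    (hRc : ∀ k, ContinuousOn (R k) (Ici 0)) (hR0 : ∀ k t, 0 ≤ t → 0 ≤ R k t)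
    (hdini : ∀ k ≤ i, ∀ t, 0 ≤ t → upperDini (R k) t + ((lam k * R k t : ℝ) : EReal) ≤
      ((δ k t + ∑ j ∈ Finset.Iio k, σ k j * R j t : ℝ) : EReal)) :
    GroupBounds lam σ δ R i := by
  have htrans : ∀ k ≤ i, ∀ t, 0 ≤ t → R k t ≤ Real.exp (-(lam k) * t) * R k 0
      + expConv (lam k) (fun t => δ k t + ∑ j ∈ Finset.Iio k, σ k j * R j t) t :=
    fun k hk t ht => le_exp_add_expConv_of_upperDini (hlam k) (hRc k)
      (continuousOn_forcing hδc hRc k) (hdini k hk) ht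
  refine ⟨htrans i le_rfl, fun D hD => ?_, fun p T hp hT =>
    truncNorm_le_lpBound hlam hσ hδc hδ0 hRc hR0 htrans hp hT i le_rfl⟩
  obtain ⟨K, μ, -, hμ, hb⟩ := exists_exponential_bound hlam hσ hδc hRc hR0 htrans hD (i.val + 1)
  have hbi := hb i le_rfl (Nat.lt_succ_self _)
  exact ⟨⟨K, μ, hμ, hbi⟩, limsup_le_of_exponential hμ hbi⟩

end Recursion

/-! ### From differential inequalities to all error bounds -/

/-- For the first two groups the recursion involves only the entry `σ 1 0`, so a constant coupling
matrix does no harm. -/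
theorem GroupBounds.twoGroupBounds {m : ℕ} {lam : Fin (m + 2) → ℝ} {s : ℝ}
    {δ R : Fin (m + 2) → ℝ → ℝ} (hs : 0 ≤ s) (hlam : ∀ k, 0 < lam k)
    (h0 : GroupBounds lam (fun _ _ => s) δ R 0) (h1 : GroupBounds lam (fun _ _ => s) δ R 1) :
    TwoGroupBounds (lam 0) (lam 1) s (δ 0) (δ 1) (R 0) (R 1) := by
  have hz : Finset.Iio (0 : Fin (m + 2)) = ∅ := by
    ext j
    simp
  have ho : Finset.Iio (1 : Fin (m + 2)) = {0} := by
    ext j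
    simp [Fin.lt_one_iff]
  have hj : ∀ j : Fin (m + 2), j ≤ 1 → j = 0 ∨ j = 1 := by
    intro j hj
    rcases hj.lt_or_eq with h | h
    · exact Or.inl ((Fin.lt_one_iff j).1 h)
    · exact Or.inr h
  have hl0 := hlam 0
  have hl1 := hlam 1
  constructor
  · simpa [hz] using h0.transient
  · simpa [ho] using h1.transient
  · intro D₁ hD
    have := (h0.ultimate (fun _ => D₁) (fun j hj => by
      obtain rfl : j = 0 := Fin.le_zero_iff.1 hj
      exact hD)).2
    rw [recBound_eq, hz] at this
    simpa using this
  · intro D₁ D₂ hD₁ hD₂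
    have := (h1.ultimate (fun k => if k = 0 then D₁ else D₂) (fun j hj1 => by
      rcases hj j hj1 with rfl | rfl
      · simpa using hD₁
      · simpa using hD₂)).2
    rw [recBound_eq, ho, Finset.sum_singleton, recBound_eq, hz, Finset.sum_empty] at this
    refine this.trans_eq ?_
    congr 1
    simp only [one_ne_zero, if_true, if_false, add_zero]
    field_simp
  · intro p τ hp hτ
    have := h0.lp p τ hp hτ
    rw [lpBound, recBound_eq, hz] at this
    simpa using this
  · intro p τ hp hτ
    have := h1.lp p τ hp hτ
    rw [lpBound, recBound_eq, ho, Finset.sum_singleton, recBound_eq, hz, Finset.sum_empty,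
      add_zero, mul_add, ← mul_assoc, ← ENNReal.ofReal_mul (by positivity),
      ← ENNReal.ofReal_mul (by positivity)] at this
    refine this.trans_eq ?_
    have e1 : s / lam 1 * (R 0 0 * zeta (lam 0) p) = s / lam 1 * R 0 0 * zeta (lam 0) p := by ring
    have e2 : s / lam 1 * (1 / lam 0) = s / (lam 0 * lam 1) := by field_simp
    rw [e1, e2]
    ring

/-- Common to both notions of length, which enter only through continuity, nonnegativity, the Dini
inequalities with constant couplings, and the comparison of `ξ` with `R`. -/
theorem errorBounds_of_upperDini {m : ℕ} {n : Fin (m + 2) → ℕ} {f : State n → ℝ → State n}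
    {Θ : Transformation n} {lam : Fin (m + 2) → ℝ} {d : State n → ℝ → State n}
    {P₂ : ℝ → State n} {R ξ : Fin (m + 2) → ℝ → ℝ} (hlam : ∀ k, 0 < lam k)
    (hδc : ∀ k, ContinuousOn (disturbance Θ d P₂ k) (Ici 0))
    (hRc : ∀ k, ContinuousOn (R k) (Ici 0)) (hR0 : ∀ k t, 0 ≤ t → 0 ≤ R k t)
    (hdini : ∀ i (σ : Fin (m + 2) → ℝ),
      (∀ j < i, ∀ x t, 0 ≤ t → ‖jacBlock f Θ i j x t‖ ≤ σ j) → ∀ t, 0 ≤ t →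
      upperDini (R i) t + ((lam i * R i t : ℝ) : EReal) ≤
        ((disturbance Θ d P₂ i t + ∑ j ∈ Finset.Iio i, σ j * R j t : ℝ) : EReal))
    (hξ : ∀ i (c : ℝ), 0 < c → (∀ x t, 0 ≤ t → ∀ v, c * ‖v‖ ≤ ‖Θ i x t v‖) →
      ∀ t, 0 ≤ t → c * ξ i t ≤ R i t) :
    ErrorBounds f Θ lam d P₂ R ξ := by
  have hδ0 : ∀ k t, 0 ≤ disturbance Θ d P₂ k t := fun k t => norm_nonneg _
  have hall : ∀ (σ : Fin (m + 2) → Fin (m + 2) → ℝ) (i : Fin (m + 2)),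
      (∀ k ≤ i, ∀ j < k, ∀ x t, 0 ≤ t → ‖jacBlock f Θ k j x t‖ ≤ σ k j) →
      GroupBounds lam σ (disturbance Θ d P₂) R i := fun σ i hσ =>
    groupBounds_of_upperDini hlam
      -- Coupling bounds are nonnegative because they dominate a norm, for instance at state `0` and
      -- time `0`.
      (fun k hk j hj => (norm_nonneg _).trans (hσ k hk j hj 0 0 le_rfl)) hδc hδ0 hRc hR0
      fun k hk => hdini k (σ k) (hσ k hk)
  refine ⟨fun s hs => ?_, hall, ?_⟩
  · have hz : ∀ k : Fin (m + 2), k ≤ 0 → ∀ j < k, ∀ x t, 0 ≤ t → ‖jacBlock f Θ k j x t‖ ≤ s :=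
      fun k hk j hj => absurd (hj.trans_le hk) (Fin.not_lt_zero j)
    refine GroupBounds.twoGroupBounds ((norm_nonneg _).trans (hs 0 0 le_rfl)) hlam
      (hall _ 0 hz) (hall _ 1 fun k hk j hj => ?_)
    have hj0 : j = 0 := (Fin.lt_one_iff j).1 (hj.trans_le hk)
    subst hj0
    have hk1 : k = 1 := by
      rcases hk.lt_or_eq with h | h
      · exact absurd ((Fin.lt_one_iff k).1 h) hj.ne'
      · exact h
    subst hk1
    exact hs
  · intro σ hσ c hc hcΘ η κ hη hκ y hy p τ hp hτ
    have hRb : ∀ i, truncNorm p τ (R i) ≤ lpBound lam σ (disturbance Θ d P₂) R p τ i :=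
      fun i => (hall σ i fun k _ => hσ k).lp p τ hp hτ
    have hηc : ∀ i, 0 ≤ η i / c i := fun i => div_nonneg (hη i) (hc i).le
    have hκc : ∀ i, 0 ≤ κ i / c i := fun i => div_nonneg (hκ i) (hc i).le
    have h1 : truncNorm p τ y ≤ truncNorm p τ (fun t => ∑ i, (η i / c i * R i t
        + κ i / c i * disturbance Θ d P₂ i t)) := by
      refine truncNorm_mono fun t ht => (hy t ht).trans (Finset.sum_le_sum fun i _ => ?_)
      have e1 : η i * ξ i t = η i / c i * (c i * ξ i t) := by field_simp [(hc i).ne']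
      have e2 : κ i * ‖d (P₂ t) t i‖ = κ i / c i * (c i * ‖d (P₂ t) t i‖) := by
        field_simp [(hc i).ne']
      rw [e1, e2]
      exact add_le_add
        (mul_le_mul_of_nonneg_left (hξ i (c i) (hc i) (hcΘ i) t ht) (hηc i))
        (mul_le_mul_of_nonneg_left (hcΘ i _ t ht _) (hκc i))
    refine h1.trans ((truncNorm_sum_le _ hp fun i _ =>
      (continuousOn_const.mul (hRc i)).add (continuousOn_const.mul (hδc i))).trans
      (Finset.sum_le_sum fun i _ => ?_))
    refine (truncNorm_add_le hp (u := fun t => η i / c i * R i t)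
      (v := fun t => κ i / c i * disturbance Θ d P₂ i t) (continuousOn_const.mul (hRc i))
      (continuousOn_const.mul (hδc i))).trans ?_
    rw [truncNorm_const_mul (hηc i), truncNorm_const_mul (hκc i)]
    gcongr
    exact hRb i

/-! ### Dynamics of the transformed displacements -/

section Displacements

variable {N : ℕ} {n : Fin N → ℕ}

/-- The rate of change of `δz i` along the unperturbed dynamics, as a function of `δx`. -/
noncomputable def zRate (f : State n → ℝ → State n) (Θ : Transformation n) (i : Fin N) (x : State n) (t : ℝ) :
    State n →L[ℝ] EuclideanSpace ℝ (Fin (n i)) :=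
  (fderiv ℝ (fun p : State n × ℝ => Θ i p.1 p.2) (x, t) (f x t, 1)).comp
      (ContinuousLinearMap.proj i)
    + (Θ i x t).comp ((ContinuousLinearMap.proj i).comp (fderiv ℝ (fun y => f y t) x))

theorem zRate_apply (f : State n → ℝ → State n) (Θ : Transformation n) (i : Fin N) (x : State n)
    (t : ℝ) (u : State n) :
    zRate f Θ i x t u = fderiv ℝ (fun p : State n × ℝ => Θ i p.1 p.2) (x, t) (f x t, 1) (u i)
      + Θ i x t (fderiv ℝ (fun y => f y t) x u i) := rfl

/-- In this form smoothness of the block diagonal map follows from the rules for sums and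
compositions. -/
theorem blockTheta_eq_sum (Θ : Transformation n) (x : State n) (t : ℝ) :
    blockTheta Θ x t = ∑ i, (ContinuousLinearMap.single ℝ
      (fun k => EuclideanSpace ℝ (Fin (n k))) i).comp
        ((Θ i x t).comp (ContinuousLinearMap.proj i)) := by
  ext1 u
  funext i
  simp [blockTheta, Finset.sum_apply]

theorem eq_sum_single (z : State n) :
    z = ∑ j, ContinuousLinearMap.single ℝ (fun k => EuclideanSpace ℝ (Fin (n k))) j (z j) := by
  funext i
  simp [Finset.sum_apply]

variable {f : State n → ℝ → State n} {Θ : Transformation n} {lam : Fin N → ℝ}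

theorem contDiff_blockTheta (h : ∀ i, ContDiff ℝ 1 (fun p : State n × ℝ => Θ i p.1 p.2)) :
    ContDiff ℝ 1 (fun p : State n × ℝ => blockTheta Θ p.1 p.2) := by
  simp_rw [blockTheta_eq_sum]
  exact ContDiff.sum fun i _ => contDiff_const.clm_comp ((h i).clm_comp contDiff_const)

namespace IsContractingHierarchy

/-- Both sides come from differentiating `p ↦ Θ i p (u i)`, once as a component of `blockTheta` and
once directly; derivatives are unique. -/
theorem thetaDot_apply (hS : IsContractingHierarchy f Θ lam) (x : State n) (t : ℝ) (u : State n)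
    (i : Fin N) :
    thetaDot f Θ x t u i
      = fderiv ℝ (fun p : State n × ℝ => Θ i p.1 p.2) (x, t) (f x t, 1) (u i) := by
  have h1 := (((contDiff_blockTheta hS.smooth_theta).differentiable one_ne_zero) (x, t)).hasFDerivAt
  have h2 := (((hS.smooth_theta i).differentiable one_ne_zero) (x, t)).hasFDerivAt
  have h3 := ((ContinuousLinearMap.proj (R := ℝ) (φ := fun k => EuclideanSpace ℝ (Fin (n k))) i).hasFDerivAt).comp
    (x, t) (h1.clm_apply (hasFDerivAt_const u (x, t)))
  have h4 := h2.clm_apply (hasFDerivAt_const (u i) (x, t))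
  have h5 := h3.unique h4
  have h6 := congrArg (fun T => T (f x t, 1)) h5
  simpa [thetaDot] using h6

/-- Uniform positivity gives injectivity, which suffices in finite dimension. It makes `inverse` in
`genJacobian` a genuine inverse. -/
theorem isInvertible_blockTheta (hS : IsContractingHierarchy f Θ lam) (x : State n) {t : ℝ}
    (ht : 0 ≤ t) : (blockTheta Θ x t).IsInvertible := by
  have hinj : Function.Injective (blockTheta Θ x t : State n →ₗ[ℝ] State n) := by
    refine (injective_iff_map_eq_zero _).2 fun u hu => funext fun i => ?_
    obtain ⟨c, hc, hb⟩ := hS.uniformly_pos i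
    have h1 : Θ i x t (u i) = 0 := congrFun hu i
    have h2 := hb x t ht (u i)
    rw [h1, norm_zero] at h2
    exact norm_le_zero_iff.1 (nonpos_of_mul_nonpos_right h2 hc)
  refine ⟨(LinearEquiv.ofInjectiveEndo _ hinj).toContinuousLinearEquiv, ?_⟩
  ext1 u
  rfl

theorem genJacobian_blockTheta (hS : IsContractingHierarchy f Θ lam) (x : State n) {t : ℝ}
    (ht : 0 ≤ t) (u : State n) (i : Fin N) :
    genJacobian f Θ x t (blockTheta Θ x t u) i = zRate f Θ i x t u := by
  obtain ⟨e, he⟩ := hS.isInvertible_blockTheta x ht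
  have h1 : (blockTheta Θ x t).inverse (blockTheta Θ x t u) = u := by
    rw [← he]
    simp
  rw [genJacobian, ContinuousLinearMap.comp_apply, h1, zRate_apply, ← hS.thetaDot_apply]
  rfl

/-- The `i`-th block of `(δz)' = F δz`; triangularity removes the groups `j > i`. -/
theorem zRate_eq_sum (hS : IsContractingHierarchy f Θ lam) (i : Fin N) (x : State n) {t : ℝ}
    (ht : 0 ≤ t) (u : State n) :
    zRate f Θ i x t u = jacBlock f Θ i i x t (Θ i x t (u i))
      + ∑ j ∈ Finset.Iio i, jacBlock f Θ i j x t (Θ j x t (u j)) := by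
  have h1 : zRate f Θ i x t u = ∑ j, jacBlock f Θ i j x t (Θ j x t (u j)) := by
    rw [← hS.genJacobian_blockTheta x ht, eq_sum_single (blockTheta Θ x t u), map_sum,
      Finset.sum_apply]
    rfl
  rw [h1, ← Finset.sum_insert (f := fun j => jacBlock f Θ i j x t (Θ j x t (u j)))
    (by simp : i ∉ Finset.Iio i), Finset.Iio_insert]
  symm
  refine Finset.sum_subset (Finset.subset_univ _) fun j _ hj => ?_
  rw [hS.lower_triangular i j (by simpa using hj) x t ht]
  rfl

/-- Expanding the square turns the bound on the symmetric part into a bound on the cross term. This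
replaces a derivative of the norm and remains valid at `z = 0`. -/
theorem norm_add_smul_jacBlock_le (hS : IsContractingHierarchy f Θ lam) (i : Fin N) (x : State n)
    {t h C : ℝ} (ht : 0 ≤ t) (h0 : 0 ≤ h) (hl : h * lam i ≤ 1) (hC : ‖jacBlock f Θ i i x t‖ ≤ C)
    (z : EuclideanSpace ℝ (Fin (n i))) :
    ‖z + h • jacBlock f Θ i i x t z‖ ≤ (1 - h * lam i) * ‖z‖ + h ^ 2 * C ^ 2 * ‖z‖ := by
  set A := jacBlock f Θ i i x t
  have hA : ‖A z‖ ≤ C * ‖z‖ := (A.le_opNorm z).trans (mul_le_mul_of_nonneg_right hC (norm_nonneg _))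
  have hin := hS.contracting i x t ht z
  have hz := norm_nonneg z
  have hA2 : ‖A z‖ ^ 2 ≤ (C * ‖z‖) ^ 2 := pow_le_pow_left₀ (norm_nonneg _) hA 2
  have hnn : 0 ≤ (1 - h * lam i) * ‖z‖ + h ^ 2 * C ^ 2 * ‖z‖ :=
    add_nonneg (mul_nonneg (by linarith) hz) (by positivity)
  refine abs_le_of_sq_le_sq' ?_ hnn |>.2
  rw [norm_add_sq_real, inner_smul_right, norm_smul, Real.norm_of_nonneg h0]
  have h1 : h * inner ℝ z (A z) ≤ h * (-(lam i) * ‖z‖ ^ 2) := mul_le_mul_of_nonneg_left hin h0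
  have h2 : (h * ‖A z‖) ^ 2 ≤ h ^ 2 * (C * ‖z‖) ^ 2 := by
    rw [mul_pow]
    exact mul_le_mul_of_nonneg_left hA2 (sq_nonneg h)
  -- The square of the right side exceeds what is needed by a manifestly nonnegative remainder.
  have h3 : ((1 - h * lam i) * ‖z‖ + h ^ 2 * C ^ 2 * ‖z‖) ^ 2
      = ‖z‖ ^ 2 + 2 * (h * (-(lam i) * ‖z‖ ^ 2)) + h ^ 2 * (C * ‖z‖) ^ 2
        + h ^ 2 * ‖z‖ ^ 2 * ((lam i - h * C ^ 2) ^ 2 + C ^ 2) := by ring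
  have h4 : 0 ≤ h ^ 2 * ‖z‖ ^ 2 * ((lam i - h * C ^ 2) ^ 2 + C ^ 2) := by positivity
  rw [h3]
  linarith

theorem norm_add_smul_zRate_le (hS : IsContractingHierarchy f Θ lam) (i : Fin N) (x : State n)
    {t h C : ℝ} (ht : 0 ≤ t) (h0 : 0 ≤ h) (hl : h * lam i ≤ 1) (hC : ‖jacBlock f Θ i i x t‖ ≤ C)
    (u : State n) :
    ‖Θ i x t (u i) + h • zRate f Θ i x t u‖ ≤ (1 - h * lam i) * ‖Θ i x t (u i)‖
      + h * ∑ j ∈ Finset.Iio i, ‖jacBlock f Θ i j x t‖ * ‖Θ j x t (u j)‖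
      + h ^ 2 * C ^ 2 * ‖Θ i x t (u i)‖ := by
  rw [hS.zRate_eq_sum i x ht, smul_add, ← add_assoc]
  have h1 := hS.norm_add_smul_jacBlock_le i x ht h0 hl hC (Θ i x t (u i))
  have h2 : ‖h • ∑ j ∈ Finset.Iio i, jacBlock f Θ i j x t (Θ j x t (u j))‖
      ≤ h * ∑ j ∈ Finset.Iio i, ‖jacBlock f Θ i j x t‖ * ‖Θ j x t (u j)‖ := by
    rw [norm_smul, Real.norm_of_nonneg h0]
    exact mul_le_mul_of_nonneg_left (norm_sum_le_of_le _ fun j _ =>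
      (jacBlock f Θ i j x t).le_opNorm _) h0
  have h3 := norm_add_le (Θ i x t (u i) + h • jacBlock f Θ i i x t (Θ i x t (u i)))
    (h • ∑ j ∈ Finset.Iio i, jacBlock f Θ i j x t (Θ j x t (u j)))
  linarith

theorem continuous_theta (hS : IsContractingHierarchy f Θ lam) (i : Fin N) :
    Continuous (fun p : State n × ℝ => Θ i p.1 p.2) := (hS.smooth_theta i).continuous

theorem fderiv_field (hS : IsContractingHierarchy f Θ lam) (x : State n) (t : ℝ) :
    fderiv ℝ (fun y => f y t) x
      = (fderiv ℝ (fun p : State n × ℝ => f p.1 p.2) (x, t)).comp (ContinuousLinearMap.inl ℝ _ _) := by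
  have h1 := ((hS.smooth_field.differentiable one_ne_zero) (x, t)).hasFDerivAt
  exact (HasFDerivAt.comp (f := fun y : State n => (y, t)) x h1
    (hasFDerivAt_prodMk_left x t)).fderiv

theorem continuous_fderiv_field (hS : IsContractingHierarchy f Θ lam) :
    Continuous (fun p : State n × ℝ => fderiv ℝ (fun y => f y p.2) p.1) := by
  simp_rw [hS.fderiv_field]
  exact (hS.smooth_field.continuous_fderiv one_ne_zero).clm_comp continuous_const

theorem continuous_theta_fderiv (hS : IsContractingHierarchy f Θ lam) (i : Fin N) :
    Continuous (fun p : State n × ℝ => fderiv ℝ (fun p : State n × ℝ => Θ i p.1 p.2) p) :=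
  (hS.smooth_theta i).continuous_fderiv one_ne_zero

theorem continuous_zRate (hS : IsContractingHierarchy f Θ lam) (i : Fin N) :
    Continuous (fun p : State n × ℝ => zRate f Θ i p.1 p.2) := by
  have h1 := hS.continuous_theta_fderiv i
  have h2 := hS.smooth_field.continuous
  exact ((h1.clm_apply (h2.prodMk continuous_const)).clm_comp continuous_const).add
    ((hS.continuous_theta i).clm_comp (continuous_const.clm_comp hS.continuous_fderiv_field))

theorem continuous_thetaDot (hS : IsContractingHierarchy f Θ lam) :
    Continuous (fun p : State n × ℝ => thetaDot f Θ p.1 p.2) :=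
  ((contDiff_blockTheta hS.smooth_theta).continuous_fderiv one_ne_zero).clm_apply
    (hS.smooth_field.continuous.prodMk continuous_const)

/-- Inversion is continuous at invertible maps, and invertibility is available only for `t ≥ 0`. -/
theorem continuousOn_jacBlock (hS : IsContractingHierarchy f Θ lam) (i j : Fin N) :
    ContinuousOn (fun p : State n × ℝ => jacBlock f Θ i j p.1 p.2) {p | 0 ≤ p.2} := by
  have hB := (contDiff_blockTheta hS.smooth_theta).continuous
  have h1 : ContinuousOn (fun p : State n × ℝ => (blockTheta Θ p.1 p.2).inverse) {p | 0 ≤ p.2} := by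
    intro p hp
    obtain ⟨e, he⟩ := hS.isInvertible_blockTheta p.1 hp
    have h2 : ContinuousAt ContinuousLinearMap.inverse (blockTheta Θ p.1 p.2) := by
      rw [← he]
      exact (contDiffAt_map_inverse (n := 0) e).continuousAt
    exact (ContinuousAt.comp (f := fun p : State n × ℝ => blockTheta Θ p.1 p.2) h2
      hB.continuousAt).continuousWithinAt
  have h3 : Continuous (fun p : State n × ℝ => thetaDot f Θ p.1 p.2
      + (blockTheta Θ p.1 p.2).comp (fderiv ℝ (fun y => f y p.2) p.1)) :=
    hS.continuous_thetaDot.add (hB.clm_comp hS.continuous_fderiv_field)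
  exact (continuousOn_const.clm_comp (h3.continuousOn.clm_comp h1)).clm_comp continuousOn_const

theorem continuous_zIntegrand (hS : IsContractingHierarchy f Θ lam) (i : Fin N) (t : ℝ) :
    Continuous fun q : State n × State n => ‖Θ i q.1 t (q.2 i)‖ :=
  (((hS.continuous_theta i).comp (continuous_fst.prodMk continuous_const)).clm_apply
    ((continuous_apply i).comp continuous_snd)).norm

theorem continuous_couplingIntegrand (hS : IsContractingHierarchy f Θ lam) (i j : Fin N)
    {t : ℝ} (ht : 0 ≤ t) :
    Continuous fun q : State n × State n =>
      ‖jacBlock f Θ i j q.1 t‖ * ‖Θ j q.1 t (q.2 j)‖ := by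
  refine Continuous.mul ?_ (hS.continuous_zIntegrand j t)
  exact ((hS.continuousOn_jacBlock i j).comp_continuous
    (f := fun q : State n × State n => (q.1, t)) (by fun_prop) fun _ => ht).norm

end IsContractingHierarchy

end Displacements

/-! ### Uniform first-order expansion and integration of pointwise bounds -/

/-- The mean value inequality for `g` minus its linear part, with `g'` uniformly continuous on `K ×
[t, t + 1]`. Right derivatives suffice, as is needed at the release time of a label. -/
theorem exists_uniform_taylor {X E : Type*} [PseudoMetricSpace X] [NormedAddCommGroup E]
    [NormedSpace ℝ E] {K : Set X} (hK : IsCompact K) {g g' : X → ℝ → E} {t : ℝ}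
    (hd : ∀ x ∈ K, ∀ τ, t ≤ τ → HasDerivWithinAt (g x) (g' x τ) (Ici τ) τ)
    (hg : ∀ x ∈ K, ContinuousOn (g x) (Ici t))
    (hc : ContinuousOn (fun p : X × ℝ => g' p.1 p.2) (K ×ˢ Ici t)) {ε : ℝ} (hε : 0 < ε) :
    ∃ δ > 0, ∀ x ∈ K, ∀ h, 0 ≤ h → h ≤ δ → ‖g x (t + h) - (g x t + h • g' x t)‖ ≤ ε * h := by
  have hcomp : IsCompact (K ×ˢ Icc t (t + 1)) := hK.prod isCompact_Icc
  have huc := hcomp.uniformContinuousOn_of_continuous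
    (hc.mono (prod_mono_right Icc_subset_Ici_self))
  obtain ⟨δ, hδ, hu⟩ := Metric.uniformContinuousOn_iff_le.1 huc ε hε
  refine ⟨min δ 1, lt_min hδ one_pos, fun x hx h h0 hh => ?_⟩
  have hh1 : h ≤ 1 := hh.trans (min_le_right _ _)
  have key := norm_image_sub_le_of_norm_deriv_right_le_segment (a := t) (b := t + h)
    (f := fun τ => g x τ - (τ - t) • g' x t) (f' := fun τ => g' x τ - g' x t) (C := ε)
    (((hg x hx).mono Icc_subset_Ici_self).sub (by fun_prop))
    (fun τ hτ => by
      have h1 : HasDerivWithinAt (fun τ : ℝ => (τ - t) • g' x t) ((1 : ℝ) • g' x t) (Ici τ) τ :=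
        ((hasDerivAt_id τ).sub_const t).hasDerivWithinAt.smul_const _
      rw [one_smul] at h1
      exact (hd x hx τ hτ.1).sub h1)
    (fun τ hτ => by
      have := hu (x, τ) ⟨hx, hτ.1, by linarith [hτ.2]⟩ (x, t) ⟨hx, le_rfl, by linarith⟩ (by
        rw [Prod.dist_eq, dist_self, Real.dist_eq, abs_of_nonneg (sub_nonneg.2 hτ.1)]
        exact max_le hδ.le (by linarith [hτ.2, min_le_left δ 1]))
      rwa [dist_eq_norm] at this)
    (t + h) (right_mem_Icc.2 (by linarith))
  simp only [add_sub_cancel_left, sub_self, zero_smul, sub_zero] at key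
  rwa [sub_right_comm, ← sub_add_eq_sub_sub] at key

theorem integral_le_of_le_linear {ι : Type*} {T : Finset ι} {a b c₁ c₂ c₃ : ℝ} (hab : a ≤ b)
    {y z e : ℝ → ℝ} {q : ι → ℝ → ℝ} (hy : ContinuousOn y (Icc a b)) (hz : ContinuousOn z (Icc a b))
    (he : ContinuousOn e (Icc a b)) (hq : ∀ j, ContinuousOn (q j) (Icc a b))
    (h : ∀ s ∈ Icc a b, y s ≤ c₁ * z s + c₂ * ∑ j ∈ T, q j s + c₃ * e s) :
    ∫ s in a..b, y s ≤ c₁ * (∫ s in a..b, z s) + c₂ * (∑ j ∈ T, ∫ s in a..b, q j s)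
      + c₃ * ∫ s in a..b, e s := by
  have hii : ∀ {g : ℝ → ℝ}, ContinuousOn g (Icc a b) → IntervalIntegrable g volume a b :=
    fun hg => ContinuousOn.intervalIntegrable (by rwa [uIcc_of_le hab])
  have h1 := (hii hz).const_mul c₁
  have h2 := (hii (continuousOn_finsetSum T fun j _ => hq j)).const_mul c₂
  have h3 := (hii he).const_mul c₃
  refine (intervalIntegral.integral_mono_on hab (hii hy) ((h1.add h2).add h3) h).trans_eq ?_
  have e1 : ∫ s in a..b, (c₁ * z s + c₂ * ∑ j ∈ T, q j s + c₃ * e s)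
      = (∫ s in a..b, (c₁ * z s + c₂ * ∑ j ∈ T, q j s)) + ∫ s in a..b, c₃ * e s :=
    intervalIntegral.integral_add (h1.add h2) h3
  have e2 : ∫ s in a..b, (c₁ * z s + c₂ * ∑ j ∈ T, q j s)
      = (∫ s in a..b, c₁ * z s) + ∫ s in a..b, c₂ * ∑ j ∈ T, q j s :=
    intervalIntegral.integral_add h1 h2
  refine e1.trans ?_
  rw [e2, intervalIntegral.integral_const_mul, intervalIntegral.integral_const_mul,
    intervalIntegral.integral_const_mul, intervalIntegral.integral_finsetSum fun j _ => hii (hq j)]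

/-! ### Families of unperturbed solutions and their displacements -/

section FlowRegion

variable {N : ℕ} {n : Fin N → ℕ}

/-- A two-parameter family `x s t` that is `C²` on a fat region `S` of labels `s` and times `t ≥ 0`,
every label of which follows the dynamics from any time in `S` onwards. -/
structure IsFlowRegion (f : State n → ℝ → State n) (x : ℝ → ℝ → State n) (S : Set (ℝ × ℝ)) :
    Prop where
  convex : Convex ℝ S
  interior_nonempty : (interior S).Nonempty
  smooth : ContDiffOn ℝ 2 (fun p : ℝ × ℝ => x p.1 p.2) S
  upward : ∀ s t τ, (s, t) ∈ S → t ≤ τ → (s, τ) ∈ S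
  time_nonneg : ∀ p ∈ S, 0 ≤ p.2
  flow : ∀ s t, (s, t) ∈ S → HasDerivWithinAt (x s) (f (x s t) t) (Ici t) t

/-- The virtual displacement `∂x/∂s` on a region `S`. -/
noncomputable def labelDeriv (x : ℝ → ℝ → State n) (S : Set (ℝ × ℝ)) (s t : ℝ) : State n :=
  fderivWithin ℝ (fun p : ℝ × ℝ => x p.1 p.2) S (s, t) (1, 0)

namespace IsFlowRegion

variable {f : State n → ℝ → State n} {Θ : Transformation n} {lam : Fin N → ℝ}
  {x : ℝ → ℝ → State n} {S : Set (ℝ × ℝ)}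

theorem uniqueDiffOn (h : IsFlowRegion f x S) : UniqueDiffOn ℝ S :=
  uniqueDiffOn_convex h.convex h.interior_nonempty

theorem hasFDerivWithinAt (h : IsFlowRegion f x S) {p : ℝ × ℝ} (hp : p ∈ S) :
    HasFDerivWithinAt (fun p : ℝ × ℝ => x p.1 p.2)
      (fderivWithin ℝ (fun p : ℝ × ℝ => x p.1 p.2) S p) S p :=
  (h.smooth.differentiableOn two_ne_zero p hp).hasFDerivWithinAt

theorem hasDerivWithinAt_vertical (s t : ℝ) :
    HasDerivWithinAt (fun τ : ℝ => (s, τ)) ((0 : ℝ), (1 : ℝ)) (Ici t) t :=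
  ((hasDerivAt_const t s).prodMk (hasDerivAt_id t)).hasDerivWithinAt

theorem fderivWithin_vertical (h : IsFlowRegion f x S) {s t : ℝ} (hp : (s, t) ∈ S) :
    fderivWithin ℝ (fun p : ℝ × ℝ => x p.1 p.2) S (s, t) (0, 1) = f (x s t) t := by
  have h1 := (h.hasFDerivWithinAt hp).comp_hasDerivWithinAt (f := fun τ : ℝ => (s, τ)) t
    (hasDerivWithinAt_vertical s t) fun τ hτ => h.upward s t τ hp hτ
  exact (uniqueDiffWithinAt_Ici t).eq_deriv _ h1 (h.flow s t hp)

theorem contDiffOn_fderivWithin (h : IsFlowRegion f x S) :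
    ContDiffOn ℝ 1 (fderivWithin ℝ (fun p : ℝ × ℝ => x p.1 p.2) S) S :=
  h.smooth.fderivWithin h.uniqueDiffOn (by norm_num)

theorem continuousOn_labelDeriv (h : IsFlowRegion f x S) :
    ContinuousOn (fun p : ℝ × ℝ => labelDeriv x S p.1 p.2) S :=
  h.contDiffOn_fderivWithin.continuousOn.clm_apply continuousOn_const

/-- The variational equation: `∂t ∂s x = ∂s ∂t x = ∂s f(x, t)`. This exchange of derivatives is
where the family has to be `C²`. -/
theorem hasDerivWithinAt_labelDeriv (hS : IsContractingHierarchy f Θ lam) (h : IsFlowRegion f x S)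
    {s t : ℝ} (hp : (s, t) ∈ S) :
    HasDerivWithinAt (labelDeriv x S s) (fderiv ℝ (fun y => f y t) (x s t) (labelDeriv x S s t))
      (Ici t) t := by
  set X := fun p : ℝ × ℝ => x p.1 p.2 with hX
  have h2 : HasFDerivWithinAt (fderivWithin ℝ X S) (fderivWithin ℝ (fderivWithin ℝ X S) S (s, t)) S
      (s, t) := (h.contDiffOn_fderivWithin.differentiableOn one_ne_zero _ hp).hasFDerivWithinAt
  -- Symmetry extends to boundary points because a convex set with interior lies in the closure of
  -- its interior.
  have hsymm : IsSymmSndFDerivWithinAt ℝ X S (s, t) :=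
    (h.smooth _ hp).isSymmSndFDerivWithinAt (by simp) h.uniqueDiffOn
      ((h.convex.closure_interior_eq_closure_of_nonempty_interior h.interior_nonempty).symm ▸
        subset_closure hp) hp
  have h3 : HasDerivWithinAt (labelDeriv x S s)
      (fderivWithin ℝ (fderivWithin ℝ X S) S (s, t) (0, 1) (1, 0)) (Ici t) t := by
    have h4 := h2.comp_hasDerivWithinAt (f := fun τ : ℝ => (s, τ)) t
      (hasDerivWithinAt_vertical s t) fun τ hτ => h.upward s t τ hp hτ
    have h5 := h4.clm_apply (hasDerivWithinAt_const t (Ici t) ((1 : ℝ), (0 : ℝ)))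
    simp only [map_zero, add_zero] at h5
    exact h5
  -- The time derivative `p ↦ X'(p)(0, 1)` equals `f(X p, p.2)` on `S`; `h6` and `h8` differentiate
  -- the two expressions, which are then compared in the label direction `(1, 0)`.
  have h6 := h2.clm_apply (hasFDerivWithinAt_const ((0 : ℝ), (1 : ℝ)) (s, t) S)
  have hff := (hS.smooth_field.differentiable one_ne_zero (x s t, t)).hasFDerivAt
  have h7 := HasFDerivAt.comp_hasFDerivWithinAt (f := fun p : ℝ × ℝ => (X p, p.2)) (s, t) hff
    ((h.hasFDerivWithinAt hp).prodMk hasFDerivWithinAt_snd)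
  have h8 : HasFDerivWithinAt (fun p : ℝ × ℝ => fderivWithin ℝ X S p (0, 1)) _ S (s, t) :=
    h7.congr (fun p hq => h.fderivWithin_vertical hq) (h.fderivWithin_vertical hp)
  have h9 := congrArg (fun T => T ((1 : ℝ), (0 : ℝ))) ((h.uniqueDiffOn _ hp).eq h6 h8)
  rw [hsymm (0, 1) (1, 0)] at h3
  refine h3.congr_deriv ?_
  rw [hS.fderiv_field]
  simpa [labelDeriv, hX] using h9

theorem hasDerivWithinAt_z (hS : IsContractingHierarchy f Θ lam) (h : IsFlowRegion f x S)
    (i : Fin N) {s t : ℝ} (hp : (s, t) ∈ S) :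
    HasDerivWithinAt (fun τ => Θ i (x s τ) τ (labelDeriv x S s τ i))
      (zRate f Θ i (x s t) t (labelDeriv x S s t)) (Ici t) t := by
  have hΘ := ((hS.smooth_theta i).differentiable one_ne_zero (x s t, t)).hasFDerivAt
  have h1 := hΘ.comp_hasDerivWithinAt (f := fun τ : ℝ => (x s τ, τ)) t
    ((h.flow s t hp).prodMk (hasDerivWithinAt_id t _))
  have h2 := hasDerivWithinAt_pi.1 (hasDerivWithinAt_labelDeriv hS h hp) i
  exact h1.clm_apply h2

theorem continuousOn_state (h : IsFlowRegion f x S) :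
    ContinuousOn (fun p : ℝ × ℝ => x p.1 p.2) S := h.smooth.continuousOn

theorem continuousOn_z (hS : IsContractingHierarchy f Θ lam) (h : IsFlowRegion f x S) (i : Fin N) :
    ContinuousOn (fun p : ℝ × ℝ => Θ i (x p.1 p.2) p.2 (labelDeriv x S p.1 p.2 i)) S :=
  ((hS.continuous_theta i).comp_continuousOn (h.continuousOn_state.prodMk continuousOn_snd)).clm_apply
    (continuousOn_pi.1 h.continuousOn_labelDeriv i)

theorem continuousOn_zRate (hS : IsContractingHierarchy f Θ lam) (h : IsFlowRegion f x S)
    (i : Fin N) :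
    ContinuousOn (fun p : ℝ × ℝ => zRate f Θ i (x p.1 p.2) p.2 (labelDeriv x S p.1 p.2)) S :=
  ContinuousOn.clm_apply (f := fun p : ℝ × ℝ => zRate f Θ i (x p.1 p.2) p.2)
    ((hS.continuous_zRate i).comp_continuousOn (f := fun p : ℝ × ℝ => (x p.1 p.2, p.2))
      (h.continuousOn_state.prodMk continuousOn_snd)) h.continuousOn_labelDeriv

theorem continuousOn_slice {t a b : ℝ} (hab : ∀ s ∈ Icc a b, (s, t) ∈ S) {E : Type*}
    [TopologicalSpace E] {g : ℝ × ℝ → E} (hg : ContinuousOn g S) :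
    ContinuousOn (fun s => g (s, t)) (Icc a b) :=
  hg.comp (by fun_prop) hab

theorem continuousOn_jacBlock (hS : IsContractingHierarchy f Θ lam) (h : IsFlowRegion f x S)
    (i j : Fin N) :
    ContinuousOn (fun p : ℝ × ℝ => jacBlock f Θ i j (x p.1 p.2) p.2) S :=
  (hS.continuousOn_jacBlock i j).comp (f := fun p : ℝ × ℝ => (x p.1 p.2, p.2))
    (h.continuousOn_state.prodMk continuousOn_snd)
    fun p hp => h.time_nonneg p hp

/-- The length of a transported piece of path decreases at rate `lam i`, up to the coupling. -/
theorem exists_length_step (hS : IsContractingHierarchy f Θ lam) (h : IsFlowRegion f x S)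
    (i : Fin N) {t a b : ℝ} (ht : 0 ≤ t) (hab : a ≤ b) (hmem : ∀ s ∈ Icc a b, (s, t) ∈ S)
    {ε : ℝ} (hε : 0 < ε) :
    ∃ δ > 0, ∀ k, 0 ≤ k → k ≤ δ →
      ∫ s in a..b, ‖Θ i (x s (t + k)) (t + k) (labelDeriv x S s (t + k) i)‖
        ≤ (1 - k * lam i) * (∫ s in a..b, ‖Θ i (x s t) t (labelDeriv x S s t i)‖)
          + k * (∑ j ∈ Finset.Iio i, ∫ s in a..b,
              ‖jacBlock f Θ i j (x s t) t‖ * ‖Θ j (x s t) t (labelDeriv x S s t j)‖)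
          + ε * k := by
  have hup : ∀ s ∈ Icc a b, ∀ τ, t ≤ τ → (s, τ) ∈ S := fun s hs τ hτ => h.upward s t τ (hmem s hs) hτ
  have hz : ∀ j, ContinuousOn (fun s => ‖Θ j (x s t) t (labelDeriv x S s t j)‖) (Icc a b) :=
    fun j => (continuousOn_slice hmem (continuousOn_z hS h j)).norm
  have hF : ∀ j, ContinuousOn (fun s => ‖jacBlock f Θ i j (x s t) t‖) (Icc a b) :=
    fun j => (continuousOn_slice hmem (continuousOn_jacBlock hS h i j)).norm
  obtain ⟨C, hC⟩ := isCompact_Icc.exists_bound_of_continuousOn (hF i)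
  simp only [norm_norm] at hC
  set I := ∫ s in a..b, ‖Θ i (x s t) t (labelDeriv x S s t i)‖ with hI
  have hI0 : 0 ≤ I := intervalIntegral.integral_nonneg hab fun _ _ => norm_nonneg _
  -- Half of `ε` pays for the Taylor error integrated over `[a, b]`, the other half for the `k²`
  -- term; the `+ 1` covers `a = b`.
  set ε' := ε / 2 / (b - a + 1) with hε'
  have hba : 0 < b - a + 1 := by linarith
  have hε'0 : 0 < ε' := by positivity
  obtain ⟨δ, hδ, hT⟩ := exists_uniform_taylor (isCompact_Icc (a := a) (b := b))
    (g := fun s τ => Θ i (x s τ) τ (labelDeriv x S s τ i))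
    (g' := fun s τ => zRate f Θ i (x s τ) τ (labelDeriv x S s τ)) (t := t)
    (fun s hs τ hτ => hasDerivWithinAt_z hS h i (hup s hs τ hτ))
    (fun s hs => (continuousOn_z hS h i).comp (f := fun τ : ℝ => (s, τ)) (by fun_prop)
      fun τ hτ => hup s hs τ hτ)
    ((continuousOn_zRate hS h i).mono fun p hp => hup p.1 hp.1 p.2 hp.2) hε'0
  set M := C ^ 2 * I with hM
  have hM0 : 0 ≤ M := mul_nonneg (sq_nonneg C) hI0
  refine ⟨min δ (min (1 / lam i) (ε / 2 / (M + 1))), by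
    have := hS.rate_pos i
    positivity, fun k k0 hk => ?_⟩
  have hk1 : k ≤ δ := hk.trans (min_le_left _ _)
  have hk2 : k * lam i ≤ 1 := by
    have := hk.trans ((min_le_right _ _).trans (min_le_left _ _))
    rwa [le_div_iff₀ (hS.rate_pos i)] at this
  have hk3 : k * M ≤ ε / 2 := by
    have := hk.trans ((min_le_right _ _).trans (min_le_right _ _))
    rw [le_div_iff₀ (by positivity)] at this
    nlinarith
  have hpt : ∀ s ∈ Icc a b, ‖Θ i (x s (t + k)) (t + k) (labelDeriv x S s (t + k) i)‖
      ≤ (1 - k * lam i + k ^ 2 * C ^ 2) * ‖Θ i (x s t) t (labelDeriv x S s t i)‖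
        + k * (∑ j ∈ Finset.Iio i,
            ‖jacBlock f Θ i j (x s t) t‖ * ‖Θ j (x s t) t (labelDeriv x S s t j)‖)
        + ε' * k * 1 := by
    intro s hs
    have h1 := hS.norm_add_smul_zRate_le i (x s t) ht k0 hk2 (hC s hs) (labelDeriv x S s t)
    have h2 := hT s hs k k0 hk1
    have h3 := norm_le_norm_add_norm_sub' (Θ i (x s (t + k)) (t + k) (labelDeriv x S s (t + k) i))
      (Θ i (x s t) t (labelDeriv x S s t i) + k • zRate f Θ i (x s t) t (labelDeriv x S s t))
    linarith
  have hleft : ContinuousOn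
      (fun s => ‖Θ i (x s (t + k)) (t + k) (labelDeriv x S s (t + k) i)‖) (Icc a b) :=
    (continuousOn_slice (fun s hs => hup s hs _ (by linarith)) (continuousOn_z hS h i)).norm
  have hmono := integral_le_of_le_linear hab (e := fun _ => 1)
    (q := fun j s => ‖jacBlock f Θ i j (x s t) t‖ * ‖Θ j (x s t) t (labelDeriv x S s t j)‖) hleft (hz i) continuousOn_const
    (fun j => (hF j).mul (hz j)) hpt
  rw [← hI, intervalIntegral.integral_const, smul_eq_mul, mul_one] at hmono
  refine hmono.trans ?_
  have e1 : ε' * k * (b - a) ≤ ε / 2 * k := by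
    have : (b - a) * ε' ≤ ε / 2 := by
      rw [hε', mul_div_assoc', div_le_iff₀ hba]
      nlinarith
    nlinarith
  have e2 : k ^ 2 * C ^ 2 * I ≤ ε / 2 * k := by
    have : k ^ 2 * C ^ 2 * I = k * M * k := by rw [hM]; ring
    rw [this]
    exact mul_le_mul_of_nonneg_right hk3 k0
  linarith

theorem deriv_eq_labelDeriv (h : IsFlowRegion f x S) {t a b s : ℝ}
    (hmem : ∀ s ∈ Icc a b, (s, t) ∈ S) (hs : s ∈ Ioo a b) :
    deriv (fun s => x s t) s = labelDeriv x S s t := by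
  have h1 : HasDerivWithinAt (fun s : ℝ => (s, t)) ((1 : ℝ), (0 : ℝ)) (Icc a b) s :=
    ((hasDerivAt_id s).prodMk (hasDerivAt_const s t)).hasDerivWithinAt
  have h2 := (h.hasFDerivWithinAt (hmem s (Ioo_subset_Icc_self hs))).comp_hasDerivWithinAt
    (f := fun s : ℝ => (s, t)) s h1 hmem
  exact (h2.hasDerivAt (Icc_mem_nhds hs.1 hs.2)).deriv

/-- The two-sided `deriv` can differ from `labelDeriv` only at the ends of the piece, a null set. A
general `Φ` covers lengths and couplings together. -/
theorem integral_deriv (h : IsFlowRegion f x S) {t a b : ℝ} (hab : a ≤ b)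
    (hmem : ∀ s ∈ Icc a b, (s, t) ∈ S) {Φ : State n × State n → ℝ} (hΦ : Continuous Φ) :
    IntervalIntegrable (fun s => Φ (x s t, deriv (fun s => x s t) s)) volume a b ∧
      ∫ s in a..b, Φ (x s t, deriv (fun s => x s t) s)
        = ∫ s in a..b, Φ (x s t, labelDeriv x S s t) := by
  have hc : ContinuousOn (fun s => Φ (x s t, labelDeriv x S s t)) (Icc a b) :=
    hΦ.comp_continuousOn (continuousOn_slice hmem
      (h.continuousOn_state.prodMk h.continuousOn_labelDeriv))
  have hii : IntervalIntegrable (fun s => Φ (x s t, labelDeriv x S s t)) volume a b :=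
    ContinuousOn.intervalIntegrable (by rwa [uIcc_of_le hab])
  have hae : ∀ᵐ s : ℝ, s ∈ uIoc a b →
      Φ (x s t, labelDeriv x S s t) = Φ (x s t, deriv (fun s => x s t) s) := by
    have hb : ∀ᵐ s : ℝ, s ≠ b := by simp [ae_iff]
    filter_upwards [hb] with s hs hs2
    rw [uIoc_of_le hab] at hs2
    rw [h.deriv_eq_labelDeriv hmem ⟨hs2.1, lt_of_le_of_ne hs2.2 hs⟩]
  exact ⟨hii.congr_ae ((ae_restrict_iff' measurableSet_uIoc).2 hae),
    (intervalIntegral.integral_congr_ae hae).symm⟩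

end IsFlowRegion

end FlowRegion

/-! ### Lengths along a transported path -/

section TransportedPath

variable {m : ℕ} {n : Fin (m + 2) → ℕ} {f : State n → ℝ → State n} {Θ : Transformation n}
  {lam : Fin (m + 2) → ℝ} {d : State n → ℝ → State n} {P₁ P₂ : ℝ → State n}

theorem continuousOn_disturbance (hS : IsContractingHierarchy f Θ lam)
    (hP₂ : IsIntegralCurveOn P₂ (fun t x => f x t + d x t) (Ici 0))
    (hd : ContinuousOn (fun t => d (P₂ t) t) (Ici 0)) (i : Fin (m + 2)) :
    ContinuousOn (disturbance Θ d P₂ i) (Ici 0) := by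
  have hc : ContinuousOn P₂ (Ici 0) := fun t ht => (hP₂ t ht).continuousWithinAt
  exact (((hS.continuous_theta i).comp_continuousOn (f := fun t : ℝ => (P₂ t, t))
    (hc.prodMk continuousOn_id)).clm_apply (continuousOn_pi.1 hd i)).norm

/-- Labels of the path chosen at time `0`. -/
def initialRegion : Set (ℝ × ℝ) := {p | -1 ≤ p.1 ∧ p.1 ≤ 0 ∧ 0 ≤ p.2}

/-- Labels released by the perturbed trajectory. -/
def releasedRegion : Set (ℝ × ℝ) := {p | 0 ≤ p.1 ∧ p.1 ≤ p.2}

variable {x : ℝ → ℝ → State n}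

namespace IsTransportedPath

theorem isFlowRegion_initial (hx : IsTransportedPath f P₁ P₂ x) :
    IsFlowRegion f x initialRegion where
  convex := by
    rintro ⟨a, b⟩ ⟨h1, h2, h3⟩ ⟨c, e⟩ ⟨h4, h5, h6⟩ u v hu hv huv
    simp only at h1 h2 h3 h4 h5 h6
    simp only [initialRegion, mem_ofPred_eq, Prod.smul_mk, Prod.mk_add_mk, smul_eq_mul]
    exact ⟨by nlinarith, by nlinarith, by nlinarith⟩
  interior_nonempty := by
    refine ⟨(-1 / 2, 1), mem_interior.2 ⟨Ioo (-1) 0 ×ˢ Ioi 0, ?_, isOpen_Ioo.prod isOpen_Ioi, ?_⟩⟩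
    · rintro ⟨a, b⟩ ⟨⟨h1, h2⟩, h3⟩
      exact ⟨h1.le, h2.le, le_of_lt h3⟩
    · simp only [mem_prod, mem_Ioo, mem_Ioi]
      norm_num
  smooth := hx.smooth_initial
  upward := fun s t τ h hτ => ⟨h.1, h.2.1, h.2.2.trans hτ⟩
  time_nonneg := fun p hp => hp.2.2
  flow := fun s t h => (hx.flow s h.1 t (max_le (h.2.1.trans h.2.2) h.2.2)).mono
    (Ici_subset_Ici.2 (max_le (h.2.1.trans h.2.2) h.2.2))

theorem isFlowRegion_released (hx : IsTransportedPath f P₁ P₂ x) :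
    IsFlowRegion f x releasedRegion where
  convex := by
    rintro ⟨a, b⟩ ⟨h1, h2⟩ ⟨c, e⟩ ⟨h4, h5⟩ u v hu hv huv
    simp only at h1 h2 h4 h5
    simp only [releasedRegion, mem_ofPred_eq, Prod.smul_mk, Prod.mk_add_mk, smul_eq_mul]
    exact ⟨by nlinarith, by nlinarith⟩
  interior_nonempty := by
    refine ⟨(1, 3), mem_interior.2 ⟨Ioo 0 2 ×ˢ Ioi 2, ?_, isOpen_Ioo.prod isOpen_Ioi, ?_⟩⟩
    · rintro ⟨a, b⟩ ⟨⟨h1, h2⟩, h3⟩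
      exact ⟨h1.le, h2.le.trans (le_of_lt h3)⟩
    · simp only [mem_prod, mem_Ioo, mem_Ioi]
      norm_num
  smooth := hx.smooth_released
  upward := fun s t τ h hτ => ⟨h.1, h.2.trans hτ⟩
  time_nonneg := fun p hp => hp.1.trans hp.2
  flow := fun s t h => (hx.flow s (by linarith [h.1]) t (max_le h.2 (h.1.trans h.2))).mono
    (Ici_subset_Ici.2 (max_le h.2 (h.1.trans h.2)))

theorem mem_initialRegion {t : ℝ} (ht : 0 ≤ t) : ∀ s ∈ Icc (-1 : ℝ) 0, (s, t) ∈ initialRegion :=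
  fun _ hs => ⟨hs.1, hs.2, ht⟩

theorem mem_releasedRegion {t : ℝ} : ∀ s ∈ Icc (0 : ℝ) t, (s, t) ∈ releasedRegion :=
  fun _ hs => ⟨hs.1, hs.2⟩

/-- At the moving end point the virtual displacement is the disturbance. -/
theorem labelDeriv_diagonal (hx : IsTransportedPath f P₁ P₂ x)
    (hP₂ : IsIntegralCurveOn P₂ (fun t x => f x t + d x t) (Ici 0)) {t : ℝ} (ht : 0 ≤ t) :
    labelDeriv x releasedRegion t t = d (P₂ t) t := by
  have h := hx.isFlowRegion_released
  have hp : (t, t) ∈ releasedRegion := ⟨ht, le_rfl⟩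
  have h1 : HasDerivWithinAt (fun τ : ℝ => (τ, τ)) ((1 : ℝ), (1 : ℝ)) (Ici t) t :=
    ((hasDerivAt_id t).prodMk (hasDerivAt_id t)).hasDerivWithinAt
  have h2 := (h.hasFDerivWithinAt hp).comp_hasDerivWithinAt (f := fun τ : ℝ => (τ, τ)) t h1
    fun τ hτ => ⟨ht.trans hτ, le_rfl⟩
  have h3 : HasDerivWithinAt ((fun p : ℝ × ℝ => x p.1 p.2) ∘ fun τ : ℝ => (τ, τ))
      (f (P₂ t) t + d (P₂ t) t) (Ici t) t :=
    ((hP₂ t ht).mono (Ici_subset_Ici.2 ht)).congr (fun τ hτ => hx.target τ (ht.trans hτ))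
      (hx.target t ht)
  have h4 := (uniqueDiffWithinAt_Ici t).eq_deriv _ h2 h3
  -- Along the diagonal the velocity is `f + d`; the time direction accounts for `f`, leaving `d`
  -- for the label direction.
  have h5 : ((1 : ℝ), (1 : ℝ)) = (1, 0) + (0, 1) := by simp
  rw [h5, map_add, h.fderivWithin_vertical hp, hx.target t ht,
    add_comm (f (P₂ t) t)] at h4
  exact add_right_cancel h4

/-- The path may have a kink at label `0`, so the initial and released pieces are treated
separately. -/
theorem integral_split (hx : IsTransportedPath f P₁ P₂ x) {t : ℝ} (ht : 0 ≤ t)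
    {Φ : State n × State n → ℝ} (hΦ : Continuous Φ) :
    IntervalIntegrable (fun s => Φ (x s t, deriv (fun s => x s t) s)) volume (-1) t ∧
      ∫ s in (-1)..t, Φ (x s t, deriv (fun s => x s t) s)
        = (∫ s in (-1)..0, Φ (x s t, labelDeriv x initialRegion s t))
          + ∫ s in 0..t, Φ (x s t, labelDeriv x releasedRegion s t) := by
  have h1 := hx.isFlowRegion_initial.integral_deriv (by norm_num : (-1 : ℝ) ≤ 0)
    (mem_initialRegion ht) hΦ
  have h2 := hx.isFlowRegion_released.integral_deriv ht mem_releasedRegion hΦ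
  refine ⟨h1.1.trans h2.1, ?_⟩
  rw [← h1.2, ← h2.2, intervalIntegral.integral_add_adjacent_intervals h1.1 h2.1]

theorem zLength_split (hS : IsContractingHierarchy f Θ lam) (hx : IsTransportedPath f P₁ P₂ x)
    {t : ℝ} (ht : 0 ≤ t) (i : Fin (m + 2)) :
    zLength Θ i t (fun s => x s t) (-1) t
      = (∫ s in (-1)..0, ‖Θ i (x s t) t (labelDeriv x initialRegion s t i)‖)
        + ∫ s in 0..t, ‖Θ i (x s t) t (labelDeriv x releasedRegion s t i)‖ :=
  (hx.integral_split ht (hS.continuous_zIntegrand i t)).2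

theorem continuousOn_zLength (hS : IsContractingHierarchy f Θ lam)
    (hx : IsTransportedPath f P₁ P₂ x) (i : Fin (m + 2)) :
    ContinuousOn (fun t => zLength Θ i t (fun s => x s t) (-1) t) (Ici 0) := by
  refine ContinuousOn.congr ?_ fun t ht => hx.zLength_split hS ht i
  refine ContinuousOn.add ?_ ?_
  · set g : ℝ × ℝ → ℝ := fun p => ‖Θ i (x p.1 p.2) p.2 (labelDeriv x initialRegion p.1 p.2 i)‖
    have hg : ContinuousOn g initialRegion :=
      (hx.isFlowRegion_initial.continuousOn_z hS i).norm
    -- Clamping label and time into the region makes the integrand globally continuous without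
    -- changing it on the range of integration.
    have hc : Continuous fun q : ℝ × ℝ => g (max (-1) (min q.2 0), max q.1 0) :=
      hg.comp_continuous (by fun_prop) fun q => ⟨le_max_left _ _,
        max_le (by norm_num) (min_le_right _ _), le_max_right _ _⟩
    refine (intervalIntegral.continuous_parametric_intervalIntegral_of_continuous (μ := volume)
      (a₀ := -1) (f := fun t s => g (max (-1) (min s 0), max t 0)) hc
      (continuous_const (y := (0 : ℝ)))).continuousOn.congr fun t ht => ?_
    refine intervalIntegral.integral_congr fun s hs => ?_
    rw [uIcc_of_le (by norm_num)] at hs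
    simp only [min_eq_left hs.2, max_eq_right hs.1, max_eq_left (mem_Ici.1 ht), g]
  · set g : ℝ × ℝ → ℝ := fun p => ‖Θ i (x p.1 p.2) p.2 (labelDeriv x releasedRegion p.1 p.2 i)‖
    have hg : ContinuousOn g releasedRegion :=
      (hx.isFlowRegion_released.continuousOn_z hS i).norm
    have hc : Continuous fun q : ℝ × ℝ => g (max 0 (min q.2 (max q.1 0)), max q.1 0) :=
      hg.comp_continuous (by fun_prop) fun q => ⟨le_max_left _ _,
        max_le (le_max_right _ _) (min_le_right _ _)⟩
    refine (intervalIntegral.continuous_parametric_intervalIntegral_of_continuous (μ := volume)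
      (a₀ := 0) (f := fun t s => g (max 0 (min s (max t 0)), max t 0)) hc
      continuous_id).continuousOn.congr fun t ht => ?_
    refine intervalIntegral.integral_congr fun s hs => ?_
    rw [uIcc_of_le ht] at hs
    simp only [max_eq_left (mem_Ici.1 ht), min_eq_left hs.2, max_eq_right hs.1, g]

/-- The two old pieces contract by `exists_length_step`. The new labels in `[t, t + k]` have
integrand close to its value `‖Θ i d i‖` at the corner `(t, t)`. Each of the three contributions
uses `ε / 3`. -/
theorem upperDini_zLength_le (hS : IsContractingHierarchy f Θ lam)
    (hP₂ : IsIntegralCurveOn P₂ (fun t x => f x t + d x t) (Ici 0))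
    (hx : IsTransportedPath f P₁ P₂ x) (i : Fin (m + 2)) {t : ℝ} (ht : 0 ≤ t) :
    upperDini (fun t => zLength Θ i t (fun s => x s t) (-1) t) t
      + ((lam i * zLength Θ i t (fun s => x s t) (-1) t : ℝ) : EReal)
      ≤ ((disturbance Θ d P₂ i t + ∑ j ∈ Finset.Iio i,
          coupling f Θ i j t (fun s => x s t) (-1) t : ℝ) : EReal) := by
  have h₁ := hx.isFlowRegion_initial
  have h₂ := hx.isFlowRegion_released
  refine upperDini_add_le fun ε hε => ?_
  have hε3 : 0 < ε / 3 := by positivity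
  obtain ⟨δ₁, hδ₁, H₁⟩ := h₁.exists_length_step hS i ht (by norm_num : (-1 : ℝ) ≤ 0)
    (mem_initialRegion ht) hε3
  obtain ⟨δ₂, hδ₂, H₂⟩ := h₂.exists_length_step hS i ht ht mem_releasedRegion hε3
  have hp : (t, t) ∈ releasedRegion := ⟨ht, le_rfl⟩
  obtain ⟨δ₃, hδ₃, H₃⟩ := Metric.continuousWithinAt_iff.1
    ((h₂.continuousOn_z hS i).norm (t, t) hp) (ε / 3) hε3
  have hsmall : ∀ᶠ k in 𝓝[>] (0 : ℝ), k < min δ₁ (min δ₂ δ₃) :=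
    nhdsWithin_le_nhds (eventually_lt_nhds (lt_min hδ₁ (lt_min hδ₂ hδ₃)))
  filter_upwards [hsmall, self_mem_nhdsWithin] with k hk hk0
  have k0 : 0 < k := hk0
  have hk1 : k ≤ δ₁ := hk.le.trans (min_le_left _ _)
  have hk2 : k ≤ δ₂ := hk.le.trans ((min_le_right _ _).trans (min_le_left _ _))
  have hk3 : k < δ₃ := hk.trans_le ((min_le_right _ _).trans (min_le_right _ _))
  have htk : 0 ≤ t + k := by linarith
  have E₁ := H₁ k k0.le hk1
  have E₂ := H₂ k k0.le hk2
  have hcont : ContinuousOn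
      (fun s => ‖Θ i (x s (t + k)) (t + k) (labelDeriv x releasedRegion s (t + k) i)‖)
      (Icc 0 (t + k)) :=
    (IsFlowRegion.continuousOn_slice mem_releasedRegion (h₂.continuousOn_z hS i)).norm
  have hI1 := (hcont.mono (Icc_subset_Icc_right (by linarith : t ≤ t + k))).intervalIntegrable_of_Icc
    (μ := volume) ht
  have hI2 := (hcont.mono (Icc_subset_Icc_left ht)).intervalIntegrable_of_Icc
    (μ := volume) (by linarith : t ≤ t + k)
  have hdiag : ‖Θ i (x t t) t (labelDeriv x releasedRegion t t i)‖ = disturbance Θ d P₂ i t := by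
    rw [hx.labelDeriv_diagonal hP₂ ht, hx.target t ht]
    rfl
  have E₃ : ∫ s in t..(t + k), ‖Θ i (x s (t + k)) (t + k) (labelDeriv x releasedRegion s (t + k) i)‖
      ≤ k * (disturbance Θ d P₂ i t + ε / 3) := by
    have h := intervalIntegral.integral_mono_on (μ := volume) (by linarith : t ≤ t + k) hI2
      (intervalIntegrable_const (c := disturbance Θ d P₂ i t + ε / 3)) fun s hs => by
        have h1 := H₃ (x := (s, t + k)) ⟨ht.trans hs.1, hs.2⟩ (by
          rw [Prod.dist_eq, Real.dist_eq, Real.dist_eq]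
          simp only [add_sub_cancel_left, abs_of_pos k0, abs_of_nonneg (sub_nonneg.2 hs.1)]
          exact max_lt (by linarith [hs.2]) hk3)
        rw [hdiag, Real.dist_eq] at h1
        linarith [(abs_lt.1 h1).2]
    rwa [intervalIntegral.integral_const, add_sub_cancel_left, smul_eq_mul] at h
  have hcoup : ∀ j, coupling f Θ i j t (fun s => x s t) (-1) t
      = (∫ s in (-1)..0, ‖jacBlock f Θ i j (x s t) t‖ *
          ‖Θ j (x s t) t (labelDeriv x initialRegion s t j)‖)
        + ∫ s in 0..t, ‖jacBlock f Θ i j (x s t) t‖ *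
          ‖Θ j (x s t) t (labelDeriv x releasedRegion s t j)‖ :=
    fun j => (hx.integral_split ht (hS.continuous_couplingIntegrand i j ht)).2
  simp only [hx.zLength_split hS ht, hx.zLength_split hS htk, hcoup, Finset.sum_add_distrib]
  rw [← intervalIntegral.integral_add_adjacent_intervals hI1 hI2]
  linarith

end IsTransportedPath

theorem transportedPath_bounds (hS : IsContractingHierarchy f Θ lam)
    (hP₂ : IsIntegralCurveOn P₂ (fun t x => f x t + d x t) (Ici 0))
    (hd : ContinuousOn (fun t => d (P₂ t) t) (Ici 0)) (hx : IsTransportedPath f P₁ P₂ x)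
    {R : Fin (m + 2) → ℝ → ℝ} (hR : ∀ i t, R i t = zLength Θ i t (fun s => x s t) (-1) t) :
    (∀ i, ContinuousOn (R i) (Ici 0)) ∧
      (∀ i t, 0 ≤ t → upperDini (R i) t + ((lam i * R i t : ℝ) : EReal) ≤
        ((disturbance Θ d P₂ i t + ∑ j ∈ Finset.Iio i,
          coupling f Θ i j t (fun s => x s t) (-1) t : ℝ) : EReal)) ∧
      ErrorBounds f Θ lam d P₂ R (fun i t => xLength i (fun s => x s t) (-1) t) := by
  obtain rfl : R = fun i t => zLength Θ i t (fun s => x s t) (-1) t :=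
    funext fun i => funext fun t => hR i t
  have hc := fun i => hx.continuousOn_zLength hS i
  have hD := fun i (t : ℝ) (ht : 0 ≤ t) => hx.upperDini_zLength_le hS hP₂ i ht
  refine ⟨hc, hD, errorBounds_of_upperDini hS.rate_pos (continuousOn_disturbance hS hP₂ hd) hc
    (fun i t ht => intervalIntegral.integral_nonneg (by linarith) fun _ _ => norm_nonneg _)
    (fun i σ hσ t ht => (hD i t ht).trans (EReal.coe_le_coe_iff.2 ?_)) ?_⟩
  · refine add_le_add le_rfl (Finset.sum_le_sum fun j hj => ?_)
    rw [zLength, ← intervalIntegral.integral_const_mul]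
    refine intervalIntegral.integral_mono_on (by linarith)
      (hx.integral_split ht (hS.continuous_couplingIntegrand i j ht)).1
      ((hx.integral_split ht (hS.continuous_zIntegrand j t)).1.const_mul _)
      fun s _ => ?_
    exact mul_le_mul_of_nonneg_right (hσ j (Finset.mem_Iio.1 hj) _ t ht) (norm_nonneg _)
  · intro i c hc hb t ht
    simp only [xLength]
    rw [← intervalIntegral.integral_const_mul]
    refine intervalIntegral.integral_mono_on (by linarith)
      ((hx.integral_split ht (Φ := fun q => ‖q.2 i‖) (by fun_prop)).1.const_mul _)
      (hx.integral_split ht (hS.continuous_zIntegrand i t)).1 fun s _ => ?_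
    exact hb _ t ht _

end TransportedPath

/-! ### The distance defined by smallest path integrals -/

section PathDistance

variable {N : ℕ} {n : Fin N → ℕ} {f : State n → ℝ → State n} {Θ : Transformation n}
  {lam : Fin N → ℝ}

theorem zLength_nonneg (i : Fin N) (t : ℝ) (γ : ℝ → State n) : 0 ≤ zLength Θ i t γ 0 1 :=
  intervalIntegral.integral_nonneg zero_le_one fun _ _ => norm_nonneg _

theorem zDist_le_zLength {p q : State n} (i : Fin N) (t : ℝ) {γ : ℝ → State n}
    (h : IsPath γ p q) : zDist Θ i t p q ≤ zLength Θ i t γ 0 1 :=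
  csInf_le ⟨0, by rintro _ ⟨γ, -, rfl⟩; exact zLength_nonneg i t γ⟩ ⟨γ, h, rfl⟩

theorem zDist_nonneg (i : Fin N) (t : ℝ) (p q : State n) : 0 ≤ zDist Θ i t p q :=
  Real.sInf_nonneg (by rintro _ ⟨γ, -, rfl⟩; exact zLength_nonneg i t γ)

theorem isPath_lineMap (p q : State n) : IsPath (fun s : ℝ => p + s • (q - p)) p q :=
  ⟨by fun_prop, by simp, by simp⟩

theorem deriv_lineMap (p q : State n) (s : ℝ) :
    deriv (fun s : ℝ => p + s • (q - p)) s = q - p := by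
  have h := ((hasDerivAt_id s).smul_const (q - p)).const_add p
  rw [one_smul] at h
  exact h.deriv

theorem exists_path_lt (i : Fin N) (t : ℝ) (p q : State n) {ε : ℝ} (hε : 0 < ε) :
    ∃ γ : ℝ → State n, IsPath γ p q ∧ zLength Θ i t γ 0 1 < zDist Θ i t p q + ε := by
  obtain ⟨_, ⟨γ, hγ, rfl⟩, hlt⟩ := exists_lt_of_csInf_lt
    (s := {L : ℝ | ∃ γ : ℝ → State n, IsPath γ p q ∧ L = zLength Θ i t γ 0 1})
    ⟨_, _, isPath_lineMap p q, rfl⟩ (lt_add_of_pos_right (zDist Θ i t p q) hε)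
  exact ⟨γ, hγ, hlt⟩

theorem IsPath.continuous_deriv {p q : State n} {γ : ℝ → State n} (h : IsPath γ p q) :
    Continuous (deriv γ) := h.smooth.continuous_deriv le_rfl

theorem continuous_along (hS : IsContractingHierarchy f Θ lam) (i : Fin N) (t : ℝ)
    {γ : ℝ → State n} (hγ : ContDiff ℝ 1 γ) :
    Continuous fun s => ‖Θ i (γ s) t (deriv γ s i)‖ :=
  (hS.continuous_zIntegrand i t).comp (f := fun s : ℝ => (γ s, deriv γ s))
    (hγ.continuous.prodMk (hγ.continuous_deriv le_rfl))

theorem zDist_le_of_line (hS : IsContractingHierarchy f Θ lam) (i : Fin N) (t : ℝ)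
    (p q : State n) {M : ℝ}
    (h : ∀ s ∈ Icc (0 : ℝ) 1, ‖Θ i (p + s • (q - p)) t ((q - p) i)‖ ≤ M) :
    zDist Θ i t p q ≤ M := by
  refine (zDist_le_zLength i t (isPath_lineMap p q)).trans ?_
  have h1 := intervalIntegral.integral_mono_on (μ := volume) zero_le_one
    ((continuous_along hS i t (isPath_lineMap p q).smooth).intervalIntegrable 0 1)
    (intervalIntegrable_const (c := M)) fun s hs => by
      rw [deriv_lineMap]
      exact h s hs
  rw [intervalIntegral.integral_const, sub_zero, one_smul] at h1
  exact h1

theorem zLength_congr {i : Fin N} {t a b : ℝ} (hab : a ≤ b) {γ γ' : ℝ → State n}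
    (h : EqOn γ γ' (Ioo a b)) : zLength Θ i t γ a b = zLength Θ i t γ' a b := by
  refine intervalIntegral.integral_congr_ae ?_
  have hb : ∀ᵐ s : ℝ, s ≠ b := by simp [ae_iff]
  filter_upwards [hb] with s hs hs2
  rw [uIoc_of_le hab] at hs2
  have hs3 : s ∈ Ioo a b := ⟨hs2.1, lt_of_le_of_ne hs2.2 hs⟩
  rw [h hs3, (h.eventuallyEq_of_mem (isOpen_Ioo.mem_nhds hs3)).deriv_eq]

/-- Linearity of `Θ i` pulls out the factor `ψ' ≥ 0`. Monotonicity need not be strict, so a path may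
rest. -/
theorem zLength_comp (hS : IsContractingHierarchy f Θ lam) (i : Fin N) (t a b : ℝ)
    {γ : ℝ → State n} (hγ : ContDiff ℝ 1 γ) {ψ : ℝ → ℝ} (hψ : ContDiff ℝ 1 ψ)
    (hmono : Monotone ψ) :
    zLength Θ i t (γ ∘ ψ) a b = zLength Θ i t γ (ψ a) (ψ b) := by
  have hd : ∀ s, HasDerivAt ψ (deriv ψ s) s := fun s =>
    (hψ.differentiable one_ne_zero s).hasDerivAt
  rw [zLength, zLength, ← intervalIntegral.integral_comp_mul_deriv (fun s _ => hd s)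
    (hψ.continuous_deriv le_rfl).continuousOn (continuous_along hS i t hγ)]
  refine intervalIntegral.integral_congr fun s _ => ?_
  have h1 : deriv (γ ∘ ψ) s = deriv ψ s • deriv γ (ψ s) :=
    ((hγ.differentiable one_ne_zero (ψ s)).hasDerivAt.scomp s (hd s)).deriv
  simp only [h1, Function.comp_apply, Pi.smul_apply, map_smul, norm_smul,
    Real.norm_of_nonneg hmono.deriv_nonneg]
  ring

/-- Triangle inequality: two `C¹` paths are joined by a path that slows down at the joint. -/
theorem zDist_triangle (hS : IsContractingHierarchy f Θ lam) (i : Fin N) (t : ℝ)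
    (p q r : State n) : zDist Θ i t p r ≤ zDist Θ i t p q + zDist Θ i t q r := by
  refine le_of_forall_pos_le_add fun ε hε => ?_
  obtain ⟨γ₁, h₁, hl₁⟩ := exists_path_lt (Θ := Θ) i t p q (half_pos hε)
  obtain ⟨γ₂, h₂, hl₂⟩ := exists_path_lt (Θ := Θ) i t q r (half_pos hε)
  set ψ₁ : ℝ → ℝ := fun s => Real.smoothTransition (2 * s) with hψ₁
  set ψ₂ : ℝ → ℝ := fun s => Real.smoothTransition (2 * s - 1) with hψ₂
  have hst : ContDiff ℝ 1 Real.smoothTransition := Real.smoothTransition.contDiff (n := 1)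
  have c₁ : ContDiff ℝ 1 ψ₁ := hst.comp (by fun_prop)
  have c₂ : ContDiff ℝ 1 ψ₂ := hst.comp (by fun_prop)
  have m₁ : Monotone ψ₁ := fun a b hab => Real.smoothTransition.monotone (by linarith)
  have m₂ : Monotone ψ₂ := fun a b hab => Real.smoothTransition.monotone (by linarith)
  -- On each half of the interval one of the two summands rests at `q`, so subtracting `q` leaves
  -- the other; the sum is `C¹` without any gluing.
  set γ : ℝ → State n := fun s => (γ₁ ∘ ψ₁) s + (γ₂ ∘ ψ₂) s - q with hγ
  have hc : ContDiff ℝ 1 γ :=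
    ((h₁.smooth.comp c₁).add (h₂.smooth.comp c₂)).sub contDiff_const
  have e₁ : EqOn γ (γ₁ ∘ ψ₁) (Ioo 0 (1 / 2)) := by
    intro s hs
    have : ψ₂ s = 0 := Real.smoothTransition.zero_of_nonpos (by linarith [hs.2])
    simp [hγ, this, h₂.source]
  have e₂ : EqOn γ (γ₂ ∘ ψ₂) (Ioo (1 / 2) 1) := by
    intro s hs
    have : ψ₁ s = 1 := Real.smoothTransition.one_of_one_le (by linarith [hs.1])
    simp [hγ, this, h₁.target]
  have v10 : ψ₁ 0 = 0 := by simp [hψ₁]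
  have v11 : ψ₁ (1 / 2) = 1 := by simp [hψ₁]
  have v11' : ψ₁ 1 = 1 := Real.smoothTransition.one_of_one_le (by norm_num)
  have v20 : ψ₂ (1 / 2) = 0 := by simp [hψ₂]
  have v20' : ψ₂ 0 = 0 := Real.smoothTransition.zero_of_nonpos (by norm_num)
  have v21 : ψ₂ 1 = 1 := Real.smoothTransition.one_of_one_le (by norm_num)
  have hp : IsPath γ p r := ⟨hc, by simp [hγ, v10, v20', h₁.source, h₂.source],
    by simp [hγ, v11', v21, h₁.target, h₂.target]⟩
  have hcont := continuous_along hS i t hc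
  have hsplit : zLength Θ i t γ 0 1 = zLength Θ i t γ 0 (1 / 2) + zLength Θ i t γ (1 / 2) 1 :=
    (intervalIntegral.integral_add_adjacent_intervals (hcont.intervalIntegrable _ _)
      (hcont.intervalIntegrable _ _)).symm
  have hle := zDist_le_zLength (Θ := Θ) i t hp
  rw [hsplit, zLength_congr (by norm_num) e₁, zLength_congr (by norm_num) e₂,
    zLength_comp hS i t _ _ h₁.smooth c₁ m₁, zLength_comp hS i t _ _ h₂.smooth c₂ m₂,
    v10, v11, v20, v21] at hle
  linarith

theorem deriv_component {γ : ℝ → State n} (hγ : ContDiff ℝ 1 γ) (s : ℝ) (i : Fin N) :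
    HasDerivAt (fun s => γ s i) (deriv γ s i) s :=
  hasDerivAt_pi.1 (hγ.differentiable one_ne_zero s).hasDerivAt i

/-- If each group has its own metric, paths that are nearly shortest for one group each combine to
a path that is nearly shortest for all groups. -/
theorem exists_path_forall_le
    (hΘ : ∀ i (x y : State n) t, 0 ≤ t → x i = y i → Θ i x t = Θ i y t) {t : ℝ} (ht : 0 ≤ t)
    (p q : State n) {ε : ℝ} (hε : 0 < ε) :
    ∃ γ : ℝ → State n, IsPath γ p q ∧ ∀ j, zLength Θ j t γ 0 1 ≤ zDist Θ j t p q + ε := by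
  choose γ hγ hl using fun j => exists_path_lt (Θ := Θ) j t p q hε
  have hc : ContDiff ℝ 1 fun s j => γ j s j :=
    contDiff_pi.2 fun j => (contDiff_pi.1 (hγ j).smooth) j
  -- Component `j` is taken from the path chosen for group `j`, the only component its length
  -- depends on.
  refine ⟨fun s j => γ j s j, ⟨hc, funext fun j => congrFun (hγ j).source j,
    funext fun j => congrFun (hγ j).target j⟩, fun j => (le_of_eq ?_).trans (hl j).le⟩
  refine intervalIntegral.integral_congr fun s _ => ?_
  have h1 : deriv (fun s j => γ j s j) s j = deriv (γ j) s j :=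
    (deriv_component hc s j).unique (deriv_component (hγ j).smooth s j)
  have h2 : Θ j (fun k => γ k s k) t = Θ j (γ j s) t := hΘ j _ _ t ht rfl
  simp only [h1, h2]

theorem norm_le_sum_norm (u : State n) : ‖u‖ ≤ ∑ j, ‖u j‖ :=
  (pi_norm_le_iff_of_nonneg (Finset.sum_nonneg fun _ _ => norm_nonneg _)).2 fun j =>
    Finset.single_le_sum (f := fun j => ‖u j‖) (fun _ _ => norm_nonneg _) (Finset.mem_univ j)

theorem xLength_le (hS : IsContractingHierarchy f Θ lam) {i : Fin N} {t c : ℝ}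
    (hc : ∀ x v, c * ‖v‖ ≤ ‖Θ i x t v‖) {γ : ℝ → State n} (hγ : ContDiff ℝ 1 γ) :
    c * xLength i γ 0 1 ≤ zLength Θ i t γ 0 1 := by
  have hd : Continuous fun s => ‖deriv γ s i‖ :=
    ((continuous_apply i).comp (hγ.continuous_deriv le_rfl)).norm
  rw [xLength, ← intervalIntegral.integral_const_mul]
  exact intervalIntegral.integral_mono_on zero_le_one
    ((continuous_const.mul hd).intervalIntegrable _ _)
    ((continuous_along hS i t hγ).intervalIntegrable _ _) fun s _ => hc _ _

theorem norm_sub_le_xLength {p q : State n} {γ : ℝ → State n} (hγ : IsPath γ p q) (i : Fin N) :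
    ‖q i - p i‖ ≤ xLength i γ 0 1 := by
  have hd : Continuous fun s => deriv γ s i :=
    (continuous_apply i).comp (hγ.smooth.continuous_deriv le_rfl)
  have h1 := intervalIntegral.integral_eq_sub_of_hasDerivAt (a := 0) (b := 1)
    (fun s _ => deriv_component hγ.smooth s i) (hd.intervalIntegrable _ _)
  rw [← hγ.source, ← hγ.target, ← h1]
  exact intervalIntegral.norm_integral_le_integral_norm zero_le_one

theorem norm_sub_le_zDist (hS : IsContractingHierarchy f Θ lam) {i : Fin N} {t c : ℝ}
    (h0 : 0 < c) (hc : ∀ x v, c * ‖v‖ ≤ ‖Θ i x t v‖) (p q : State n) :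
    c * ‖q i - p i‖ ≤ zDist Θ i t p q := by
  refine le_of_forall_pos_le_add fun ε hε => ?_
  obtain ⟨γ, h, hl⟩ := exists_path_lt (Θ := Θ) i t p q hε
  exact (mul_le_mul_of_nonneg_left (norm_sub_le_xLength h i) h0.le).trans
    ((xLength_le hS hc h.smooth).trans hl.le)

/-- A path that is short for all groups is short and stays in a ball. -/
theorem exists_length_const (hS : IsContractingHierarchy f Θ lam) :
    ∃ C : ℝ, 0 ≤ C ∧ ∀ t, 0 ≤ t → ∀ (p q : State n) (γ : ℝ → State n), IsPath γ p q →
      ∀ L, (∀ j, zLength Θ j t γ 0 1 ≤ L) →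
      ∫ s in (0 : ℝ)..1, ‖deriv γ s‖ ≤ C * L ∧ ∀ s ∈ Icc (0 : ℝ) 1, ‖γ s‖ ≤ ‖p‖ + C * L := by
  choose c hc hb using hS.uniformly_pos
  -- Group `j` moves by at most `L / c j`, and the norm of `State n` is at most the sum of the norms
  -- of the components.
  refine ⟨∑ j, (c j)⁻¹, Finset.sum_nonneg fun j _ => (inv_pos.2 (hc j)).le,
    fun t ht p q γ hγ L hL => ?_⟩
  have hdc : Continuous (deriv γ) := hγ.continuous_deriv
  have hdj : ∀ j, Continuous fun s => ‖deriv γ s j‖ := fun j =>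
    ((continuous_apply j).comp hdc).norm
  have h1 : ∫ s in (0 : ℝ)..1, ‖deriv γ s‖ ≤ (∑ j, (c j)⁻¹) * L := by
    calc ∫ s in (0 : ℝ)..1, ‖deriv γ s‖ ≤ ∫ s in (0 : ℝ)..1, ∑ j, ‖deriv γ s j‖ :=
          intervalIntegral.integral_mono_on zero_le_one (hdc.norm.intervalIntegrable _ _)
            ((continuous_finsetSum _ fun j _ => hdj j).intervalIntegrable _ _)
            fun s _ => norm_le_sum_norm _
      _ = ∑ j, xLength j γ 0 1 :=
          intervalIntegral.integral_finsetSum fun j _ => (hdj j).intervalIntegrable _ _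
      _ ≤ ∑ j, (c j)⁻¹ * L := Finset.sum_le_sum fun j _ => by
          rw [← div_eq_inv_mul, le_div_iff₀' (hc j)]
          exact (xLength_le hS (fun x v => hb j x t ht v) hγ.smooth).trans (hL j)
      _ = _ := (Finset.sum_mul _ _ _).symm
  refine ⟨h1, fun s hs => ?_⟩
  have h2 := intervalIntegral.integral_deriv_eq_sub (f := γ) (a := 0) (b := s)
    (fun r _ => hγ.smooth.differentiable one_ne_zero r) (hdc.intervalIntegrable _ _)
  have h3 : ‖γ s - γ 0‖ ≤ ∫ r in (0 : ℝ)..1, ‖deriv γ r‖ := by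
    rw [← h2]
    refine (intervalIntegral.norm_integral_le_integral_norm hs.1).trans ?_
    exact intervalIntegral.integral_mono_interval le_rfl hs.1 hs.2
      (Eventually.of_forall fun _ => norm_nonneg _) (hdc.norm.intervalIntegrable _ _)
  have h4 := norm_le_norm_add_norm_sub' (γ s) (γ 0)
  rw [hγ.source] at h4 h3
  linarith

/-- Locally the distance is bounded by the norm of the frozen metric. -/
theorem exists_local_zDist_le (hS : IsContractingHierarchy f Θ lam) (i : Fin N) (x₀ : State n)
    (t₀ : ℝ) {ε : ℝ} (hε : 0 < ε) :
    ∃ δ > 0, ∀ t p q, dist t t₀ < δ → dist p x₀ < δ → dist q x₀ < δ →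
      zDist Θ i t p q ≤ ‖Θ i x₀ t₀ ((q - p) i)‖ + ε * ‖q - p‖ := by
  obtain ⟨δ, hδ, h⟩ := Metric.continuous_iff.1 (hS.continuous_theta i) (x₀, t₀) ε hε
  refine ⟨δ, hδ, fun t p q ht hp hq => zDist_le_of_line hS i t p q fun s hs => ?_⟩
  -- The straight segment stays in the ball, where `Θ i` is within `ε` of its frozen value.
  have hconv := (convex_ball x₀ δ).add_smul_sub_mem hp hq hs
  have h1 := (h (p + s • (q - p), t) (by rw [Prod.dist_eq]; exact max_lt hconv ht)).le
  rw [dist_eq_norm] at h1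
  have h2 := (Θ i (p + s • (q - p)) t - Θ i x₀ t₀).le_of_opNorm_le h1 ((q - p) i)
  have h3 := norm_le_norm_add_norm_sub' (Θ i (p + s • (q - p)) t ((q - p) i))
    (Θ i x₀ t₀ ((q - p) i))
  have h4 := mul_le_mul_of_nonneg_left (norm_le_pi_norm (q - p) i) hε.le
  rw [sub_apply] at h2
  linarith

end PathDistance

/-! ### One explicit Euler step -/

section EulerStep

variable {N : ℕ} {n : Fin N → ℕ} {f : State n → ℝ → State n} {Θ : Transformation n}
  {lam : Fin N → ℝ}

/-- An explicit Euler step of a virtual displacement `u` at `x`, uniformly for `x` in a compact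
set. -/
theorem exists_euler_step (hS : IsContractingHierarchy f Θ lam) (i : Fin N) {K : Set (State n)}
    (hK : IsCompact K) {t : ℝ} (ht : 0 ≤ t) {ε : ℝ} (hε : 0 < ε) :
    ∃ δ > 0, ∀ x ∈ K, ∀ k, 0 ≤ k → k ≤ δ → ∀ u : State n,
      ‖Θ i (x + k • f x t) (t + k) ((u + k • fderiv ℝ (fun y => f y t) x u) i)‖
        ≤ (1 - k * lam i) * ‖Θ i x t (u i)‖
          + k * (∑ j ∈ Finset.Iio i, ‖jacBlock f Θ i j x t‖ * ‖Θ j x t (u j)‖)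
          + ε * k * ‖u‖ := by
  set A : State n → State n →L[ℝ] State n := fun x => fderiv ℝ (fun y => f y t) x with hA
  have hAc : Continuous A :=
    hS.continuous_fderiv_field.comp (continuous_id.prodMk continuous_const)
  have hfc : Continuous fun x => f x t :=
    hS.smooth_field.continuous.comp (continuous_id.prodMk continuous_const)
  set π : State n →L[ℝ] EuclideanSpace ℝ (Fin (n i)) := ContinuousLinearMap.proj i with hπ
  -- The operator sending a displacement at time `t` to its transform after an Euler step of length
  -- `τ - t`. Expanding it in operator norm makes the error uniform in `u`; its derivative at `τ =
  -- t` is `zRate`.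
  set g : State n → ℝ → State n →L[ℝ] EuclideanSpace ℝ (Fin (n i)) := fun x τ =>
    (Θ i (x + (τ - t) • f x t) τ).comp (π + (τ - t) • π.comp (A x)) with hg
  set g' : State n → ℝ → State n →L[ℝ] EuclideanSpace ℝ (Fin (n i)) := fun x τ =>
    (fderiv ℝ (fun p : State n × ℝ => Θ i p.1 p.2) (x + (τ - t) • f x t, τ) (f x t, 1)).comp
      (π + (τ - t) • π.comp (A x)) + (Θ i (x + (τ - t) • f x t) τ).comp (π.comp (A x)) with hg'
  have hd : ∀ x τ, HasDerivAt (g x) (g' x τ) τ := by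
    intro x τ
    have h1 : HasDerivAt (fun τ : ℝ => (x + (τ - t) • f x t, τ)) (f x t, (1 : ℝ)) τ := by
      have h2 := (((hasDerivAt_id τ).sub_const t).smul_const (f x t)).const_add x
      rw [one_smul] at h2
      exact h2.prodMk (hasDerivAt_id τ)
    have h3 := ((hS.smooth_theta i).differentiable one_ne_zero
      (x + (τ - t) • f x t, τ)).hasFDerivAt.comp_hasDerivAt
        (f := fun τ : ℝ => (x + (τ - t) • f x t, τ)) τ h1
    have h4 : HasDerivAt (fun τ : ℝ => π + (τ - t) • π.comp (A x)) (π.comp (A x)) τ := by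
      have h2 := (((hasDerivAt_id τ).sub_const t).smul_const (π.comp (A x))).const_add π
      rwa [one_smul] at h2
    exact h3.clm_comp h4
  have hcurve : Continuous fun p : State n × ℝ => (p.1 + (p.2 - t) • f p.1 t, p.2) := by fun_prop
  have hlin : Continuous fun p : State n × ℝ => π + (p.2 - t) • π.comp (A p.1) :=
    continuous_const.add ((continuous_snd.sub continuous_const).smul
      (continuous_const.clm_comp (hAc.comp continuous_fst)))
  have hg'c : Continuous fun p : State n × ℝ => g' p.1 p.2 :=
    ((((hS.continuous_theta_fderiv i).comp hcurve).clm_apply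
      ((hfc.comp continuous_fst).prodMk continuous_const)).clm_comp hlin).add
      (((hS.continuous_theta i).comp hcurve).clm_comp
        (continuous_const.clm_comp (hAc.comp continuous_fst)))
  obtain ⟨δ, hδ, hT⟩ := exists_uniform_taylor hK (g := g) (g' := g') (t := t)
    (fun x _ τ _ => (hd x τ).hasDerivWithinAt)
    (fun x _ τ _ => (hd x τ).continuousAt.continuousWithinAt) hg'c.continuousOn (half_pos hε)
  obtain ⟨C, hC⟩ := hK.exists_bound_of_continuousOn
    (f := fun x => jacBlock f Θ i i x t)
    (((hS.continuousOn_jacBlock i i).comp_continuous (f := fun x : State n => (x, t))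
      (by fun_prop) fun _ => ht).continuousOn)
  obtain ⟨M, hM⟩ := hK.exists_bound_of_continuousOn (f := fun x => Θ i x t)
    (((hS.continuous_theta i).comp (f := fun x : State n => (x, t)) (by fun_prop)).continuousOn)
  -- The absolute value is needed since a bound over a possibly empty `K` has no sign.
  set B := C ^ 2 * |M| with hB
  have hB0 : 0 ≤ B := by positivity
  have hl := hS.rate_pos i
  refine ⟨min δ (min (1 / lam i) (ε / 2 / (B + 1))), by positivity, fun x hx k k0 hk u => ?_⟩
  have hk1 : k ≤ δ := hk.trans (min_le_left _ _)
  have hk2 : k * lam i ≤ 1 := by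
    have := hk.trans ((min_le_right _ _).trans (min_le_left _ _))
    rwa [le_div_iff₀ hl] at this
  have hk3 : k * B ≤ ε / 2 := by
    have := hk.trans ((min_le_right _ _).trans (min_le_right _ _))
    rw [le_div_iff₀ (by positivity)] at this
    nlinarith
  have e1 : g x (t + k) u
      = Θ i (x + k • f x t) (t + k) ((u + k • fderiv ℝ (fun y => f y t) x u) i) := by
    simp [hg, hπ, hA]
  have e2 : (g x t + k • g' x t) u = Θ i x t (u i) + k • zRate f Θ i x t u := by
    simp [hg, hg', hπ, hA, zRate_apply]
  have h1 := (g x (t + k) - (g x t + k • g' x t)).le_of_opNorm_le (hT x hx k k0 hk1) u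
  rw [sub_apply, e1, e2] at h1
  have h2 := hS.norm_add_smul_zRate_le i x ht k0 hk2 (hC x hx) u
  have h3 := norm_le_norm_add_norm_sub'
    (Θ i (x + k • f x t) (t + k) ((u + k • fderiv ℝ (fun y => f y t) x u) i))
    (Θ i x t (u i) + k • zRate f Θ i x t u)
  have h4 : ‖Θ i x t (u i)‖ ≤ |M| * ‖u‖ :=
    ((Θ i x t).le_opNorm _).trans (mul_le_mul ((hM x hx).trans (le_abs_self M))
      (norm_le_pi_norm u i) (norm_nonneg _) (abs_nonneg M))
  have h5 : k ^ 2 * C ^ 2 * ‖Θ i x t (u i)‖ ≤ ε / 2 * k * ‖u‖ := by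
    calc k ^ 2 * C ^ 2 * ‖Θ i x t (u i)‖ ≤ k ^ 2 * C ^ 2 * (|M| * ‖u‖) :=
          mul_le_mul_of_nonneg_left h4 (by positivity)
      _ = k * B * (k * ‖u‖) := by rw [hB]; ring
      _ ≤ ε / 2 * (k * ‖u‖) := mul_le_mul_of_nonneg_right hk3 (by positivity)
      _ = _ := by ring
  linarith

/-- The Euler step of a whole path. -/
theorem exists_zLength_step (hS : IsContractingHierarchy f Θ lam) (i : Fin N) {K : Set (State n)}
    (hK : IsCompact K) {t : ℝ} (ht : 0 ≤ t) {ε : ℝ} (hε : 0 < ε) :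
    ∃ δ > 0, ∀ k, 0 ≤ k → k ≤ δ → ∀ (p q : State n) (γ : ℝ → State n), IsPath γ p q →
      (∀ s ∈ Icc (0 : ℝ) 1, γ s ∈ K) →
      zDist Θ i (t + k) (p + k • f p t) (q + k • f q t)
        ≤ (1 - k * lam i) * zLength Θ i t γ 0 1
          + k * (∑ j ∈ Finset.Iio i, coupling f Θ i j t γ 0 1)
          + ε * k * ∫ s in (0 : ℝ)..1, ‖deriv γ s‖ := by
  obtain ⟨δ, hδ, H⟩ := exists_euler_step hS i hK ht hε
  refine ⟨δ, hδ, fun k k0 hk p q γ hγ hγK => ?_⟩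
  have hft : ContDiff ℝ 1 fun y => f y t :=
    hS.smooth_field.comp (contDiff_id.prodMk contDiff_const)
  have hc : ContDiff ℝ 1 fun s => γ s + k • f (γ s) t :=
    hγ.smooth.add ((hft.comp hγ.smooth).const_smul k)
  have hp : IsPath (fun s => γ s + k • f (γ s) t) (p + k • f p t) (q + k • f q t) :=
    ⟨hc, by rw [hγ.source], by rw [hγ.target]⟩
  have hd : ∀ s, deriv (fun s => γ s + k • f (γ s) t) s
      = deriv γ s + k • fderiv ℝ (fun y => f y t) (γ s) (deriv γ s) := fun s => by
    have h1 := (hγ.smooth.differentiable one_ne_zero s).hasDerivAt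
    have h2 := (hft.differentiable one_ne_zero (γ s)).hasFDerivAt.comp_hasDerivAt s h1
    exact (h1.add (h2.const_smul k)).deriv
  have hcoup : ∀ j, Continuous fun s => ‖jacBlock f Θ i j (γ s) t‖ * ‖Θ j (γ s) t (deriv γ s j)‖ :=
    fun j => (hS.continuous_couplingIntegrand i j ht).comp (f := fun s : ℝ => (γ s, deriv γ s))
      (hγ.smooth.continuous.prodMk hγ.continuous_deriv)
  refine (zDist_le_zLength i (t + k) hp).trans ?_
  refine integral_le_of_le_linear zero_le_one (continuous_along hS i (t + k) hc).continuousOn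
    (continuous_along hS i t hγ.smooth).continuousOn hγ.continuous_deriv.norm.continuousOn
    (q := fun j s => ‖jacBlock f Θ i j (γ s) t‖ * ‖Θ j (γ s) t (deriv γ s j)‖)
    (fun j => (hcoup j).continuousOn) fun s hs => ?_
  rw [hd]
  exact H (γ s) (hγK s hs) k k0 hk (deriv γ s)

theorem tendsto_difference_quotient {P : ℝ → State n} {v : State n} {t : ℝ}
    (h : HasDerivWithinAt P v (Ici t) t) :
    Tendsto (fun k : ℝ => k⁻¹ • (P (t + k) - P t)) (𝓝[>] 0) (𝓝 v) := by
  have h1 := (hasDerivWithinAt_iff_tendsto_slope' (s := Ioi t) (by simp)).1 h.Ioi_of_Ici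
  have h4 : Tendsto (fun k : ℝ => t + k) (𝓝[>] 0) (𝓝[>] t) := by
    refine tendsto_nhdsWithin_iff.2 ⟨?_, ?_⟩
    · have : Tendsto (fun k : ℝ => t + k) (𝓝 0) (𝓝 (t + 0)) :=
        (continuous_const.add continuous_id).tendsto 0
      rw [add_zero] at this
      exact this.mono_left nhdsWithin_le_nhds
    · filter_upwards [self_mem_nhdsWithin] with k hk
      exact lt_add_of_pos_right t (mem_Ioi.1 hk)
  refine (h1.comp h4).congr fun k => ?_
  simp [slope_def_module]

/-- Two curves that leave `x₀` together separate at the rate given by the metric at `x₀`. -/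
theorem eventually_zDist_le (hS : IsContractingHierarchy f Θ lam) (i : Fin N) {x₀ w : State n}
    {t : ℝ} {a b : ℝ → State n} (ha : Tendsto a (𝓝[>] 0) (𝓝 x₀)) (hb : Tendsto b (𝓝[>] 0) (𝓝 x₀))
    (hab : Tendsto (fun k : ℝ => k⁻¹ • (b k - a k)) (𝓝[>] 0) (𝓝 w)) {ε : ℝ} (hε : 0 < ε) :
    ∀ᶠ k in 𝓝[>] (0 : ℝ), zDist Θ i (t + k) (a k) (b k) ≤ k * (‖Θ i x₀ t (w i)‖ + ε) := by
  set ε' := ε / 2 / (‖w‖ + 1) with hε'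
  have hw : 0 < ‖w‖ + 1 := by positivity
  have hε'0 : 0 < ε' := by positivity
  obtain ⟨δ, hδ, H⟩ := exists_local_zDist_le hS i x₀ t hε'0
  have hlim : Tendsto (fun k : ℝ => ‖Θ i x₀ t ((k⁻¹ • (b k - a k)) i)‖ + ε' * ‖k⁻¹ • (b k - a k)‖)
      (𝓝[>] 0) (𝓝 (‖Θ i x₀ t (w i)‖ + ε' * ‖w‖)) := by
    have hcont : Continuous fun v : State n => ‖Θ i x₀ t (v i)‖ + ε' * ‖v‖ := by fun_prop
    exact (hcont.tendsto w).comp hab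
  have hlt : ‖Θ i x₀ t (w i)‖ + ε' * ‖w‖ < ‖Θ i x₀ t (w i)‖ + ε := by
    have : ε' * (‖w‖ + 1) = ε / 2 := div_mul_cancel₀ _ hw.ne'
    nlinarith
  have hsmall : ∀ᶠ k in 𝓝[>] (0 : ℝ), k < δ :=
    nhdsWithin_le_nhds (eventually_lt_nhds hδ)
  filter_upwards [hlim.eventually_lt_const hlt, ha.eventually (Metric.ball_mem_nhds x₀ hδ),
    hb.eventually (Metric.ball_mem_nhds x₀ hδ), hsmall, self_mem_nhdsWithin] with k h1 h2 h3 h4 h5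
  have k0 : 0 < k := h5
  have h6 := H (t + k) (a k) (b k) (by simpa [Real.dist_eq, abs_of_pos k0] using h4) h2 h3
  have h7 : b k - a k = k • (k⁻¹ • (b k - a k)) := by rw [smul_inv_smul₀ k0.ne']
  have h8 : ‖Θ i x₀ t ((b k - a k) i)‖ + ε' * ‖b k - a k‖
      = k * (‖Θ i x₀ t ((k⁻¹ • (b k - a k)) i)‖ + ε' * ‖k⁻¹ • (b k - a k)‖) := by
    conv_lhs => rw [h7]
    rw [Pi.smul_apply, map_smul, norm_smul, norm_smul k, Real.norm_of_nonneg k0.le]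
    ring
  rw [h8] at h6
  exact h6.trans (mul_le_mul_of_nonneg_left h1.le k0.le)

end EulerStep

/-! ### Smallest path integrals between the two trajectories -/

section ShortestPath

variable {m : ℕ} {n : Fin (m + 2) → ℕ} {f : State n → ℝ → State n} {Θ : Transformation n}
  {lam : Fin (m + 2) → ℝ} {d : State n → ℝ → State n} {P₁ P₂ : ℝ → State n}

/-- The route runs from `P₁ (t + k)` through the Euler images of `P₁ t` and `P₂ t` to `P₂ (t + k)`.
The admissible `k` do not depend on the path within `K`, so nearly shortest paths may be chosen
after `k`. -/
theorem eventually_zDist_step (hS : IsContractingHierarchy f Θ lam)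
    (hP₁ : IsIntegralCurveOn P₁ (fun t x => f x t) (Ici 0))
    (hP₂ : IsIntegralCurveOn P₂ (fun t x => f x t + d x t) (Ici 0)) (i : Fin (m + 2))
    {K : Set (State n)} (hK : IsCompact K) {t : ℝ} (ht : 0 ≤ t) {ε : ℝ} (hε : 0 < ε) :
    ∀ᶠ k in 𝓝[>] (0 : ℝ), ∀ γ : ℝ → State n, IsPath γ (P₁ t) (P₂ t) →
      (∀ s ∈ Icc (0 : ℝ) 1, γ s ∈ K) →
      zDist Θ i (t + k) (P₁ (t + k)) (P₂ (t + k))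
        ≤ (1 - k * lam i) * zLength Θ i t γ 0 1
          + k * (∑ j ∈ Finset.Iio i, coupling f Θ i j t γ 0 1)
          + k * disturbance Θ d P₂ i t + ε * k * (1 + ∫ s in (0 : ℝ)..1, ‖deriv γ s‖) := by
  obtain ⟨δ, hδ, H⟩ := exists_zLength_step hS i hK ht hε
  have hsub := Ici_subset_Ici.2 ht
  have D₁ := (hP₁ t ht).mono hsub
  have D₂ := (hP₂ t ht).mono hsub
  have hadd : Tendsto (fun k : ℝ => t + k) (𝓝[>] 0) (𝓝[≥] t) := by
    refine tendsto_nhdsWithin_iff.2 ⟨?_, ?_⟩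
    · have : Tendsto (fun k : ℝ => t + k) (𝓝 0) (𝓝 (t + 0)) :=
        (continuous_const.add continuous_id).tendsto 0
      rw [add_zero] at this
      exact this.mono_left nhdsWithin_le_nhds
    · filter_upwards [self_mem_nhdsWithin] with k hk
      exact le_add_of_nonneg_right (le_of_lt (mem_Ioi.1 hk))
  have heuler : ∀ p : State n, Tendsto (fun k : ℝ => p + k • f p t) (𝓝[>] 0) (𝓝 p) := by
    intro p
    have h : Continuous fun k : ℝ => p + k • f p t := by fun_prop
    have := h.tendsto 0
    rw [zero_smul, add_zero] at this
    exact this.mono_left nhdsWithin_le_nhds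
  -- The unperturbed trajectory agrees with its Euler step to first order, hence the relative
  -- velocity `0`; in `e₂` it is the disturbance.
  have e₁ := eventually_zDist_le hS i (t := t) (w := 0) (D₁.continuousWithinAt.tendsto.comp hadd)
    (heuler (P₁ t)) (by
      have h := (tendsto_const_nhds (x := f (P₁ t) t)).sub (tendsto_difference_quotient D₁)
      rw [sub_self] at h
      refine h.congr' ?_
      filter_upwards [self_mem_nhdsWithin] with k hk
      have hk0 : k ≠ 0 := (mem_Ioi.1 hk).ne'
      simp only [Function.comp_apply, smul_sub, smul_add, inv_smul_smul₀ hk0]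
      abel) (half_pos hε)
  have e₂ := eventually_zDist_le hS i (t := t) (w := d (P₂ t) t) (heuler (P₂ t))
    (D₂.continuousWithinAt.tendsto.comp hadd) (by
      have h := (tendsto_difference_quotient D₂).sub (tendsto_const_nhds (x := f (P₂ t) t))
      rw [add_sub_cancel_left] at h
      refine h.congr' ?_
      filter_upwards [self_mem_nhdsWithin] with k hk
      have hk0 : k ≠ 0 := (mem_Ioi.1 hk).ne'
      simp only [Function.comp_apply, smul_sub, smul_add, inv_smul_smul₀ hk0]
      abel) (half_pos hε)
  have hsmall : ∀ᶠ k in 𝓝[>] (0 : ℝ), k < δ := nhdsWithin_le_nhds (eventually_lt_nhds hδ)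
  filter_upwards [e₁, e₂, hsmall, self_mem_nhdsWithin] with k h₁ h₂ h₃ h₄ γ hγ hγK
  have k0 : 0 < k := h₄
  have h₅ := H k k0.le h₃.le _ _ γ hγ hγK
  have h₆ := zDist_triangle hS i (t + k) (P₁ (t + k)) (P₁ t + k • f (P₁ t) t) (P₂ (t + k))
  have h₇ := zDist_triangle hS i (t + k) (P₁ t + k • f (P₁ t) t) (P₂ t + k • f (P₂ t) t)
    (P₂ (t + k))
  simp only [Function.comp_apply, Pi.zero_apply, map_zero, norm_zero, zero_add] at h₁ h₂
  have h₈ : ‖Θ i (P₂ t) t (d (P₂ t) t i)‖ = disturbance Θ d P₂ i t := rfl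
  rw [h₈] at h₂
  linarith

theorem upperDini_zDist_le_coupling (hS : IsContractingHierarchy f Θ lam)
    (hP₁ : IsIntegralCurveOn P₁ (fun t x => f x t) (Ici 0))
    (hP₂ : IsIntegralCurveOn P₂ (fun t x => f x t + d x t) (Ici 0)) (i : Fin (m + 2)) {t : ℝ}
    (ht : 0 ≤ t) {γ : ℝ → State n} (hγ : IsPath γ (P₁ t) (P₂ t))
    (hmin : zLength Θ i t γ 0 1 = zDist Θ i t (P₁ t) (P₂ t)) :
    upperDini (fun t => zDist Θ i t (P₁ t) (P₂ t)) t
      + ((lam i * zDist Θ i t (P₁ t) (P₂ t) : ℝ) : EReal)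
      ≤ ((disturbance Θ d P₂ i t + ∑ j ∈ Finset.Iio i, coupling f Θ i j t γ 0 1 : ℝ) : EReal) := by
  refine upperDini_add_le fun ε hε => ?_
  have hI : 0 ≤ ∫ s in (0 : ℝ)..1, ‖deriv γ s‖ :=
    intervalIntegral.integral_nonneg zero_le_one fun _ _ => norm_nonneg _
  set I := ∫ s in (0 : ℝ)..1, ‖deriv γ s‖
  have hI1 : 0 < 1 + I := by linarith
  -- A given minimiser stays in its own image, which serves as the compact set.
  filter_upwards [eventually_zDist_step hS hP₁ hP₂ i
    (isCompact_Icc.image hγ.smooth.continuous) ht (div_pos hε hI1)] with k hk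
  have h1 := hk γ hγ fun s hs => mem_image_of_mem γ hs
  have h2 : ε / (1 + I) * k * (1 + I) = ε * k := by field_simp
  rw [h2, hmin] at h1
  linarith

/-- No minimiser is assumed: for each fixed small `k` the step is applied to paths within `η` of
optimal for all groups, and then `η` tends to `0`. -/
theorem upperDini_zDist_le (hS : IsContractingHierarchy f Θ lam)
    (hΘ : ∀ i (x y : State n) t, 0 ≤ t → x i = y i → Θ i x t = Θ i y t)
    (hP₁ : IsIntegralCurveOn P₁ (fun t x => f x t) (Ici 0))
    (hP₂ : IsIntegralCurveOn P₂ (fun t x => f x t + d x t) (Ici 0)) (i : Fin (m + 2))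
    (σ : Fin (m + 2) → ℝ) (hσ : ∀ j < i, ∀ x t, 0 ≤ t → ‖jacBlock f Θ i j x t‖ ≤ σ j) {t : ℝ}
    (ht : 0 ≤ t) :
    upperDini (fun t => zDist Θ i t (P₁ t) (P₂ t)) t
      + ((lam i * zDist Θ i t (P₁ t) (P₂ t) : ℝ) : EReal)
      ≤ ((disturbance Θ d P₂ i t
          + ∑ j ∈ Finset.Iio i, σ j * zDist Θ j t (P₁ t) (P₂ t) : ℝ) : EReal) := by
  refine upperDini_add_le fun ε hε => ?_
  set D := fun j => zDist Θ j t (P₁ t) (P₂ t) with hD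
  have hD0 : ∀ j, 0 ≤ D j := fun j => zDist_nonneg j t _ _
  obtain ⟨C, hC, hlen⟩ := exists_length_const hS
  -- The `+ 1` leaves room for every tolerance `η ≤ 1`, so that all the paths used lie in one ball.
  set L := ∑ j, D j + 1 with hL
  have hL0 : 0 ≤ L := add_nonneg (Finset.sum_nonneg fun j _ => hD0 j) zero_le_one
  have hCL : 0 ≤ C * L := mul_nonneg hC hL0
  have hCL1 : 0 < 1 + C * L := by linarith
  have hσ0 : ∀ j ∈ Finset.Iio i, 0 ≤ σ j := fun j hj =>
    (norm_nonneg _).trans (hσ j (Finset.mem_Iio.1 hj) 0 0 le_rfl)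
  have hl := hS.rate_pos i
  have hsmall : ∀ᶠ k in 𝓝[>] (0 : ℝ), k < 1 / lam i :=
    nhdsWithin_le_nhds (eventually_lt_nhds (by positivity))
  filter_upwards [eventually_zDist_step hS hP₁ hP₂ i
    (isCompact_closedBall (0 : State n) (‖P₁ t‖ + C * L)) ht (div_pos hε hCL1), hsmall,
    self_mem_nhdsWithin] with k hk hk1 hk2
  have k0 : 0 < k := hk2
  have hkl : 0 ≤ 1 - k * lam i := by
    rw [lt_div_iff₀ hl] at hk1
    linarith
  set B := (1 - k * lam i) + k * ∑ j ∈ Finset.Iio i, σ j with hB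
  have hB0 : 0 ≤ B := add_nonneg hkl (mul_nonneg k0.le (Finset.sum_nonneg hσ0))
  have key : ∀ η, 0 < η → η ≤ 1 → zDist Θ i (t + k) (P₁ (t + k)) (P₂ (t + k))
      ≤ (1 - k * lam i) * D i + k * (∑ j ∈ Finset.Iio i, σ j * D j)
        + k * disturbance Θ d P₂ i t + ε * k + η * B := by
    intro η hη hη1
    obtain ⟨γ, hγ, hγl⟩ := exists_path_forall_le hΘ ht (P₁ t) (P₂ t) hη
    have hγL : ∀ j, zLength Θ j t γ 0 1 ≤ L := fun j =>
      (hγl j).trans (add_le_add (Finset.single_le_sum (f := D) (fun j _ => hD0 j)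
        (Finset.mem_univ j)) hη1)
    obtain ⟨hI, hball⟩ := hlen t ht _ _ γ hγ L hγL
    have h1 := hk γ hγ fun s hs => mem_closedBall_zero_iff.2 (hball s hs)
    have h2 : (1 - k * lam i) * zLength Θ i t γ 0 1 ≤ (1 - k * lam i) * (D i + η) :=
      mul_le_mul_of_nonneg_left (hγl i) hkl
    have h3 : ∑ j ∈ Finset.Iio i, coupling f Θ i j t γ 0 1
        ≤ ∑ j ∈ Finset.Iio i, σ j * D j + (∑ j ∈ Finset.Iio i, σ j) * η := by
      rw [Finset.sum_mul, ← Finset.sum_add_distrib]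
      refine Finset.sum_le_sum fun j hj => ?_
      have h4 : coupling f Θ i j t γ 0 1 ≤ σ j * zLength Θ j t γ 0 1 := by
        rw [zLength, ← intervalIntegral.integral_const_mul]
        refine intervalIntegral.integral_mono_on zero_le_one
          (((hS.continuous_couplingIntegrand i j ht).comp (f := fun s : ℝ => (γ s, deriv γ s))
            (hγ.smooth.continuous.prodMk hγ.continuous_deriv)).intervalIntegrable _ _)
          ((continuous_const.mul (continuous_along hS j t hγ.smooth)).intervalIntegrable _ _)
          fun s _ => ?_
        exact mul_le_mul_of_nonneg_right (hσ j (Finset.mem_Iio.1 hj) _ t ht) (norm_nonneg _)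
      have h5 := mul_le_mul_of_nonneg_left (hγl j) (hσ0 j hj)
      rw [mul_add] at h5
      exact h4.trans h5
    have h6 : ε / (1 + C * L) * k * (1 + ∫ s in (0 : ℝ)..1, ‖deriv γ s‖) ≤ ε * k := by
      calc ε / (1 + C * L) * k * (1 + ∫ s in (0 : ℝ)..1, ‖deriv γ s‖)
          ≤ ε / (1 + C * L) * k * (1 + C * L) :=
            mul_le_mul_of_nonneg_left (by linarith) (by positivity)
        _ = ε * k := by field_simp
    have h7 := mul_le_mul_of_nonneg_left h3 k0.le
    rw [hB]
    linarith
  have hfin : zDist Θ i (t + k) (P₁ (t + k)) (P₂ (t + k))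
      ≤ (1 - k * lam i) * D i + k * (∑ j ∈ Finset.Iio i, σ j * D j)
        + k * disturbance Θ d P₂ i t + ε * k := by
    refine le_of_forall_pos_le_add fun e he => ?_
    have hB1 : 0 < B + 1 := by linarith
    refine (key (min 1 (e / (B + 1))) (lt_min one_pos (div_pos he hB1)) (min_le_left _ _)).trans
      (add_le_add le_rfl ?_)
    calc min 1 (e / (B + 1)) * B ≤ e / (B + 1) * B :=
          mul_le_mul_of_nonneg_right (min_le_right _ _) hB0
      _ ≤ e / (B + 1) * (B + 1) := mul_le_mul_of_nonneg_left (by linarith) (by positivity)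
      _ = e := by field_simp
  have hDi : zDist Θ i t (P₁ t) (P₂ t) = D i := rfl
  linarith

theorem continuousOn_curve {P : ℝ → State n} {v : ℝ → State n → State n}
    (hP : IsIntegralCurveOn P v (Ici 0)) : ContinuousOn P (Ici 0) :=
  fun t ht => (hP t ht).continuousWithinAt

/-- Straight segments bound the distances uniformly on `[0, T]`; this confines nearly shortest paths
at all these times to one compact set. -/
theorem exists_zDist_bound (hS : IsContractingHierarchy f Θ lam) (hP₁ : ContinuousOn P₁ (Ici 0))
    (hP₂ : ContinuousOn P₂ (Ici 0)) (i : Fin (m + 2)) (T : ℝ) :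
    ∃ M, 0 ≤ M ∧ ∀ t ∈ Icc 0 T, zDist Θ i t (P₁ t) (P₂ t) ≤ M := by
  have hc : ContinuousOn (fun p : ℝ × ℝ =>
      Θ i (P₁ p.1 + p.2 • (P₂ p.1 - P₁ p.1)) p.1 ((P₂ p.1 - P₁ p.1) i))
      (Icc 0 T ×ˢ Icc (0 : ℝ) 1) := by
    have c₁ : ContinuousOn (fun p : ℝ × ℝ => P₁ p.1) (Icc 0 T ×ˢ Icc (0 : ℝ) 1) :=
      hP₁.comp continuousOn_fst fun p hp => hp.1.1
    have c₂ : ContinuousOn (fun p : ℝ × ℝ => P₂ p.1) (Icc 0 T ×ˢ Icc (0 : ℝ) 1) :=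
      hP₂.comp continuousOn_fst fun p hp => hp.1.1
    exact ((hS.continuous_theta i).comp_continuousOn
      (f := fun p : ℝ × ℝ => (P₁ p.1 + p.2 • (P₂ p.1 - P₁ p.1), p.1))
      ((c₁.add (continuousOn_snd.smul (c₂.sub c₁))).prodMk continuousOn_fst)).clm_apply
      (continuousOn_pi.1 (c₂.sub c₁) i)
  obtain ⟨M, hM⟩ := (isCompact_Icc.prod isCompact_Icc).exists_bound_of_continuousOn hc
  exact ⟨|M|, abs_nonneg M, fun t ht => zDist_le_of_line hS i t _ _ fun s hs =>
    (hM (t, s) ⟨ht, hs⟩).trans (le_abs_self M)⟩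

/-- A path nearly shortest at time `t` has almost the same length at a nearby time `t'`, by uniform
continuity of `Θ i`, and moving its end points costs little. It must be short for all groups at once
to stay in a fixed compact set, whence the separate metrics. -/
theorem continuousOn_zDist (hS : IsContractingHierarchy f Θ lam)
    (hΘ : ∀ i (x y : State n) t, 0 ≤ t → x i = y i → Θ i x t = Θ i y t)
    (hP₁ : ContinuousOn P₁ (Ici 0)) (hP₂ : ContinuousOn P₂ (Ici 0)) (i : Fin (m + 2)) :
    ContinuousOn (fun t => zDist Θ i t (P₁ t) (P₂ t)) (Ici 0) := by
  intro t₀ ht₀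
  have ht₀' : 0 ≤ t₀ := ht₀
  obtain ⟨C, hC, hlen⟩ := exists_length_const hS
  choose M hM0 hM using fun j => exists_zDist_bound hS hP₁ hP₂ j (t₀ + 1)
  set L := ∑ j, M j + 1 with hL
  have hL0 : 0 ≤ L := add_nonneg (Finset.sum_nonneg fun j _ => hM0 j) zero_le_one
  have hCL : 0 ≤ C * L := mul_nonneg hC hL0
  obtain ⟨r, hr⟩ := isCompact_Icc.exists_bound_of_continuousOn
    (hP₁.mono (Icc_subset_Ici_self : Icc 0 (t₀ + 1) ⊆ Ici 0))
  set K := Metric.closedBall (0 : State n) (r + C * L) with hK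
  have huc := ((isCompact_closedBall (0 : State n) (r + C * L)).prod
    (isCompact_Icc (a := 0) (b := t₀ + 1))).uniformContinuousOn_of_continuous
      (hS.continuous_theta i).continuousOn
  have key : ∀ ε > 0, ∃ δ > 0, ∀ t t', 0 ≤ t → 0 ≤ t' → dist t t₀ < δ → dist t' t₀ < δ →
      zDist Θ i t' (P₁ t') (P₂ t') ≤ zDist Θ i t (P₁ t) (P₂ t) + ε := by
    intro ε hε
    have hloc : ∀ P : ℝ → State n, ContinuousOn P (Ici 0) → ∃ δ > 0, ∀ t t' τ, 0 ≤ t → 0 ≤ t' →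
        dist τ t₀ < δ → dist t t₀ < δ → dist t' t₀ < δ → zDist Θ i τ (P t) (P t') ≤ ε / 4 := by
      intro P hP
      obtain ⟨δ₁, hδ₁, H₁⟩ := exists_local_zDist_le hS i (P t₀) t₀ one_pos
      set A := ‖Θ i (P t₀) t₀‖ + 1 with hA
      have hA0 : 0 < A := by positivity
      obtain ⟨δ₂, hδ₂, H₂⟩ := Metric.continuousWithinAt_iff.1 (hP t₀ ht₀)
        (min δ₁ (ε / 8 / A)) (lt_min hδ₁ (by positivity))
      refine ⟨min δ₁ δ₂, lt_min hδ₁ hδ₂, fun t t' τ h0 h0' hτ ht ht' => ?_⟩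
      have d₁ := H₂ h0 (ht.trans_le (min_le_right _ _))
      have d₂ := H₂ h0' (ht'.trans_le (min_le_right _ _))
      have h1 := H₁ τ (P t) (P t') (hτ.trans_le (min_le_left _ _))
        (d₁.trans_le (min_le_left _ _)) (d₂.trans_le (min_le_left _ _))
      have h2 : ‖P t' - P t‖ ≤ ε / 8 / A + ε / 8 / A := by
        rw [← dist_eq_norm]
        refine (dist_triangle_right _ _ (P t₀)).trans (add_le_add ?_ ?_)
        · exact (d₂.trans_le (min_le_right _ _)).le
        · exact (d₁.trans_le (min_le_right _ _)).le
      have h3 : ‖Θ i (P t₀) t₀ ((P t' - P t) i)‖ ≤ ‖Θ i (P t₀) t₀‖ * ‖P t' - P t‖ :=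
        ((Θ i (P t₀) t₀).le_opNorm _).trans
          (mul_le_mul_of_nonneg_left (norm_le_pi_norm _ i) (norm_nonneg _))
      have h4 : A * ‖P t' - P t‖ ≤ ε / 4 := by
        calc A * ‖P t' - P t‖ ≤ A * (ε / 8 / A + ε / 8 / A) :=
              mul_le_mul_of_nonneg_left h2 hA0.le
          _ = ε / 4 := by field_simp; ring
      rw [hA] at h4
      linarith
    obtain ⟨δ₁, hδ₁, H₁⟩ := hloc P₁ hP₁
    obtain ⟨δ₂, hδ₂, H₂⟩ := hloc P₂ hP₂
    have hε' : 0 < ε / 4 / (C * L + 1) := by positivity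
    obtain ⟨δ₃, hδ₃, H₃⟩ := Metric.uniformContinuousOn_iff_le.1 huc _ hε'
    refine ⟨min (min δ₁ δ₂) (min (δ₃ / 2) 1), by positivity, fun t t' h0 h0' ht ht' => ?_⟩
    simp only [lt_min_iff] at ht ht'
    have hT : ∀ τ, 0 ≤ τ → dist τ t₀ < 1 → τ ∈ Icc 0 (t₀ + 1) := fun τ hτ hd =>
      ⟨hτ, by rw [Real.dist_eq] at hd; linarith [(abs_lt.1 hd).2]⟩
    have htT := hT t h0 ht.2.2
    have htT' := hT t' h0' ht'.2.2
    have htt : dist t' t ≤ δ₃ := by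
      have := dist_triangle_right t' t t₀
      linarith [ht.2.1, ht'.2.1]
    set η := min 1 (ε / 4) with hη
    obtain ⟨γ, hγ, hγl⟩ := exists_path_forall_le hΘ h0 (P₁ t) (P₂ t)
      (lt_min one_pos (by positivity) : 0 < η)
    have hγL : ∀ j, zLength Θ j t γ 0 1 ≤ L := fun j =>
      (hγl j).trans (add_le_add ((hM j t htT).trans (Finset.single_le_sum (f := M)
        (fun j _ => hM0 j) (Finset.mem_univ j))) (min_le_left _ _))
    obtain ⟨hI, hball⟩ := hlen t h0 _ _ γ hγ L hγL
    have hlen' : zLength Θ i t' γ 0 1 ≤ zLength Θ i t γ 0 1 + ε / 4 := by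
      -- The empty index set removes the coupling term, which has no role when only the metric
      -- changes.
      have h1 := integral_le_of_le_linear (T := (∅ : Finset (Fin 0))) (c₁ := 1) (c₂ := 0)
        (c₃ := ε / 4 / (C * L + 1)) zero_le_one
        (continuous_along hS i t' hγ.smooth).continuousOn
        (continuous_along hS i t hγ.smooth).continuousOn hγ.continuous_deriv.norm.continuousOn
        (q := fun _ _ => 0) (fun _ => continuousOn_const) fun s hs => by
          have hsK : γ s ∈ K := mem_closedBall_zero_iff.2 ((hball s hs).trans
            (add_le_add (hr t htT) le_rfl))
          have h2 := H₃ (γ s, t') ⟨hsK, htT'⟩ (γ s, t) ⟨hsK, htT⟩ (by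
            rw [Prod.dist_eq, dist_self]
            exact max_le hδ₃.le htt)
          rw [dist_eq_norm] at h2
          have h3 := (Θ i (γ s) t' - Θ i (γ s) t).le_of_opNorm_le h2 (deriv γ s i)
          rw [sub_apply] at h3
          have h4 := norm_le_norm_add_norm_sub' (Θ i (γ s) t' (deriv γ s i))
            (Θ i (γ s) t (deriv γ s i))
          have h5 := mul_le_mul_of_nonneg_left (norm_le_pi_norm (deriv γ s) i) hε'.le
          simp only [Finset.sum_empty, mul_zero, add_zero, one_mul]
          linarith
      simp only [Finset.sum_empty, mul_zero, add_zero, one_mul] at h1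
      refine h1.trans (add_le_add le_rfl ?_)
      calc ε / 4 / (C * L + 1) * ∫ s in (0 : ℝ)..1, ‖deriv γ s‖
          ≤ ε / 4 / (C * L + 1) * (C * L + 1) :=
            mul_le_mul_of_nonneg_left (by linarith) hε'.le
        _ = ε / 4 := by field_simp
    have g₁ := H₁ t' t t' h0' h0 ht'.1.1 ht'.1.1 ht.1.1
    have g₂ := H₂ t t' t' h0 h0' ht'.1.2 ht.1.2 ht'.1.2
    have g₃ := zDist_triangle hS i t' (P₁ t') (P₁ t) (P₂ t')
    have g₄ := zDist_triangle hS i t' (P₁ t) (P₂ t) (P₂ t')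
    have g₅ := zDist_le_zLength (Θ := Θ) i t' hγ
    have g₆ := hγl i
    have g₇ : η ≤ ε / 4 := min_le_right _ _
    linarith
  refine Metric.continuousWithinAt_iff.2 fun ε hε => ?_
  obtain ⟨δ, hδ, H⟩ := key (ε / 2) (half_pos hε)
  refine ⟨δ, hδ, fun t ht hd => ?_⟩
  -- The estimate is symmetric in the two times, so it yields upper and lower semicontinuity
  -- together.
  have a₁ := H t t₀ ht ht₀ hd (by simpa using hδ)
  have a₂ := H t₀ t ht₀ ht (by simpa using hδ) hd
  rw [Real.dist_eq, abs_lt]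
  constructor <;> linarith

theorem shortestPath_bounds (hS : IsContractingHierarchy f Θ lam)
    (hP₁ : IsIntegralCurveOn P₁ (fun t x => f x t) (Ici 0))
    (hP₂ : IsIntegralCurveOn P₂ (fun t x => f x t + d x t) (Ici 0))
    (hd : ContinuousOn (fun t => d (P₂ t) t) (Ici 0))
    (hΘ : ∀ i (x y : State n) t, 0 ≤ t → x i = y i → Θ i x t = Θ i y t)
    {R : Fin (m + 2) → ℝ → ℝ} (hR : ∀ i t, R i t = zDist Θ i t (P₁ t) (P₂ t)) :
    (∀ i, ContinuousOn (R i) (Ici 0)) ∧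
      (∀ i t, 0 ≤ t → ∀ γ : ℝ → State n, IsPath γ (P₁ t) (P₂ t) →
        zLength Θ i t γ 0 1 = R i t →
        upperDini (R i) t + ((lam i * R i t : ℝ) : EReal) ≤
          ((disturbance Θ d P₂ i t + ∑ j ∈ Finset.Iio i,
            coupling f Θ i j t γ 0 1 : ℝ) : EReal)) ∧
      (∀ i (σ : Fin (m + 2) → ℝ),
        (∀ j < i, ∀ x t, 0 ≤ t → ‖jacBlock f Θ i j x t‖ ≤ σ j) → ∀ t, 0 ≤ t →
        upperDini (R i) t + ((lam i * R i t : ℝ) : EReal) ≤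
          ((disturbance Θ d P₂ i t + ∑ j ∈ Finset.Iio i, σ j * R j t : ℝ) : EReal)) ∧
      ErrorBounds f Θ lam d P₂ R (fun i t => ‖P₂ t i - P₁ t i‖) := by
  obtain rfl : R = fun i t => zDist Θ i t (P₁ t) (P₂ t) :=
    funext fun i => funext fun t => hR i t
  have hc := continuousOn_zDist hS hΘ (continuousOn_curve hP₁) (continuousOn_curve hP₂)
  have hD := fun i (σ : Fin (m + 2) → ℝ)
    (hσ : ∀ j < i, ∀ x t, 0 ≤ t → ‖jacBlock f Θ i j x t‖ ≤ σ j) (t : ℝ) (ht : 0 ≤ t) =>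
      upperDini_zDist_le hS hΘ hP₁ hP₂ i σ hσ ht
  exact ⟨hc, fun i t ht γ hγ hmin => upperDini_zDist_le_coupling hS hP₁ hP₂ i ht hγ hmin, hD,
    errorBounds_of_upperDini hS.rate_pos (continuousOn_disturbance hS hP₂ hd) hc
      (fun i t _ => zDist_nonneg i t _ _) hD
      fun i c h0 hb t ht => norm_sub_le_zDist hS h0 (fun x v => hb x t ht v) _ _⟩

end ShortestPath

end Hierarchy

theorem mainTheorem6 {m : ℕ} {n : Fin (m + 2) → ℕ}
    (f : Hierarchy.State n → ℝ → Hierarchy.State n) (Θ : Hierarchy.Transformation n)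
    (lam : Fin (m + 2) → ℝ) (hS : Hierarchy.IsContractingHierarchy f Θ lam)
    (d : Hierarchy.State n → ℝ → Hierarchy.State n) (P₁ P₂ : ℝ → Hierarchy.State n)
    (hP₁ : IsIntegralCurveOn P₁ (fun t x => f x t) (Ici 0))
    (hP₂ : IsIntegralCurveOn P₂ (fun t x => f x t + d x t) (Ici 0))
    (hd : ContinuousOn (fun t => d (P₂ t) t) (Ici 0)) :
    -- path lengths along a path that is carried along by the flow
    (∀ x : ℝ → ℝ → Hierarchy.State n, Hierarchy.IsTransportedPath f P₁ P₂ x →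
      ∀ R : Fin (m + 2) → ℝ → ℝ,
      (∀ i t, R i t = Hierarchy.zLength Θ i t (fun s => x s t) (-1) t) →
        (∀ i, ContinuousOn (R i) (Ici 0)) ∧
        (∀ i t, 0 ≤ t →
          Hierarchy.upperDini (R i) t + ((lam i * R i t : ℝ) : EReal) ≤
            ((Hierarchy.disturbance Θ d P₂ i t + ∑ j ∈ Finset.Iio i,
              Hierarchy.coupling f Θ i j t (fun s => x s t) (-1) t : ℝ) : EReal)) ∧
        Hierarchy.ErrorBounds f Θ lam d P₂ R
          (fun i t => Hierarchy.xLength i (fun s => x s t) (-1) t)) ∧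
    -- smallest path integrals, when each group has a metric on its own state space
    ((∀ i (x y : Hierarchy.State n) t, 0 ≤ t → x i = y i → Θ i x t = Θ i y t) →
      ∀ R : Fin (m + 2) → ℝ → ℝ,
      (∀ i t, R i t = Hierarchy.zDist Θ i t (P₁ t) (P₂ t)) →
        (∀ i, ContinuousOn (R i) (Ici 0)) ∧
        (∀ i t, 0 ≤ t → ∀ γ : ℝ → Hierarchy.State n, Hierarchy.IsPath γ (P₁ t) (P₂ t) →
          Hierarchy.zLength Θ i t γ 0 1 = R i t →
          Hierarchy.upperDini (R i) t + ((lam i * R i t : ℝ) : EReal) ≤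
            ((Hierarchy.disturbance Θ d P₂ i t + ∑ j ∈ Finset.Iio i,
              Hierarchy.coupling f Θ i j t γ 0 1 : ℝ) : EReal)) ∧
        (∀ i (σ : Fin (m + 2) → ℝ),
          (∀ j < i, ∀ x t, 0 ≤ t → ‖Hierarchy.jacBlock f Θ i j x t‖ ≤ σ j) →
          ∀ t, 0 ≤ t →
          Hierarchy.upperDini (R i) t + ((lam i * R i t : ℝ) : EReal) ≤
            ((Hierarchy.disturbance Θ d P₂ i t + ∑ j ∈ Finset.Iio i, σ j * R j t : ℝ) : EReal)) ∧
        Hierarchy.ErrorBounds f Θ lam d P₂ R (fun i t => ‖P₂ t i - P₁ t i‖)) := by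
  exact ⟨fun x hx R hR => Hierarchy.transportedPath_bounds hS hP₂ hd hx hR,
    fun hΘ R hR => Hierarchy.shortestPath_bounds hS hP₁ hP₂ hd hΘ hR⟩
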